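/- **Corollary 3.10.** *Model.* Let $k\ge 1$, $r\ge 0$ be integers and $K,\sigma_Y>0$. Let $(X,Y)\in\mathbb R^d\times\mathbb R$ have joint law $P_{X,Y}$ with $X\sim N(0,I_d)$ and $\mathbb E|Y|<\infty$. A subspace $W\subseteq\mathbb R^d$ is a mean dimension-reduction subspace if $\mathbb E[Y\mid X]$ is almost surely a Borel function of the orthogonal projection of $X$ to $W$; the central mean subspace $\mathcal U$ is the intersection of all of them, provided that it is itself one. Assume that $\mathcal U$ exists and has dimension $k$, let the columns of $U\in\mathbb R^{d\times k}$ be an orthonormal basis of $\mathcal U$, and assume that $\mathbb E[Y\mid X]=f(U^{\mathsf T}X)$ almost surely, where $f:\mathbb R^k\to\mathbb R$ is a polynomial of degree at most $r$ with $\mathbb E_{Z\sim N(0,I_k)}[f(Z)^2]=1$, and that for almost every $x$ and all $t>0$ $$\mathbb P\big(|Y-\mathbb E[Y\mid X=x]|>t\,\big|\,X=x\big)\le K\exp\!\big(-t^2/(2\sigma_Y^2)\big).$$ Let $\tau:=\min_{\eta\in\mathbb R^k,\ \|\eta\|=1}\mathbb E_{Z\sim N(0,I_k)}[(\eta^{\mathsf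 T}\nabla f(Z))^2]$. *Estimator.* Let $h,\sigma_\theta>0$, let $m\ge1$ be an integer and let $n=2dm$ (that is, $m=n/(2d)$). Draw i.i.d. $\theta_1,\dots,\theta_m\sim N(0,\sigma_\theta^2I_d)$ and, independently, an i.i.d. sample of size $n$ from $P_{X,Y}$; split the sample (in a way fixed in advance) into $2m$ parts $D_{j,\ell}$, $j\le m$, $\ell\in\{1,2\}$, of equal size. Let $\varphi_s$ be the density of $N(0,s^2I_d)$, let $\rho_h(x;\theta)=\varphi_h(x-\theta)/\varphi_1(x)$, and put $$\hat\beta_{j,\ell}=\frac{h^{-2}}{|D_{j,\ell}|}\sum_{(X,Y)\in D_{j,\ell}}\rho_h(X;\theta_j)\,Y\,(X-\theta_j),\qquad \widehat M=\frac1{2m}\sum_{j=1}^m\big(\hat\beta_{j,1}\hat\beta_{j,2}^{\mathsf T}+\hat\beta_{j,2}\hat\beta_{j,1}^{\mathsf T}\big).$$ Let the columns of $\widehat U\in\mathbb R^{d\times k}$ be orthonormal eigenvectors of $\widehat M$ for its $k$ largest eigenvalues (ties resolved arbitrarily), and let $d(\widehat U,U)=\min_R\|\widehat UR-U\|_{\mathrm{op}}$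 over orthogonal $R\in\mathbb R^{k\times k}$. *Factors.* For $0<s<1/20$ and $0<h<\sqrt5/2$ let $$A_{s,d,r}=s^{-(r-1)}(1-20s)^{-d/2},\qquad B_{h,d,r}=\max\{h^{-2r+1},h^{r-1}\}\,(5h^8-4h^{10})^{-d/6}.$$ *Claims.* (1) There is $C_2>0$, depending only on $k,r,K,\sigma_Y$, such that for all models as above with $(d,k)\neq(2,1)$, all $0<h<\sqrt5/2$, $0<\sigma_\theta<h/\sqrt{20}$, $0<\delta<1$ and all $m\ge1$, $n=2dm$, with probability at least $1-\delta$, $$d(\widehat U,U)\le C_2\,A_{\sigma_\theta^2/h^2,d,r}\,B_{h,d,r}\,\frac{d}{\tau\sqrt n}\cdot\frac{\log(8d/\delta)}{\sqrt\delta}.$$ (2) If $r\ge2$ and $d\ge1$, then $s_*:=\frac{r-1}{20(r-1)+10d}$ minimizes $s\mapsto A_{s,d,r}$ over $0<s<1/20$, and $h=1$ minimizes $h\mapsto B_{h,d,r}$ over $0<h<\sqrt5/2$. (3) There are $c_3,C_3>0$, depending only on $k,r,K,\sigma_Y$, such that for all $d\ge1$, with $h=1$ and $\sigma_\theta^2=s_*$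 if $r\ge2$, respectively any $0<\sigma_\theta^2\le 1/(20+10d)$ if $r=1$ (where no minimizer exists), $$c_3\,d^r\le A_{\sigma_\theta^2,d,r}\,B_{1,d,r}\,d\le C_3\,d^r,$$ and for all models as above, all $0<\delta<1$, $m\ge1$ and $n=2dm$, with probability at least $1-\delta$, $$d(\widehat U,U)\le \frac{C_3\,d^r}{\tau\sqrt n}\cdot\frac{\log(8d/\delta)}{\sqrt\delta}.$$ -/

import Mathlib

open MeasureTheory ProbabilityTheory

noncomputable section

namespace CMS

/-- `ℝ^d` with its Euclidean norm. -/
abbrev Vec (d : ℕ) : Type := EuclideanSpace ℝ (Fin d)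

/-- The Gaussian law `N(0, s² I_d)` on `ℝ^d`. -/
def gaussianLaw (d : ℕ) (s : ℝ) : Measure (Vec d) :=
  (stdGaussian (Vec d)).map (fun x => s • x)

/-- The Lebesgue density of `N(0, s² I_d)` at `x` (for `s > 0`). -/
def gaussianDensity (d : ℕ) (s : ℝ) (x : Vec d) : ℝ :=
  (2 * Real.pi * s ^ 2) ^ (-(d : ℝ) / 2) * Real.exp (-‖x‖ ^ 2 / (2 * s ^ 2))

/-! ### The regression function and the central mean subspace -/

/-- The regression function `x ↦ E[Y | X = x]` of the joint law `P` of `(X, Y)`. -/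
def regressionFun {d : ℕ} (P : Measure (Vec d × ℝ)) [IsFiniteMeasure P] (x : Vec d) : ℝ :=
  ∫ y, y ∂(P.condKernel x)

/-- `W` is a mean dimension-reduction subspace: `E[Y | X]` is almost surely a (Borel) function of
the orthogonal projection of `X` to `W`, i.e. of the coordinates of that projection in a basis. -/
def IsMeanDimReduction {d : ℕ} (P : Measure (Vec d × ℝ)) [IsFiniteMeasure P]
    (W : Submodule ℝ (Vec d)) : Prop :=
  ∃ φ : Vec d → ℝ, Measurable φ ∧ ∀ᵐ x ∂P.fst, regressionFun P x = φ (W.starProjection x)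

/-- `S` is the central mean subspace: it is the intersection of all mean dimension-reduction
subspaces, and this intersection is itself a mean dimension-reduction subspace. -/
def IsCentralMeanSubspace {d : ℕ} (P : Measure (Vec d × ℝ)) [IsFiniteMeasure P]
    (S : Submodule ℝ (Vec d)) : Prop :=
  S = sInf {W : Submodule ℝ (Vec d) | IsMeanDimReduction P W} ∧ IsMeanDimReduction P S

/-- The column space of a `d × k` matrix. -/
def colSpace {d k : ℕ} (U : Matrix (Fin d) (Fin k) ℝ) : Submodule ℝ (Vec d) :=
  Submodule.span ℝ (Set.range fun j : Fin k => (WithLp.toLp 2 fun i => U i j : Vec d))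

/-- The index vector `Uᵀ x`. -/
def index {d k : ℕ} (U : Matrix (Fin d) (Fin k) ℝ) (x : Vec d) : Vec k :=
  WithLp.toLp 2 (Matrix.mulVec U.transpose x.ofLp)

/-- The polynomial multi-index model: `P` is the joint law of `(X, Y)`, the columns of `U` are an
orthonormal basis of the central mean subspace, `f` is the link function, `r` bounds its degree,
and `K`, `σY` are the constants of the subgaussian tail of the noise. -/
structure PolynomialModel {d k : ℕ} (r : ℕ) (K σY : ℝ) (P : Measure (Vec d × ℝ))
    [IsProbabilityMeasure P] (U : Matrix (Fin d) (Fin k) ℝ) (f : Vec k → ℝ) : Prop where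
  /-- `X` is a standard Gaussian vector. -/
  design : P.fst = gaussianLaw d 1
  /-- `Y` has an expectation. -/
  integrable : Integrable (fun z : Vec d × ℝ => z.2) P
  orthonormal : U.transpose * U = 1
  centralMeanSubspace : IsCentralMeanSubspace P (colSpace U)
  /-- `E[Y | X] = f (Uᵀ X)` almost surely. -/
  regression : ∀ᵐ x ∂P.fst, regressionFun P x = f (index U x)
  polynomial : ∃ q : MvPolynomial (Fin k) ℝ, q.totalDegree ≤ r ∧
    ∀ z : Vec k, f z = MvPolynomial.eval z.ofLp q
  normalized : ∫ z, f z ^ 2 ∂(gaussianLaw k 1) = 1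
  /-- `P(|Y - E[Y | X = x]| > t | X = x) ≤ K exp(-t² / (2 σY²))`. -/
  noise : ∀ᵐ x ∂P.fst, ∀ t : ℝ, 0 < t →
    P.condKernel x {y : ℝ | t < |y - regressionFun P x|} ≤
      ENNReal.ofReal (K * Real.exp (-t ^ 2 / (2 * σY ^ 2)))

/-- The minimum signal strength: the minimum over unit vectors `η` of
`E_{Z ∼ N(0, I_k)} [(ηᵀ ∇f(Z))²]`. -/
def minSignal {k : ℕ} (f : Vec k → ℝ) : ℝ :=
  ⨅ η : Metric.sphere (0 : Vec k) 1, ∫ z, inner ℝ (η : Vec k) (gradient f z) ^ 2 ∂(gaussianLaw k 1)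

/-! ### The estimator -/

/-- The density ratio `ρ_h(x; θ) = φ_h(x - θ) / p(x)`, where `p` is the density of the design. -/
def densityRatio {d : ℕ} (p : Vec d → ℝ) (h : ℝ) (x θ : Vec d) : ℝ :=
  gaussianDensity d h (x - θ) / p x

/-- The estimate of the smoothed gradient at `θ` from the observations with index in `D`. -/
def gradEstimate {d n : ℕ} (p : Vec d → ℝ) (h : ℝ) (θ : Vec d) (data : Fin n → Vec d × ℝ)
    (D : Finset (Fin n)) : Vec d :=
  (h ^ (-2 : ℤ) / (D.card : ℝ)) •
    ∑ i ∈ D, (densityRatio p h (data i).1 θ * (data i).2) • ((data i).1 - θ)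

/-- A division of the `n` observations into `2 m` parts `D_{j,ℓ}` of equal size: observation `i`
goes to the part with label `part i`. -/
def IsEqualSplit {n m : ℕ} (part : Fin n → Fin m × Fin 2) : Prop :=
  ∀ a b : Fin m × Fin 2,
    (Finset.univ.filter fun i => part i = a).card = (Finset.univ.filter fun i => part i = b).card

/-- The gradient estimate at `θ_j` from the part `D_{j,ℓ}` of the data. -/
def splitGradEstimate {d n m : ℕ} (p : Vec d → ℝ) (h : ℝ) (part : Fin n → Fin m × Fin 2)
    (θ : Fin m → Vec d) (data : Fin n → Vec d × ℝ) (j : Fin m) (l : Fin 2) : Vec d :=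
  gradEstimate p h (θ j) data (Finset.univ.filter fun i => part i = (j, l))

/-- The matrix `(2m)⁻¹ ∑ j, (β_{j,1} β_{j,2}ᵀ + β_{j,2} β_{j,1}ᵀ)`. -/
def estMatrix {d n m : ℕ} (p : Vec d → ℝ) (h : ℝ) (part : Fin n → Fin m × Fin 2)
    (θ : Fin m → Vec d) (data : Fin n → Vec d × ℝ) : Matrix (Fin d) (Fin d) ℝ :=
  (1 / (2 * (m : ℝ))) • ∑ j : Fin m,
    (Matrix.vecMulVec (splitGradEstimate p h part θ data j 0).ofLp
        (splitGradEstimate p h part θ data j 1).ofLp +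
      Matrix.vecMulVec (splitGradEstimate p h part θ data j 1).ofLp
        (splitGradEstimate p h part θ data j 0).ofLp)

/-- The columns of `V` are orthonormal top-`k` eigenvectors of `M`: they are the first `k` columns
of a spectral decomposition `M = Q diag(ev) Qᵀ` with `Q` orthogonal and `ev` decreasing. -/
def IsTopEigenvectors {d k : ℕ} (M : Matrix (Fin d) (Fin d) ℝ) (V : Matrix (Fin d) (Fin k) ℝ) :
    Prop :=
  ∃ (hk : k ≤ d) (Q : Matrix (Fin d) (Fin d) ℝ) (ev : Fin d → ℝ),
    Q ∈ Matrix.orthogonalGroup (Fin d) ℝ ∧ Antitone ev ∧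
      M = Q * Matrix.diagonal ev * Q.transpose ∧ V = Q.submatrix id (Fin.castLE hk)

/-- The operator norm of a matrix with respect to the Euclidean norms. -/
def opNorm {d k : ℕ} (M : Matrix (Fin d) (Fin k) ℝ) : ℝ :=
  ‖LinearMap.toContinuousLinearMap (Matrix.toEuclideanLin M)‖

/-- The distance with optimal rotation, `min_R ‖V R - U‖` over orthogonal `k × k` matrices `R`. -/
def rotDist {d k : ℕ} (V U : Matrix (Fin d) (Fin k) ℝ) : ℝ :=
  ⨅ R : Matrix.orthogonalGroup (Fin k) ℝ, opNorm (V * (R : Matrix (Fin k) (Fin k) ℝ) - U)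

/-- The joint law of the locations `θ_1, …, θ_m`, i.i.d. from `N(0, σθ² I_d)`, and of an
independent i.i.d. sample of size `n` from `P`. -/
def samplingLaw {d : ℕ} (n m : ℕ) (σθ : ℝ) (P : Measure (Vec d × ℝ)) :
    Measure ((Fin m → Vec d) × (Fin n → Vec d × ℝ)) :=
  (Measure.pi fun _ : Fin m => gaussianLaw d σθ).prod (Measure.pi fun _ : Fin n => P)

/-- With probability at least `1 - δ`, the estimator with standard Gaussian design density has
error at most `ε`, however ties between eigenvectors are resolved: the event that some choice
of top-`k` eigenvectors has error larger than `ε` has (outer) measure at most `δ`. -/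
def ErrorBound {d k n m : ℕ} (P : Measure (Vec d × ℝ)) (U : Matrix (Fin d) (Fin k) ℝ)
    (part : Fin n → Fin m × Fin 2) (h σθ δ ε : ℝ) : Prop :=
  samplingLaw n m σθ P
    {ω | ∃ V : Matrix (Fin d) (Fin k) ℝ,
      IsTopEigenvectors (estMatrix (gaussianDensity d 1) h part ω.1 ω.2) V ∧
        ε < rotDist V U} ≤ ENNReal.ofReal δ

/-! ### The explicit factors -/

/-- `A_{s,d,r} = s^{-(r-1)} (1 - 20 s)^{-d/2}`. -/
def factorA (s : ℝ) (d r : ℕ) : ℝ :=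
  s ^ (-((r : ℝ) - 1)) * (1 - 20 * s) ^ (-(d : ℝ) / 2)

/-- `B_{h,d,r} = max {h^{-2r+1}, h^{r-1}} (5 h^8 - 4 h^10)^{-d/6}`. -/
def factorB (h : ℝ) (d r : ℕ) : ℝ :=
  max (h ^ (-2 * (r : ℝ) + 1)) (h ^ ((r : ℝ) - 1)) * (5 * h ^ 8 - 4 * h ^ 10) ^ (-(d : ℝ) / 6)

/-- The optimal value `(r - 1) / (20 (r - 1) + 10 d)` of the ratio `σθ² / h²`, for `r ≥ 2`. -/
def optRatio (d r : ℕ) : ℝ :=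
  ((r : ℝ) - 1) / (20 * ((r : ℝ) - 1) + 10 * (d : ℝ))

end CMS

end

/-!
The estimate `M̂` is an average of `m` products of two independent gradient estimates at random
locations `θ_j`. Given `θ`, a gradient estimate from the standard Gaussian design has mean
`b(θ) = U E[∇f(Uᵀθ + h Z)]`: the density ratio turns the design into `N(θ, h² I)`, Stein's identity
turns the factor `h⁻² (X - θ)` into a gradient, and a reflection argument shows that the components
orthogonal to the columns of `U` vanish. Hence `M̂` is an unbiased estimate of
`M = E[b(θ) b(θ)ᵀ] = U B Uᵀ`, and the proof compares its fluctuation with the smallest eigenvalue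
of `B`.

*Fluctuation.* The `m` products are uncorrelated. Given `θ`, the squared Frobenius norm of each has
mean at most the square of `‖b(θ)‖² + V(θ) / d`, where `V(θ)` is the second moment of the term of
one observation; the factor `1 / d` comes from the `d` observations in each part and balances the
dimension of the noise. Completing squares in the Gaussian density ratio bounds this
by an explicit envelope in `θ`, whose second moment gives
`E‖M̂ - M‖_F² ≤ C (1 / m) h⁻⁴ (h² (2 - h²))^{-d} (1 - 20 s)^{-d/2}` with `s = σθ² / h²`
(`lintegral_estMatrix_sub_sq_le_explicit`).

*Signal.* For a unit vector `η`, the quantity `ηᵀ B η` is the second moment of the polynomial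
`ηᵀ∇f` smoothed at scale `h` and sampled at scale `σθ`. Gaussian smoothing is injective on the
finite-dimensional space of polynomials of degree at most `r - 1`, and rescaling the argument costs
at most a power of the scale, so that `ηᵀ B η ≥ c (s^{(r-1)/2} min(1, h)^{r-1})² τ`
(`exists_popIndexMatrix_lower_bound`). Here `τ > 0`, since a direction in which `f` does not vary
could be removed from the central mean subspace (`minSignal_pos`).

*Conclusion.* Ky Fan's maximum principle yields a Davis-Kahan bound for the distance with optimal
rotation (`rotDist_sq_le`), and Chebyshev's inequality gives the error bound. The dependence on `h`
is dominated by `B_{h,d,r}` when `d ≥ 3` (`variance_factor_le`), or when `h = 1`; for `d ≤ 2` and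
`(d, k) ≠ (2, 1)` the central mean subspace is the whole space and the error vanishes. The factors
are minimized by elementary inequalities: `log t ≤ t - 1` for `A`, and `5 u⁴ - 4 u⁵ ≤ 1` for `B`.
-/


open MeasureTheory ProbabilityTheory
open scoped ENNReal

noncomputable section

namespace CMS

/-! ### Gaussian laws and their densities -/

lemma measurable_gaussianDensity (d : ℕ) (s : ℝ) : Measurable (gaussianDensity d s) := by
  unfold gaussianDensity; fun_prop

lemma gaussianDensity_pos (d : ℕ) {s : ℝ} (hs : 0 < s) (x : Vec d) : 0 < gaussianDensity d s x := by
  unfold gaussianDensity; positivity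

instance isProbabilityMeasure_gaussianLaw (d : ℕ) (s : ℝ) :
    IsProbabilityMeasure (gaussianLaw d s) :=
  Measure.isProbabilityMeasure_map (by fun_prop)

lemma gaussianLaw_one (d : ℕ) : gaussianLaw d 1 = stdGaussian (Vec d) := by
  simp [gaussianLaw]

lemma charFun_gaussianLaw (d : ℕ) (s : ℝ) (t : Vec d) :
    charFun (gaussianLaw d s) t = Complex.exp (-(s ^ 2 * ‖t‖ ^ 2) / 2) := by
  rw [gaussianLaw, charFun_map_smul, charFun_stdGaussian, norm_smul]
  congr 1
  push_cast
  rw [mul_pow, ← Complex.ofReal_pow ‖s‖, Real.norm_eq_abs, sq_abs]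
  push_cast
  ring

lemma integral_cexp_gaussianDensity (d : ℕ) {s : ℝ} (hs : 0 < s) (t : Vec d) :
    ∫ x : Vec d, (gaussianDensity d s x : ℂ) * Complex.exp (inner ℝ x t * Complex.I) =
      Complex.exp (-(s ^ 2 * ‖t‖ ^ 2) / 2) := by
  have key := GaussianFourier.integral_cexp_neg_mul_sq_norm_add (V := Vec d)
    (b := ((1 / (2 * s ^ 2) : ℝ) : ℂ)) (by rw [Complex.ofReal_re]; positivity) Complex.I t
  have hfun : ∀ x : Vec d, (gaussianDensity d s x : ℂ) * Complex.exp (inner ℝ x t * Complex.I) =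
      (((2 * Real.pi * s ^ 2) ^ (-(d : ℝ) / 2) : ℝ) : ℂ) *
        Complex.exp (-((1 / (2 * s ^ 2) : ℝ) : ℂ) * ‖x‖ ^ 2 + Complex.I * inner ℝ t x) := by
    intro x
    rw [gaussianDensity, Complex.ofReal_mul, mul_assoc, Complex.ofReal_exp, ← Complex.exp_add,
      real_inner_comm]
    congr 2
    push_cast
    ring
  simp_rw [hfun]
  rw [integral_const_mul, key, finrank_euclideanSpace, Fintype.card_fin, ← mul_assoc]
  have h1 : (Real.pi : ℂ) / ((1 / (2 * s ^ 2) : ℝ) : ℂ) = ((2 * Real.pi * s ^ 2 : ℝ) : ℂ) := by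
    push_cast
    field_simp
  have h2 : ((d : ℂ) / 2) = (((d : ℝ) / 2 : ℝ) : ℂ) := by push_cast; ring
  rw [h1, h2, ← Complex.ofReal_cpow (by positivity), ← Complex.ofReal_mul,
    ← Real.rpow_add (by positivity)]
  rw [show -(d : ℝ) / 2 + (d : ℝ) / 2 = 0 by ring, Real.rpow_zero, Complex.ofReal_one, one_mul]
  congr 1
  rw [Complex.I_sq]
  push_cast
  have : (s : ℂ) ≠ 0 := by exact_mod_cast hs.ne'
  field_simp
  ring

lemma integrable_gaussianDensity (d : ℕ) {s : ℝ} (hs : 0 < s) :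
    Integrable (gaussianDensity d s) := by
  by_contra hcon
  -- Otherwise the Fourier integral at `0` would be the junk value `0` instead of `1`.
  have h := integral_cexp_gaussianDensity d hs 0
  simp only [inner_zero_right, Complex.ofReal_zero, zero_mul, Complex.exp_zero, mul_one, norm_zero,
    ne_eq, OfNat.ofNat_ne_zero, not_false_eq_true, zero_pow, mul_zero, neg_zero, zero_div] at h
  rw [integral_complex_ofReal, integral_undef hcon] at h
  simp at h

lemma gaussianLaw_eq_withDensity (d : ℕ) {s : ℝ} (hs : 0 < s) :
    gaussianLaw d s = volume.withDensity (fun x => ENNReal.ofReal (gaussianDensity d s x)) := by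
  have hfin : IsFiniteMeasure
      (volume.withDensity (fun x : Vec d => ENNReal.ofReal (gaussianDensity d s x))) :=
    isFiniteMeasure_withDensity_ofReal (integrable_gaussianDensity d hs).2
  apply Measure.ext_of_charFun
  ext t
  rw [charFun_gaussianLaw, charFun_apply,
    integral_withDensity_eq_integral_toReal_smul (by
      have := measurable_gaussianDensity d s; fun_prop) (by simp),
    ← integral_cexp_gaussianDensity d hs]
  congr 1
  ext x
  rw [ENNReal.toReal_ofReal (gaussianDensity_pos d hs x).le, Complex.real_smul]

lemma lintegral_gaussianLaw (d : ℕ) (s : ℝ) {F : Vec d → ℝ≥0∞} (hF : Measurable F) :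
    ∫⁻ x, F x ∂(gaussianLaw d s) = ∫⁻ g, F (s • g) ∂(stdGaussian (Vec d)) := by
  rw [gaussianLaw, lintegral_map hF (by fun_prop)]

lemma lintegral_gaussianDensity_sub (d : ℕ) {s : ℝ} (hs : 0 < s) (c : Vec d) {F : Vec d → ℝ≥0∞}
    (hF : Measurable F) :
    ∫⁻ x, ENNReal.ofReal (gaussianDensity d s (x - c)) * F x =
      ∫⁻ g, F (c + s • g) ∂(stdGaussian (Vec d)) := by
  have hm := measurable_gaussianDensity d s
  rw [← lintegral_gaussianLaw d s (F := fun x => F (c + x)) (by fun_prop),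
    gaussianLaw_eq_withDensity d hs, lintegral_withDensity_eq_lintegral_mul _ (by fun_prop)
      (by fun_prop), ← lintegral_add_left_eq_self _ c]
  simp

lemma integral_gaussianDensity_sub (d : ℕ) {s : ℝ} (hs : 0 < s) (c : Vec d) {F : Vec d → ℝ}
    (hF : Measurable F) :
    ∫ x, gaussianDensity d s (x - c) * F x = ∫ g, F (c + s • g) ∂(stdGaussian (Vec d)) := by
  have hm := measurable_gaussianDensity d s
  have h1 : ∫ g, F (c + s • g) ∂(stdGaussian (Vec d)) = ∫ x, F (c + x) ∂(gaussianLaw d s) := by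
    rw [gaussianLaw, integral_map (by fun_prop)
      (Measurable.aestronglyMeasurable (by fun_prop))]
  rw [h1, gaussianLaw_eq_withDensity d hs, integral_withDensity_eq_integral_toReal_smul
    (by fun_prop) (by simp), ← integral_add_left_eq_self _ c]
  congr 1
  ext x
  rw [ENNReal.toReal_ofReal (gaussianDensity_pos d hs x).le]
  simp

/-! ### Importance weights and exponential tilts -/

lemma measurable_densityRatio {d : ℕ} (h : ℝ) :
    Measurable fun q : Vec d × Vec d => densityRatio (gaussianDensity d 1) h q.1 q.2 := by
  unfold densityRatio
  have h1 := measurable_gaussianDensity d 1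
  have h2 := measurable_gaussianDensity d h
  fun_prop

/-- Weighting the standard Gaussian design by `ρ_h(·; θ)` produces the law `N(θ, h² I_d)`. -/
lemma integral_densityRatio_mul {d : ℕ} {h : ℝ} (hh : 0 < h) (θ : Vec d) {F : Vec d → ℝ}
    (hF : Measurable F) :
    ∫ x, densityRatio (gaussianDensity d 1) h x θ * F x ∂(stdGaussian (Vec d)) =
      ∫ g, F (θ + h • g) ∂(stdGaussian (Vec d)) := by
  rw [← integral_gaussianDensity_sub d hh θ hF]
  have hm : Measurable fun x => densityRatio (gaussianDensity d 1) h x θ * F x :=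
    ((measurable_densityRatio h).comp (measurable_id.prodMk measurable_const)).mul hF
  have := integral_gaussianDensity_sub d one_pos 0 hm
  simp only [sub_zero, zero_add, one_smul] at this
  rw [← this]
  congr 1
  ext x
  have := (gaussianDensity_pos d one_pos x).ne'
  rw [densityRatio]
  field_simp

lemma sq_rpow_neg_half_div {d : ℕ} {h : ℝ} (hh : 0 < h) (hh2 : h ^ 2 < 2) :
    ((2 * Real.pi * h ^ 2) ^ (-(d : ℝ) / 2)) ^ 2 / (2 * Real.pi * 1 ^ 2) ^ (-(d : ℝ) / 2) =
      (h ^ 2 * (2 - h ^ 2)) ^ (-(d : ℝ) / 2) *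
        (2 * Real.pi * (√(h ^ 2 / (2 - h ^ 2))) ^ 2) ^ (-(d : ℝ) / 2) := by
  have h2 : 0 < 2 - h ^ 2 := by linarith
  have hp := Real.pi_pos
  rw [Real.sq_sqrt (by positivity), ← Real.mul_rpow (by positivity) (by positivity), sq,
    ← Real.mul_rpow (by positivity) (by positivity), ← Real.div_rpow (by positivity) (by positivity)]
  congr 1
  field_simp

/-- The square of the importance weight against the standard Gaussian design is a multiple of the
law `N((1 + σ²) θ, σ² I_d)` with `σ² = h² / (2 - h²)`. -/
lemma densityRatio_sq_mul {d : ℕ} {h : ℝ} (hh : 0 < h) (hh2 : h ^ 2 < 2) (x θ : Vec d) :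
    densityRatio (gaussianDensity d 1) h x θ ^ 2 * gaussianDensity d 1 x =
      (h ^ 2 * (2 - h ^ 2)) ^ (-(d : ℝ) / 2) * Real.exp (‖θ‖ ^ 2 / (2 - h ^ 2)) *
        gaussianDensity d (√(h ^ 2 / (2 - h ^ 2))) (x - (2 / (2 - h ^ 2)) • θ) := by
  have h2 : 0 < 2 - h ^ 2 := by linarith
  have hpos := (gaussianDensity_pos d one_pos x).ne'
  have e1 : densityRatio (gaussianDensity d 1) h x θ ^ 2 * gaussianDensity d 1 x =
      gaussianDensity d h (x - θ) ^ 2 / gaussianDensity d 1 x := by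
    rw [densityRatio]; field_simp
  rw [e1]
  unfold gaussianDensity
  rw [mul_pow, mul_div_mul_comm, sq_rpow_neg_half_div hh hh2]
  have e2 : Real.exp (-‖x - θ‖ ^ 2 / (2 * h ^ 2)) ^ 2 / Real.exp (-‖x‖ ^ 2 / (2 * 1 ^ 2)) =
      Real.exp (‖θ‖ ^ 2 / (2 - h ^ 2)) * Real.exp (-‖x - (2 / (2 - h ^ 2)) • θ‖ ^ 2 /
        (2 * √(h ^ 2 / (2 - h ^ 2)) ^ 2)) := by
    rw [← Real.exp_nat_mul, ← Real.exp_sub, ← Real.exp_add, Real.sq_sqrt (by positivity),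
      norm_sub_sq_real, norm_sub_sq_real, inner_smul_right, norm_smul, Real.norm_eq_abs, mul_pow,
      sq_abs]
    congr 1
    push_cast
    field_simp
    ring
  rw [e2]
  ring

lemma lintegral_densityRatio_sq_mul {d : ℕ} {h : ℝ} (hh : 0 < h) (hh2 : h ^ 2 < 2) (θ : Vec d)
    {F : Vec d → ℝ≥0∞} (hF : Measurable F) :
    ∫⁻ x, ENNReal.ofReal (densityRatio (gaussianDensity d 1) h x θ ^ 2) * F x
        ∂(stdGaussian (Vec d)) =
      ENNReal.ofReal ((h ^ 2 * (2 - h ^ 2)) ^ (-(d : ℝ) / 2) * Real.exp (‖θ‖ ^ 2 / (2 - h ^ 2))) *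
        ∫⁻ g, F ((2 / (2 - h ^ 2)) • θ + √(h ^ 2 / (2 - h ^ 2)) • g) ∂(stdGaussian (Vec d)) := by
  have h2 : 0 < 2 - h ^ 2 := by linarith
  have hm : Measurable fun x =>
      ENNReal.ofReal (densityRatio (gaussianDensity d 1) h x θ ^ 2) * F x :=
    (((measurable_densityRatio h).comp (measurable_id.prodMk measurable_const)).pow_const
      2).ennreal_ofReal.mul hF
  have h1 := lintegral_gaussianDensity_sub d one_pos 0 hm
  simp only [sub_zero, zero_add, one_smul] at h1
  have hm2 := measurable_gaussianDensity d (√(h ^ 2 / (2 - h ^ 2)))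
  rw [← h1, ← lintegral_gaussianDensity_sub d (by positivity) _ hF,
    ← lintegral_const_mul _ (by fun_prop)]
  congr 1
  ext x
  rw [← mul_assoc, ← mul_assoc, ← ENNReal.ofReal_mul (gaussianDensity_pos d one_pos x).le,
    ← ENNReal.ofReal_mul (by positivity), ← densityRatio_sq_mul hh hh2, mul_comm (gaussianDensity d 1 x)]

/-- The exponential tilt of `N(0, s² I_d)` by `exp (a ‖θ‖²)` is a multiple of a centred Gaussian law
with a larger variance. -/
lemma lintegral_exp_sq_mul_gaussianLaw {d : ℕ} {s a : ℝ} (hs : 0 < s) (ha : 2 * a * s ^ 2 < 1)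
    {F : Vec d → ℝ≥0∞} (hF : Measurable F) :
    ∫⁻ θ, ENNReal.ofReal (Real.exp (a * ‖θ‖ ^ 2)) * F θ ∂(gaussianLaw d s) =
      ENNReal.ofReal ((1 - 2 * a * s ^ 2) ^ (-(d : ℝ) / 2)) *
        ∫⁻ g, F (√(s ^ 2 / (1 - 2 * a * s ^ 2)) • g) ∂(stdGaussian (Vec d)) := by
  have h2 : 0 < 1 - 2 * a * s ^ 2 := by linarith
  have hm := measurable_gaussianDensity d s
  have hm2 := measurable_gaussianDensity d (√(s ^ 2 / (1 - 2 * a * s ^ 2)))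
  have h3 := lintegral_gaussianDensity_sub d (s := √(s ^ 2 / (1 - 2 * a * s ^ 2))) (by positivity)
    0 hF
  simp only [sub_zero, zero_add] at h3
  rw [gaussianLaw_eq_withDensity d hs, lintegral_withDensity_eq_lintegral_mul _ (by fun_prop)
      (by fun_prop), ← h3, ← lintegral_const_mul _ (by fun_prop)]
  congr 1
  ext x
  rw [Pi.mul_apply, ← mul_assoc, ← mul_assoc, ← ENNReal.ofReal_mul (gaussianDensity_pos d hs x).le,
    ← ENNReal.ofReal_mul (by positivity)]
  congr 2
  unfold gaussianDensity
  have hp := Real.pi_pos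
  rw [Real.sq_sqrt (by positivity), ← mul_assoc, ← Real.mul_rpow (by positivity) (by positivity),
    mul_assoc, ← Real.exp_add]
  congr 2
  · field_simp
    rw [div_self]
    rw [show 1 - 2 * s ^ 2 * a = 1 - 2 * a * s ^ 2 by ring]
    exact h2.ne'
  · field_simp
    ring

/-! ### The index map and Gaussian moments -/

/-- The vector `U z` of `ℝ^d` with coordinates `z` with respect to the columns of `U`. -/
def matVec {d k : ℕ} (U : Matrix (Fin d) (Fin k) ℝ) (z : Vec k) : Vec d :=
  WithLp.toLp 2 (Matrix.mulVec U z.ofLp)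

section
variable {d k : ℕ} (U : Matrix (Fin d) (Fin k) ℝ)

lemma inner_eq_dotProduct {n : ℕ} (x y : Vec n) : inner ℝ x y = x.ofLp ⬝ᵥ y.ofLp := by
  simp [PiLp.inner_apply, dotProduct, mul_comm]

lemma inner_index (x : Vec d) (z : Vec k) : inner ℝ (index U x) z = inner ℝ x (matVec U z) := by
  rw [inner_eq_dotProduct, inner_eq_dotProduct, index, matVec, Matrix.mulVec_transpose,
    ← Matrix.dotProduct_mulVec]

lemma index_add (x y : Vec d) : index U (x + y) = index U x + index U y := by
  simp [index, Matrix.mulVec_add]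

lemma index_sub (x y : Vec d) : index U (x - y) = index U x - index U y := by
  simp [index, Matrix.mulVec_sub]

lemma index_smul (c : ℝ) (x : Vec d) : index U (c • x) = c • index U x := by
  simp [index, Matrix.mulVec_smul]

lemma continuous_index : Continuous (index U) := by
  unfold index; fun_prop

@[fun_prop]
lemma measurable_index : Measurable (index U) := (continuous_index U).measurable

variable {U}

lemma index_matVec (hU : U.transpose * U = 1) (z : Vec k) : index U (matVec U z) = z := by
  simp [index, matVec, Matrix.mulVec_mulVec, hU]

lemma norm_matVec (hU : U.transpose * U = 1) (z : Vec k) : ‖matVec U z‖ = ‖z‖ := by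
  have h : ‖matVec U z‖ ^ 2 = ‖z‖ ^ 2 := by
    rw [← real_inner_self_eq_norm_sq, ← inner_index, index_matVec hU, real_inner_self_eq_norm_sq]
  exact (sq_eq_sq₀ (norm_nonneg _) (norm_nonneg _)).1 h

/-- The index vector of a standard Gaussian vector is standard Gaussian. -/
lemma map_index_stdGaussian (hU : U.transpose * U = 1) :
    (stdGaussian (Vec d)).map (index U) = stdGaussian (Vec k) := by
  apply Measure.ext_of_charFun
  ext t
  rw [charFun_apply, integral_map (measurable_index U).aemeasurable
    (Measurable.aestronglyMeasurable (by fun_prop))]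
  simp_rw [inner_index]
  rw [← charFun_apply, charFun_stdGaussian, charFun_stdGaussian, norm_matVec hU]

lemma lintegral_comp_index (hU : U.transpose * U = 1) {F : Vec k → ℝ≥0∞} (hF : Measurable F) :
    ∫⁻ g, F (index U g) ∂(stdGaussian (Vec d)) = ∫⁻ z, F z ∂(stdGaussian (Vec k)) := by
  rw [← map_index_stdGaussian hU, lintegral_map hF (measurable_index U)]

lemma integral_comp_index (hU : U.transpose * U = 1) {F : Vec k → ℝ} (hF : Measurable F) :
    ∫ g, F (index U g) ∂(stdGaussian (Vec d)) = ∫ z, F z ∂(stdGaussian (Vec k)) := by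
  rw [← map_index_stdGaussian hU, integral_map (measurable_index U).aemeasurable
    hF.aestronglyMeasurable]

end

lemma integrable_one_add_norm_pow (k p : ℕ) :
    Integrable (fun z : Vec k => (1 + ‖z‖) ^ p) (stdGaussian (Vec k)) := by
  have h0 : MemLp (fun z : Vec k => z) p (stdGaussian (Vec k)) :=
    IsGaussian.memLp_id _ p (by simp)
  have hc : MemLp (fun _ : Vec k => (1 : ℝ)) p (stdGaussian (Vec k)) := memLp_const 1
  have h1 : MemLp (fun z : Vec k => 1 + ‖z‖) p (stdGaussian (Vec k)) := hc.add h0.norm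
  have h2 := h1.integrable_norm_pow'
  refine h2.congr (Filter.Eventually.of_forall fun z => ?_)
  simp only
  rw [Real.norm_of_nonneg (by positivity)]

/-- The moment `E (1 + ‖Z‖)^p` of a standard Gaussian vector `Z` in `ℝ^k`. -/
def gaussMoment (k p : ℕ) : ℝ := ∫ z, (1 + ‖z‖) ^ p ∂(stdGaussian (Vec k))

lemma lintegral_one_add_norm_pow (k p : ℕ) :
    ∫⁻ z, ENNReal.ofReal ((1 + ‖z‖) ^ p) ∂(stdGaussian (Vec k)) =
      ENNReal.ofReal (gaussMoment k p) :=
  (ofReal_integral_eq_lintegral_ofReal (integrable_one_add_norm_pow k p)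
    (Filter.Eventually.of_forall fun z => by positivity)).symm

lemma gaussMoment_nonneg (k p : ℕ) : 0 ≤ gaussMoment k p :=
  integral_nonneg fun z => by positivity

lemma one_le_gaussMoment (k p : ℕ) : 1 ≤ gaussMoment k p := by
  have h : ∫ _ : Vec k, (1 : ℝ) ∂(stdGaussian (Vec k)) ≤ gaussMoment k p :=
    integral_mono (integrable_const _) (integrable_one_add_norm_pow k p)
      fun z => one_le_pow₀ (by simp)
  simpa using h

lemma lintegral_one_add_abs_pow (d : ℕ) (i : Fin d) (p : ℕ) :
    ∫⁻ g : Vec d, ENNReal.ofReal ((1 + |g i|) ^ p) ∂(stdGaussian (Vec d)) =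
      ENNReal.ofReal (gaussMoment 1 p) := by
  classical
  set E : Matrix (Fin d) (Fin 1) ℝ := Matrix.of fun a _ => if a = i then 1 else 0 with hE
  have hEE : E.transpose * E = 1 := by
    ext a b
    rw [Subsingleton.elim a b]
    simp [hE, Matrix.mul_apply]
  have hidx : ∀ g : Vec d, ‖index E g‖ = |g i| := by
    intro g
    rw [EuclideanSpace.norm_eq]
    simp [index, hE, Matrix.mulVec, dotProduct, Real.sqrt_sq_eq_abs]
  rw [← lintegral_one_add_norm_pow, ← lintegral_comp_index hEE (by fun_prop)]
  simp_rw [hidx]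

/-- Jensen's inequality for the average of the `1 + g_i²`. -/
lemma one_add_norm_sq_div_pow_le {d : ℕ} (hd : 0 < d) (q : ℕ) (g : Vec d) :
    (1 + ‖g‖ ^ 2 / d) ^ q ≤ ∑ i : Fin d, (1 / (d : ℝ)) * (1 + |g i|) ^ (2 * q) := by
  have hd' : (0 : ℝ) < d := by exact_mod_cast hd
  have h1 : (1 + ‖g‖ ^ 2 / d) = ∑ i : Fin d, (1 / (d : ℝ)) * (1 + g i ^ 2) := by
    rw [EuclideanSpace.real_norm_sq_eq, ← Finset.mul_sum, Finset.sum_add_distrib]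
    simp
    field_simp
  rw [h1]
  refine (Real.pow_arith_mean_le_arith_mean_pow _ _ _ (fun _ _ => by positivity) ?_
    (fun _ _ => by positivity) q).trans ?_
  · simp [hd'.ne']
  · refine Finset.sum_le_sum fun i _ => ?_
    rw [pow_mul]
    have : 1 + g i ^ 2 ≤ (1 + |g i|) ^ 2 := by
      rw [← sq_abs]; nlinarith [abs_nonneg (g i)]
    gcongr

/-- Joint moments of the index vector and of the normalized squared norm of a standard Gaussian
vector are bounded independently of the ambient dimension. -/
lemma lintegral_index_norm_moment {d k : ℕ} {U : Matrix (Fin d) (Fin k) ℝ}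
    (hU : U.transpose * U = 1) (hd : 0 < d) (p q : ℕ) :
    ∫⁻ g, ENNReal.ofReal ((1 + ‖index U g‖) ^ p * (1 + ‖g‖ ^ 2 / d) ^ q) ∂(stdGaussian (Vec d)) ≤
      ENNReal.ofReal (gaussMoment k (p * 2) + gaussMoment 1 (2 * (q * 2))) := by
  have hd' : (0 : ℝ) < d := by exact_mod_cast hd
  have hstep : ∀ g : Vec d,
      ENNReal.ofReal ((1 + ‖index U g‖) ^ p * (1 + ‖g‖ ^ 2 / d) ^ q) ≤
        ENNReal.ofReal ((1 + ‖index U g‖) ^ (p * 2)) +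
          ∑ i : Fin d, ENNReal.ofReal (1 / (d : ℝ)) *
            ENNReal.ofReal ((1 + |g i|) ^ (2 * (q * 2))) := by
    intro g
    have h1 := one_add_norm_sq_div_pow_le hd (q * 2) g
    have h2 : (1 + ‖index U g‖) ^ p * (1 + ‖g‖ ^ 2 / d) ^ q ≤
        (1 + ‖index U g‖) ^ (p * 2) + ∑ i : Fin d, (1 / (d : ℝ)) * (1 + |g i|) ^ (2 * (q * 2)) := by
      rw [pow_mul] at h1
      rw [pow_mul (1 + ‖index U g‖)]
      nlinarith [sq_nonneg ((1 + ‖index U g‖) ^ p - (1 + ‖g‖ ^ 2 / d) ^ q),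
        sq_nonneg ((1 + ‖index U g‖) ^ p), sq_nonneg ((1 + ‖g‖ ^ 2 / d) ^ q)]
    refine (ENNReal.ofReal_le_ofReal h2).trans ?_
    rw [ENNReal.ofReal_add (by positivity) (Finset.sum_nonneg fun i _ => by positivity),
      ENNReal.ofReal_sum_of_nonneg fun i _ => by positivity]
    simp_rw [ENNReal.ofReal_mul (show (0 : ℝ) ≤ 1 / d by positivity)]
    exact le_rfl
  have hmeas : ∀ i : Fin d, Measurable fun g : Vec d =>
      ENNReal.ofReal (1 / (d : ℝ)) * ENNReal.ofReal ((1 + |g i|) ^ (2 * (q * 2))) := by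
    intro i
    have : Measurable fun g : Vec d => |g i| := by fun_prop
    fun_prop
  refine (lintegral_mono hstep).trans ?_
  rw [lintegral_add_left (by fun_prop), lintegral_finsetSum _ (fun i _ => hmeas i),
    lintegral_comp_index hU (F := fun z => ENNReal.ofReal ((1 + ‖z‖) ^ (p * 2))) (by fun_prop),
    lintegral_one_add_norm_pow, ENNReal.ofReal_add (gaussMoment_nonneg _ _)
      (gaussMoment_nonneg _ _)]
  gcongr
  have : ∀ i : Fin d, ∫⁻ g : Vec d, ENNReal.ofReal (1 / (d : ℝ)) *
      ENNReal.ofReal ((1 + |g i|) ^ (2 * (q * 2))) ∂(stdGaussian (Vec d)) =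
      ENNReal.ofReal (1 / (d : ℝ) * gaussMoment 1 (2 * (q * 2))) := by
    intro i
    rw [lintegral_const_mul' _ _ (by simp), lintegral_one_add_abs_pow,
      ENNReal.ofReal_mul (by positivity)]
  rw [Finset.sum_congr rfl fun i _ => this i, ← ENNReal.ofReal_sum_of_nonneg
    (fun i _ => mul_nonneg (by positivity) (gaussMoment_nonneg _ _))]
  apply ENNReal.ofReal_le_ofReal
  rw [Finset.sum_const, Finset.card_univ, Fintype.card_fin, nsmul_eq_mul]
  field_simp
  exact le_rfl

/-! ### Polynomials on `ℝ^k` in the Gaussian `L²` space -/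

/-- The polynomial function `ℝ^k → ℝ` defined by `q`. -/
def polyFun {k : ℕ} (q : MvPolynomial (Fin k) ℝ) (z : Vec k) : ℝ := MvPolynomial.eval z.ofLp q

/-- The sum of the absolute values of the coefficients of `q`. -/
def coeffNorm {k : ℕ} (q : MvPolynomial (Fin k) ℝ) : ℝ := ∑ α ∈ q.support, |q.coeff α|

section
variable {k : ℕ} (q : MvPolynomial (Fin k) ℝ)

lemma continuous_polyFun : Continuous (polyFun q) := by
  unfold polyFun
  exact (MvPolynomial.continuous_eval q).comp (PiLp.continuous_ofLp 2 _)

@[fun_prop]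
lemma measurable_polyFun : Measurable (polyFun q) := (continuous_polyFun q).measurable

lemma coeffNorm_nonneg : 0 ≤ coeffNorm q := Finset.sum_nonneg fun _ _ => abs_nonneg _

lemma coeffNorm_eq_sum {I : Finset (Fin k →₀ ℕ)} (hI : q.support ⊆ I) :
    coeffNorm q = ∑ α ∈ I, |q.coeff α| := by
  refine Finset.sum_subset hI fun α _ hα => ?_
  rw [MvPolynomial.notMem_support_iff.1 hα, abs_zero]

lemma degree_le_of_mem_support {D : ℕ} (hq : q.totalDegree ≤ D) {α : Fin k →₀ ℕ}
    (hα : α ∈ q.support) : α.degree ≤ D :=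
  (MvPolynomial.le_totalDegree hα).trans hq

lemma abs_prod_pow_le (z : Vec k) (α : Fin k →₀ ℕ) :
    |∏ i, z i ^ α i| ≤ (1 + ‖z‖) ^ α.degree := by
  rw [Finset.abs_prod, Finsupp.degree_eq_sum, ← Finset.prod_pow_eq_pow_sum]
  refine Finset.prod_le_prod (fun _ _ => abs_nonneg _) fun i _ => ?_
  rw [abs_pow]
  gcongr
  have := PiLp.norm_apply_le z i
  rw [Real.norm_eq_abs] at this
  linarith

lemma abs_polyFun_le {D : ℕ} (hq : q.totalDegree ≤ D) (z : Vec k) :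
    |polyFun q z| ≤ coeffNorm q * (1 + ‖z‖) ^ D := by
  rw [polyFun, MvPolynomial.eval_eq', coeffNorm, Finset.sum_mul]
  refine (Finset.abs_sum_le_sum_abs _ _).trans (Finset.sum_le_sum fun α hα => ?_)
  rw [abs_mul]
  refine mul_le_mul_of_nonneg_left ((abs_prod_pow_le z α).trans ?_) (abs_nonneg _)
  exact pow_le_pow_right₀ (by simp) (degree_le_of_mem_support q hq hα)

lemma polyFun_mul (q' : MvPolynomial (Fin k) ℝ) (z : Vec k) :
    polyFun (q * q') z = polyFun q z * polyFun q' z := by simp [polyFun]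

lemma integrable_polyFun : Integrable (polyFun q) (stdGaussian (Vec k)) := by
  refine ((integrable_one_add_norm_pow k q.totalDegree).const_mul (coeffNorm q)).mono'
    (measurable_polyFun q).aestronglyMeasurable (Filter.Eventually.of_forall fun z => ?_)
  exact abs_polyFun_le q le_rfl z

lemma memLp_polyFun : MemLp (polyFun q) 2 (stdGaussian (Vec k)) := by
  rw [memLp_two_iff_integrable_sq (measurable_polyFun q).aestronglyMeasurable]
  simp_rw [sq, ← polyFun_mul]
  exact integrable_polyFun _

end

/-- Polynomials as elements of the Gaussian `L²` space. -/
def polyL2 (k : ℕ) : MvPolynomial (Fin k) ℝ →ₗ[ℝ] Lp ℝ 2 (stdGaussian (Vec k)) where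
  toFun q := MemLp.toLp (polyFun q) (memLp_polyFun q)
  map_add' p q := by
    rw [← MemLp.toLp_add]
    congr 1
    ext z
    simp [polyFun]
  map_smul' c q := by
    rw [RingHom.id_apply, ← MemLp.toLp_const_smul]
    congr 1
    ext z
    simp [polyFun, MvPolynomial.smul_eval]

lemma norm_polyL2_sq {k : ℕ} (q : MvPolynomial (Fin k) ℝ) :
    ‖polyL2 k q‖ ^ 2 = ∫ z, polyFun q z ^ 2 ∂(stdGaussian (Vec k)) := by
  rw [← real_inner_self_eq_norm_sq, L2.inner_def]
  refine integral_congr_ae ?_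
  filter_upwards [(memLp_polyFun q).coeFn_toLp] with z hz
  change inner ℝ (MemLp.toLp (polyFun q) (memLp_polyFun q) z)
    (MemLp.toLp (polyFun q) (memLp_polyFun q) z) = _
  rw [hz]
  simp [sq]

instance isOpenPosMeasure_stdGaussian (k : ℕ) : (stdGaussian (Vec k)).IsOpenPosMeasure := by
  have h : (volume : Measure (Vec k)) ≪ stdGaussian (Vec k) := by
    rw [← gaussianLaw_one, gaussianLaw_eq_withDensity k one_pos]
    refine withDensity_absolutelyContinuous'
      (measurable_gaussianDensity k 1).ennreal_ofReal.aemeasurable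
      (Filter.Eventually.of_forall fun x => ?_)
    simpa using gaussianDensity_pos k one_pos x
  exact h.isOpenPosMeasure

lemma polyFun_eq_zero_iff {k : ℕ} (q : MvPolynomial (Fin k) ℝ) :
    (∀ z, polyFun q z = 0) ↔ q = 0 := by
  refine ⟨fun h => ?_, fun h z => by simp [h, polyFun]⟩
  refine MvPolynomial.funext fun x => ?_
  simpa [polyFun] using h (WithLp.toLp 2 x)

lemma eq_zero_of_integral_sq_eq_zero {k : ℕ} (q : MvPolynomial (Fin k) ℝ)
    (h : ∫ z, polyFun q z ^ 2 ∂(stdGaussian (Vec k)) = 0) : q = 0 := by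
  rw [integral_eq_zero_iff_of_nonneg (fun z => sq_nonneg _) (memLp_polyFun q).integrable_sq] at h
  rw [← polyFun_eq_zero_iff]
  have h2 : polyFun q =ᵐ[stdGaussian (Vec k)] fun _ => 0 := by
    filter_upwards [h] with z hz
    simpa using hz
  intro z
  exact congrFun ((Continuous.ae_eq_iff_eq _ (continuous_polyFun q) continuous_const).1 h2) z

lemma polyL2_injective (k : ℕ) : Function.Injective (polyL2 k) := by
  rw [← LinearMap.ker_eq_bot, LinearMap.ker_eq_bot']
  intro q hq
  apply eq_zero_of_integral_sq_eq_zero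
  rw [← norm_polyL2_sq, hq]
  simp

/-- The exponents of total degree at most `D`. -/
def exponents (k D : ℕ) : Finset (Fin k →₀ ℕ) := (Finsupp.finite_of_degree_le D).toFinset

lemma support_subset_exponents {k D : ℕ} {q : MvPolynomial (Fin k) ℝ} (hq : q.totalDegree ≤ D) :
    q.support ⊆ exponents k D := by
  intro α hα
  simpa [exponents] using degree_le_of_mem_support q hq hα

/-- On polynomials of bounded degree, an injective linear map controls the coefficients. -/
lemma exists_coeffNorm_le {k : ℕ} (D : ℕ) {E : Type*} [NormedAddCommGroup E] [NormedSpace ℝ E]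
    (L : MvPolynomial (Fin k) ℝ →ₗ[ℝ] E) (hL : Function.Injective L) :
    ∃ C : ℝ, 0 < C ∧ ∀ q : MvPolynomial (Fin k) ℝ, q.totalDegree ≤ D →
      coeffNorm q ≤ C * ‖L q‖ := by
  let J : (exponents k D → ℝ) →ₗ[ℝ] MvPolynomial (Fin k) ℝ :=
    ∑ α : exponents k D, (MvPolynomial.monomial (α : Fin k →₀ ℕ)).comp (LinearMap.proj α)
  have hJ : ∀ c, J c = ∑ α : exponents k D, MvPolynomial.monomial (α : Fin k →₀ ℕ) (c α) := by
    intro c; simp [J]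
  have hcoeff : ∀ c (α : exponents k D), (J c).coeff α = c α := by
    intro c α
    rw [hJ, MvPolynomial.coeff_sum]
    simp only [MvPolynomial.coeff_monomial]
    rw [Finset.sum_eq_single α]
    · simp
    · intro β _ hβ
      rw [if_neg (fun h => hβ (Subtype.ext h))]
    · simp
  have hinj : Function.Injective J := by
    intro c c' h
    ext α
    rw [← hcoeff c α, h, hcoeff]
  obtain ⟨K, hK0, hK⟩ := (L.comp J).exists_antilipschitzWith
    (LinearMap.ker_eq_bot.2 (hL.comp hinj))
  refine ⟨((exponents k D).card + 1) * K, by positivity, fun q hq => ?_⟩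
  have hqJ : J (fun α => q.coeff α) = q := by
    rw [hJ, Finset.sum_coe_sort (exponents k D)
      (fun α => MvPolynomial.monomial α (q.coeff α))]
    conv_rhs => rw [q.as_sum]
    refine (Finset.sum_subset (support_subset_exponents hq) fun α _ hα => ?_).symm
    rw [MvPolynomial.notMem_support_iff.1 hα, map_zero]
  have h1 : ‖fun α : exponents k D => q.coeff α‖ ≤ K * ‖L q‖ := by
    have := hK.le_mul_dist (fun α : exponents k D => q.coeff α) 0
    rw [dist_zero_right, map_zero, dist_zero_right, LinearMap.comp_apply, hqJ] at this
    exact this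
  rw [coeffNorm_eq_sum q (support_subset_exponents hq)]
  calc ∑ α ∈ exponents k D, |q.coeff α| ≤ ∑ α ∈ exponents k D, K * ‖L q‖ := by
        refine Finset.sum_le_sum fun α hα => ?_
        exact (norm_le_pi_norm (fun α : exponents k D => q.coeff α) ⟨α, hα⟩).trans h1
    _ = (exponents k D).card * (K * ‖L q‖) := by rw [Finset.sum_const, nsmul_eq_mul]
    _ ≤ ((exponents k D).card + 1) * K * ‖L q‖ := by
        have : (0:ℝ) ≤ K * ‖L q‖ := by positivity
        nlinarith

lemma norm_polyL2_le {k : ℕ} (D : ℕ) :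
    ∃ C : ℝ, 0 < C ∧ ∀ q : MvPolynomial (Fin k) ℝ, q.totalDegree ≤ D →
      ‖polyL2 k q‖ ≤ C * coeffNorm q := by
  refine ⟨√(gaussMoment k (D * 2)), Real.sqrt_pos.2 (one_pos.trans_le (one_le_gaussMoment _ _)),
    fun q hq => ?_⟩
  have h : ‖polyL2 k q‖ ^ 2 ≤ (√(gaussMoment k (D * 2)) * coeffNorm q) ^ 2 := by
    rw [norm_polyL2_sq, mul_pow, Real.sq_sqrt (gaussMoment_nonneg _ _), gaussMoment,
      ← integral_mul_const]
    refine integral_mono (memLp_polyFun q).integrable_sq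
      ((integrable_one_add_norm_pow k _).mul_const _) fun z => ?_
    have := abs_polyFun_le q hq z
    simp only
    rw [← sq_abs, pow_mul, ← mul_pow, mul_comm]
    gcongr
  exact (sq_le_sq₀ (norm_nonneg _) (mul_nonneg (Real.sqrt_nonneg _) (coeffNorm_nonneg q))).1 h

/-! ### Dilation and Gaussian smoothing of polynomials -/

/-- The polynomial `z ↦ q (t z)`. -/
def dilate {k : ℕ} (t : ℝ) (q : MvPolynomial (Fin k) ℝ) : MvPolynomial (Fin k) ℝ :=
  ∑ α ∈ q.support, MvPolynomial.monomial α (t ^ α.degree * q.coeff α)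

section
variable {k : ℕ} (t : ℝ) (q : MvPolynomial (Fin k) ℝ)

lemma coeff_dilate (α : Fin k →₀ ℕ) : (dilate t q).coeff α = t ^ α.degree * q.coeff α := by
  rw [dilate, MvPolynomial.coeff_sum]
  simp only [MvPolynomial.coeff_monomial, Finset.sum_ite_eq']
  split_ifs with h
  · rfl
  · rw [MvPolynomial.notMem_support_iff.1 h, mul_zero]

lemma polyFun_dilate (z : Vec k) : polyFun (dilate t q) z = polyFun q (t • z) := by
  rw [polyFun, dilate, polyFun, MvPolynomial.eval_eq' _ q, map_sum]
  refine Finset.sum_congr rfl fun α _ => ?_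
  rw [MvPolynomial.eval_monomial, Finsupp.prod_fintype _ _ (by simp)]
  simp only [PiLp.smul_apply, smul_eq_mul, mul_pow, Finset.prod_mul_distrib]
  rw [Finset.prod_pow_eq_pow_sum, ← Finsupp.degree_eq_sum]
  ring

lemma support_dilate_subset : (dilate t q).support ⊆ q.support := by
  intro α hα
  rw [MvPolynomial.mem_support_iff, coeff_dilate] at hα
  exact MvPolynomial.mem_support_iff.2 (right_ne_zero_of_mul hα)

lemma totalDegree_dilate_le : (dilate t q).totalDegree ≤ q.totalDegree :=
  MvPolynomial.totalDegree_le_of_support_subset (support_dilate_subset t q)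

variable {t q}

lemma coeffNorm_dilate_ge {D : ℕ} (ht : 0 < t) (hq : q.totalDegree ≤ D) :
    min 1 t ^ D * coeffNorm q ≤ coeffNorm (dilate t q) := by
  rw [coeffNorm_eq_sum _ (support_dilate_subset t q), coeffNorm, Finset.mul_sum]
  refine Finset.sum_le_sum fun α hα => ?_
  rw [coeff_dilate, abs_mul, abs_of_pos (pow_pos ht _)]
  refine mul_le_mul_of_nonneg_right ?_ (abs_nonneg _)
  have hm : 0 < min 1 t := lt_min one_pos ht
  calc min 1 t ^ D ≤ min 1 t ^ α.degree :=
        pow_le_pow_of_le_one hm.le (min_le_left _ _) (degree_le_of_mem_support q hq hα)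
    _ ≤ t ^ α.degree := pow_le_pow_left₀ hm.le (min_le_right _ _) _

end

/-- The translation `q(y + z)` as a polynomial in `y` whose coefficients are polynomials in `z`. -/
def translate {k : ℕ} :
    MvPolynomial (Fin k) ℝ →ₐ[ℝ] MvPolynomial (Fin k) (MvPolynomial (Fin k) ℝ) :=
  MvPolynomial.aeval fun i => MvPolynomial.X i + MvPolynomial.C (MvPolynomial.X i)

lemma eval_map_translate {k : ℕ} (q : MvPolynomial (Fin k) ℝ) (y z : Vec k) :
    MvPolynomial.eval y.ofLp (MvPolynomial.map (MvPolynomial.eval z.ofLp) (translate q)) =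
      polyFun q (y + z) := by
  rw [polyFun]
  induction q using MvPolynomial.induction_on with
  | C a => simp [translate, MvPolynomial.algebraMap_eq, MvPolynomial.algebraMap_apply]
  | add p q hp hq => simp only [map_add, hp, hq]
  | mul_X p i hp =>
    rw [map_mul, map_mul, map_mul, hp, map_mul]
    simp [translate]

lemma totalDegree_translate_le {k : ℕ} (q : MvPolynomial (Fin k) ℝ) :
    (translate q).totalDegree ≤ q.totalDegree := by
  conv_lhs => rw [q.as_sum, map_sum]
  refine MvPolynomial.totalDegree_finsetSum_le fun α hα => ?_
  rw [translate, MvPolynomial.aeval_monomial, MvPolynomial.algebraMap_apply]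
  refine (MvPolynomial.totalDegree_mul _ _).trans ?_
  rw [MvPolynomial.totalDegree_C, zero_add]
  refine (MvPolynomial.totalDegree_finsetProd _ _).trans
    (le_trans (Finset.sum_le_sum fun i _ => ?_) (MvPolynomial.le_totalDegree hα))
  refine (MvPolynomial.totalDegree_pow _ _).trans ?_
  have : (MvPolynomial.X i + MvPolynomial.C (MvPolynomial.X i) :
      MvPolynomial (Fin k) (MvPolynomial (Fin k) ℝ)).totalDegree ≤ 1 := by
    refine (MvPolynomial.totalDegree_add _ _).trans ?_
    simp
  simpa using Nat.mul_le_mul_left (α i) this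

lemma pderiv_translate {k : ℕ} (i : Fin k) (q : MvPolynomial (Fin k) ℝ) :
    MvPolynomial.pderiv i (translate q) = translate (MvPolynomial.pderiv i q) := by
  induction q using MvPolynomial.induction_on with
  | C a => simp [translate, MvPolynomial.algebraMap_apply]
  | add p q hp hq => simp only [map_add, hp, hq]
  | mul_X p j hp =>
    rw [map_mul, MvPolynomial.pderiv_mul, hp, MvPolynomial.pderiv_mul, map_add, map_mul, map_mul]
    congr 2
    classical
    simp only [translate, MvPolynomial.aeval_X, map_add, MvPolynomial.pderiv_C, add_zero,
      MvPolynomial.pderiv_X]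
    by_cases h : i = j
    · subst h; simp
    · simp [h]

/-- The Gaussian expectation as a linear functional on polynomials. -/
def polyMean (k : ℕ) : MvPolynomial (Fin k) ℝ →ₗ[ℝ] ℝ where
  toFun q := ∫ z, polyFun q z ∂(stdGaussian (Vec k))
  map_add' p q := by
    rw [← integral_add (integrable_polyFun p) (integrable_polyFun q)]
    simp [polyFun]
  map_smul' c q := by
    simp [polyFun, MvPolynomial.smul_eval, integral_const_mul]

/-- Gaussian smoothing: the polynomial `y ↦ E q(y + Z)` with `Z ∼ N(0, I_k)`. -/
def smoothFun {k : ℕ} (q : MvPolynomial (Fin k) ℝ) : MvPolynomial (Fin k) ℝ :=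
  ∑ β ∈ (translate q).support, MvPolynomial.monomial β (polyMean k ((translate q).coeff β))

lemma coeff_smoothFun {k : ℕ} (q : MvPolynomial (Fin k) ℝ) (β : Fin k →₀ ℕ) :
    (smoothFun q).coeff β = polyMean k ((translate q).coeff β) := by
  rw [smoothFun, MvPolynomial.coeff_sum]
  simp only [MvPolynomial.coeff_monomial, Finset.sum_ite_eq']
  split_ifs with h
  · rfl
  · rw [MvPolynomial.notMem_support_iff.1 h, map_zero]

/-- Gaussian smoothing as a linear map. -/
def smooth {k : ℕ} : MvPolynomial (Fin k) ℝ →ₗ[ℝ] MvPolynomial (Fin k) ℝ where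
  toFun := smoothFun
  map_add' p q := by
    ext β
    rw [MvPolynomial.coeff_add]
    simp only [coeff_smoothFun, map_add, MvPolynomial.coeff_add]
  map_smul' c q := by
    ext β
    rw [RingHom.id_apply, MvPolynomial.coeff_smul]
    simp only [coeff_smoothFun, map_smul, MvPolynomial.coeff_smul]

section
variable {k : ℕ} (q : MvPolynomial (Fin k) ℝ)

lemma coeff_smooth (β : Fin k →₀ ℕ) :
    (smooth q).coeff β = polyMean k ((translate q).coeff β) := coeff_smoothFun q β

lemma totalDegree_smooth_le : (smooth q).totalDegree ≤ q.totalDegree := by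
  refine le_trans ?_ (totalDegree_translate_le q)
  refine Finset.sup_le fun β hβ => ?_
  refine MvPolynomial.le_totalDegree (MvPolynomial.mem_support_iff.2 fun h => ?_)
  rw [MvPolynomial.mem_support_iff, coeff_smooth, h, map_zero] at hβ
  exact hβ rfl

lemma polyFun_smooth (y : Vec k) :
    polyFun (smooth q) y = ∫ z, polyFun q (y + z) ∂(stdGaussian (Vec k)) := by
  have h1 : ∀ z : Vec k, polyFun q (y + z) =
      ∑ β ∈ (translate q).support, polyFun ((translate q).coeff β) z * ∏ i, y i ^ β i := by
    intro z
    rw [← eval_map_translate]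
    conv_lhs => rw [(translate q).as_sum, map_sum, map_sum]
    refine Finset.sum_congr rfl fun β _ => ?_
    rw [MvPolynomial.map_monomial, MvPolynomial.eval_monomial, Finsupp.prod_fintype _ _ (by simp),
      polyFun]
  simp_rw [h1]
  rw [integral_finsetSum _ fun β _ => (integrable_polyFun _).mul_const _]
  simp_rw [integral_mul_const]
  change polyFun (smoothFun q) y = _
  rw [smoothFun, polyFun, map_sum]
  refine Finset.sum_congr rfl fun β _ => ?_
  rw [MvPolynomial.eval_monomial, Finsupp.prod_fintype _ _ (by simp)]
  rfl

lemma pderiv_smooth (i : Fin k) :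
    MvPolynomial.pderiv i (smooth q) = smooth (MvPolynomial.pderiv i q) := by
  ext β
  rw [MvPolynomial.coeff_pderiv, coeff_smooth, coeff_smooth, ← pderiv_translate,
    MvPolynomial.coeff_pderiv]
  have : ((translate q).coeff (β + Finsupp.single i 1)) * ((β i : MvPolynomial (Fin k) ℝ) + 1) =
      ((β i : ℝ) + 1) • (translate q).coeff (β + Finsupp.single i 1) := by
    rw [MvPolynomial.smul_eq_C_mul, mul_comm]
    simp
  rw [this, map_smul, smul_eq_mul, mul_comm]

lemma totalDegree_pderiv_le (i : Fin k) :
    (MvPolynomial.pderiv i q).totalDegree ≤ q.totalDegree - 1 := by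
  refine Finset.sup_le fun α hα => ?_
  rw [MvPolynomial.mem_support_iff, MvPolynomial.coeff_pderiv] at hα
  have h := MvPolynomial.le_totalDegree
    (MvPolynomial.mem_support_iff.2 (left_ne_zero_of_mul hα))
  rw [Finsupp.sum_add_index' (by simp) (by simp), Finsupp.sum_single_index rfl] at h
  omega

lemma eq_C_of_pderiv_eq_zero (h : ∀ i, MvPolynomial.pderiv i q = 0) :
    q = MvPolynomial.C (q.coeff 0) := by
  ext α
  rw [MvPolynomial.coeff_C]
  split_ifs with h0
  · rw [h0]
  · obtain ⟨i, hi⟩ : ∃ i, α i ≠ 0 := by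
      by_contra hc
      push Not at hc
      exact h0 (Finsupp.ext fun i => (hc i).symm)
    have h1 := congrArg (MvPolynomial.coeff (α - Finsupp.single i 1)) (h i)
    rw [MvPolynomial.coeff_pderiv, MvPolynomial.coeff_zero] at h1
    have h2 : α - Finsupp.single i 1 + Finsupp.single i 1 = α := by
      ext j
      by_cases hj : j = i
      · subst hj; simp; omega
      · simp [Ne.symm hj]
    rw [h2] at h1
    exact (mul_eq_zero.1 h1).resolve_right (by positivity)

/-- Smoothing commutes with derivatives and fixes constants, hence it is injective by induction on
the degree. -/
lemma smooth_injective : Function.Injective (smooth (k := k)) := by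
  rw [← LinearMap.ker_eq_bot, LinearMap.ker_eq_bot']
  have key : ∀ n : ℕ, ∀ q : MvPolynomial (Fin k) ℝ, q.totalDegree ≤ n → smooth q = 0 → q = 0 := by
    intro n
    induction n with
    | zero =>
      intro q hq h
      rw [MvPolynomial.totalDegree_eq_zero_iff_eq_C.1 (Nat.le_zero.1 hq)] at h ⊢
      have := polyFun_smooth (k := k) (MvPolynomial.C (q.coeff 0)) 0
      rw [h] at this
      simp [polyFun] at this
      simp [← this]
    | succ n ih =>
      intro q hq h
      have hd : ∀ i, MvPolynomial.pderiv i q = 0 := fun i =>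
        ih _ ((totalDegree_pderiv_le q i).trans (by omega)) (by rw [← pderiv_smooth, h, map_zero])
      rw [eq_C_of_pderiv_eq_zero q hd] at h ⊢
      exact ih _ (by simp) h
  exact fun q h => key _ q le_rfl h

end

/-- The Gaussian second moment of a smoothed and dilated polynomial controls the Gaussian second
moment of the polynomial itself. In the coefficients, dilation by `t ≤ 1` costs at most `t ^ D`,
and smoothing costs a constant. -/
theorem exists_smoothing_lower_bound (k D : ℕ) :
    ∃ c : ℝ, 0 < c ∧ ∀ p : MvPolynomial (Fin k) ℝ, p.totalDegree ≤ D → ∀ h t : ℝ, 0 < h → 0 < t →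
      t ≤ 1 →
      c * (t ^ D * min 1 h ^ D) ^ 2 * ∫ z, polyFun p z ^ 2 ∂(stdGaussian (Vec k)) ≤
        ∫ w, (∫ z, polyFun p (h • (t • w + z)) ∂(stdGaussian (Vec k))) ^ 2
          ∂(stdGaussian (Vec k)) := by
  obtain ⟨C₁, hC₁, h₁⟩ := exists_coeffNorm_le D (polyL2 k) (polyL2_injective k)
  obtain ⟨C₂, hC₂, h₂⟩ := exists_coeffNorm_le D ((polyL2 k).comp smooth)
    ((polyL2_injective k).comp smooth_injective)
  obtain ⟨C₃, hC₃, h₃⟩ := norm_polyL2_le (k := k) D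
  refine ⟨(C₁ * C₂ * C₃ * C₃)⁻¹ ^ 2, by positivity, fun p hp h t hh ht ht1 => ?_⟩
  have hdeg : (dilate h p).totalDegree ≤ D := (totalDegree_dilate_le h p).trans hp
  have hdeg' : (smooth (dilate h p)).totalDegree ≤ D := (totalDegree_smooth_le _).trans hdeg
  have hdeg'' : (dilate t (smooth (dilate h p))).totalDegree ≤ D :=
    (totalDegree_dilate_le _ _).trans hdeg'
  have hfun : ∀ w, ∫ z, polyFun p (h • (t • w + z)) ∂(stdGaussian (Vec k)) =
      polyFun (dilate t (smooth (dilate h p))) w := by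
    intro w
    simp_rw [polyFun_dilate, polyFun_smooth, polyFun_dilate]
  simp_rw [hfun]
  rw [← norm_polyL2_sq, ← norm_polyL2_sq, ← mul_pow, ← mul_pow]
  have hm : 0 < min 1 h := lt_min one_pos hh
  refine pow_le_pow_left₀ (by positivity) ?_ 2
  have e1 := h₁ _ hdeg''
  have e2 := coeffNorm_dilate_ge ht hdeg'
  have e3 := h₂ _ hdeg
  have e4 := coeffNorm_dilate_ge hh hp
  have e5 := h₃ p hp
  have e6 := h₃ _ hdeg'
  rw [min_eq_right ht1] at e2
  rw [LinearMap.comp_apply] at e3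
  have f1 : coeffNorm (dilate h p) ≤ C₂ * C₃ * coeffNorm (smooth (dilate h p)) := by
    refine e3.trans ?_
    rw [mul_assoc]
    gcongr
  have f2 : ‖polyL2 k p‖ * (t ^ D * min 1 h ^ D) ≤
      C₁ * C₂ * C₃ * C₃ * ‖polyL2 k (dilate t (smooth (dilate h p)))‖ := by
    calc ‖polyL2 k p‖ * (t ^ D * min 1 h ^ D) ≤
        (C₃ * coeffNorm p) * (t ^ D * min 1 h ^ D) :=
          mul_le_mul_of_nonneg_right e5 (by positivity)
      _ = C₃ * t ^ D * (min 1 h ^ D * coeffNorm p) := by ring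
      _ ≤ C₃ * t ^ D * (C₂ * C₃ * coeffNorm (smooth (dilate h p))) := by
        exact mul_le_mul_of_nonneg_left (e4.trans f1) (by positivity)
      _ = C₃ * (C₂ * C₃) * (t ^ D * coeffNorm (smooth (dilate h p))) := by ring
      _ ≤ C₃ * (C₂ * C₃) * (C₁ * ‖polyL2 k (dilate t (smooth (dilate h p)))‖) := by
        exact mul_le_mul_of_nonneg_left (e2.trans e1) (by positivity)
      _ = _ := by ring
  rw [mul_assoc, inv_mul_le_iff₀ (by positivity), mul_comm _ ‖polyL2 k p‖]
  exact f2

/-! ### Directional derivatives of polynomials and Stein's identity -/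

/-- The directional derivative of a polynomial, as a linear function of the direction. -/
def dirDeriv {k : ℕ} (q : MvPolynomial (Fin k) ℝ) : Vec k →ₗ[ℝ] MvPolynomial (Fin k) ℝ where
  toFun η := ∑ i, η i • MvPolynomial.pderiv i q
  map_add' η ζ := by simp [add_smul, Finset.sum_add_distrib]
  map_smul' c η := by simp [mul_smul, Finset.smul_sum]

section
variable {k : ℕ} (q : MvPolynomial (Fin k) ℝ)

lemma dirDeriv_apply (η : Vec k) : dirDeriv q η = ∑ i, η i • MvPolynomial.pderiv i q := rfl

lemma polyFun_dirDeriv (η z : Vec k) :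
    polyFun (dirDeriv q η) z = ∑ i, η i * polyFun (MvPolynomial.pderiv i q) z := by
  simp [polyFun, dirDeriv_apply, MvPolynomial.smul_eval]

lemma totalDegree_dirDeriv_le (η : Vec k) : (dirDeriv q η).totalDegree ≤ q.totalDegree - 1 := by
  refine MvPolynomial.totalDegree_finsetSum_le fun i _ => ?_
  exact (MvPolynomial.totalDegree_smul_le _ _).trans (totalDegree_pderiv_le q i)

lemma hasFDerivAt_polyFun (z : Vec k) :
    HasFDerivAt (polyFun q)
      (∑ i, polyFun (MvPolynomial.pderiv i q) z • (EuclideanSpace.proj i : Vec k →L[ℝ] ℝ)) z := by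
  induction q using MvPolynomial.induction_on with
  | C a =>
    have : polyFun (MvPolynomial.C a : MvPolynomial (Fin k) ℝ) = fun _ => a := by
      ext z; simp [polyFun]
    rw [this]
    simpa [polyFun] using hasFDerivAt_const a z
  | add p q hp hq =>
    have h1 : polyFun (p + q) = fun z => polyFun p z + polyFun q z := by
      ext z; simp [polyFun]
    rw [h1]
    convert! hp.add hq using 1
    rw [← Finset.sum_add_distrib]
    refine Finset.sum_congr rfl fun i _ => ?_
    rw [← add_smul]
    simp [polyFun]
  | mul_X p j hp =>
    have h1 : polyFun (p * MvPolynomial.X j) = fun z => polyFun p z * (EuclideanSpace.proj j : Vec k →L[ℝ] ℝ) z := by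
      ext z; simp [polyFun]
    rw [h1]
    convert! hp.mul (EuclideanSpace.proj j : Vec k →L[ℝ] ℝ).hasFDerivAt using 1
    ext v
    classical
    simp only [polyFun, Derivation.leibniz, MvPolynomial.pderiv_X, Pi.single_apply, smul_eq_mul,
      FunLike.coe_sum, Finset.sum_apply, FunLike.coe_smul,
      Pi.smul_apply, PiLp.proj_apply, map_add, map_mul, MvPolynomial.eval_X,
      add_apply, Finset.mul_sum, add_mul, Finset.sum_add_distrib]
    congr 1
    · rw [Finset.sum_eq_single j]
      · simp
      · intro b _ hb
        simp [hb.symm]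
      · simp
    · refine Finset.sum_congr rfl fun i _ => ?_
      ring

lemma fderiv_polyFun (z v : Vec k) : fderiv ℝ (polyFun q) z v = polyFun (dirDeriv q v) z := by
  rw [(hasFDerivAt_polyFun q z).fderiv, polyFun_dirDeriv]
  simp [mul_comm]

lemma differentiable_polyFun : Differentiable ℝ (polyFun q) := fun z =>
  (hasFDerivAt_polyFun q z).differentiableAt

lemma inner_gradient_polyFun (η z : Vec k) :
    inner ℝ η (gradient (polyFun q) z) = polyFun (dirDeriv q η) z := by
  rw [← fderiv_polyFun, real_inner_comm, gradient, InnerProductSpace.toDual_symm_apply]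

lemma differentiable_gaussianDensity (s : ℝ) : Differentiable ℝ (gaussianDensity k s) := by
  intro x
  have h1 : DifferentiableAt ℝ (fun x : Vec k => ‖x‖ ^ 2) x :=
    (hasStrictFDerivAt_norm_sq x).hasFDerivAt.differentiableAt
  have h2 : DifferentiableAt ℝ (fun x : Vec k => -‖x‖ ^ 2 / (2 * s ^ 2)) x := by
    simp_rw [div_eq_mul_inv]
    exact (DifferentiableAt.fun_neg h1).mul_const _
  exact h2.exp.const_mul _

lemma fderiv_gaussianDensity_one (x v : Vec k) :
    fderiv ℝ (gaussianDensity k 1) x v = -(inner ℝ v x * gaussianDensity k 1 x) := by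
  have h1 : HasFDerivAt (fun x : Vec k => -‖x‖ ^ 2 / (2 * 1 ^ 2))
      ((-(1 / 2 : ℝ)) • ((2 : ℕ) • innerSL ℝ x)) x := by
    have h := (HasStrictFDerivAt.hasFDerivAt (hasStrictFDerivAt_norm_sq x)).const_mul (-(1 / 2 : ℝ))
    have he : (fun x : Vec k => -‖x‖ ^ 2 / (2 * 1 ^ 2)) = fun x => -(1 / 2 : ℝ) * ‖x‖ ^ 2 := by
      ext y; ring
    rw [he]
    exact h
  have h2 := (h1.exp).const_mul ((2 * Real.pi * 1 ^ 2 : ℝ) ^ (-(k : ℝ) / 2))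
  have h3 : fderiv ℝ (gaussianDensity k 1) x = _ := h2.fderiv
  rw [h3]
  simp [gaussianDensity, real_inner_comm]
  ring

lemma integrable_mul_gaussianDensity {F : Vec k → ℝ} (hF : Integrable F (stdGaussian (Vec k))) :
    Integrable fun x => F x * gaussianDensity k 1 x := by
  rw [← gaussianLaw_one, gaussianLaw_eq_withDensity k one_pos,
    integrable_withDensity_iff (measurable_gaussianDensity k 1).ennreal_ofReal (by simp)] at hF
  refine hF.congr (Filter.Eventually.of_forall fun x => ?_)
  simp only
  rw [ENNReal.toReal_ofReal (gaussianDensity_pos k one_pos x).le]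

lemma inner_eq_polyFun (v z : Vec k) :
    inner ℝ v z = polyFun (∑ i, v i • MvPolynomial.X i) z := by
  simp [polyFun, MvPolynomial.smul_eval, inner_eq_dotProduct, dotProduct]

/-- Stein's identity for polynomials. -/
lemma integral_polyFun_mul_inner (v : Vec k) :
    ∫ z, polyFun q z * inner ℝ v z ∂(stdGaussian (Vec k)) =
      ∫ z, polyFun (dirDeriv q v) z ∂(stdGaussian (Vec k)) := by
  have hcv : ∀ F : Vec k → ℝ, Measurable F → ∫ z, F z ∂(stdGaussian (Vec k)) =
      ∫ x, F x * gaussianDensity k 1 x := by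
    intro F hF
    have := integral_gaussianDensity_sub k one_pos 0 hF
    simp only [sub_zero, zero_add, one_smul] at this
    rw [← this]
    simp_rw [mul_comm]
  have hint : Integrable (fun z => polyFun q z * inner ℝ v z) (stdGaussian (Vec k)) := by
    simp_rw [inner_eq_polyFun, ← polyFun_mul]
    exact integrable_polyFun _
  have hpart := integral_mul_fderiv_eq_neg_fderiv_mul_of_integrable (μ := (volume : Measure (Vec k)))
    (f := polyFun q) (g := gaussianDensity k 1) (v := v)
    (by simp_rw [fderiv_polyFun]; exact integrable_mul_gaussianDensity (integrable_polyFun _))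
    (by
      simp_rw [fderiv_gaussianDensity_one]
      refine (integrable_mul_gaussianDensity hint).neg.congr
        (Filter.Eventually.of_forall fun x => ?_)
      simp only [Pi.neg_apply]
      ring)
    (integrable_mul_gaussianDensity (integrable_polyFun q))
    (fun x _ => differentiable_polyFun q x)
    (fun x _ => differentiable_gaussianDensity 1 x)
  rw [hcv _ (by fun_prop), hcv _ (by fun_prop)]
  simp_rw [fderiv_polyFun, fderiv_gaussianDensity_one] at hpart
  rw [← neg_inj, ← hpart, ← integral_neg]
  congr 1
  ext x
  ring

/-- The polynomial `z ↦ q (u + h z)`. -/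
def affineComp (h : ℝ) (u : Vec k) : MvPolynomial (Fin k) ℝ :=
  MvPolynomial.aeval (fun i => MvPolynomial.C (u i) + MvPolynomial.C h * MvPolynomial.X i) q

lemma polyFun_affineComp (h : ℝ) (u z : Vec k) :
    polyFun (affineComp q h u) z = polyFun q (u + h • z) := by
  rw [polyFun, polyFun, affineComp]
  induction q using MvPolynomial.induction_on with
  | C a => simp
  | add p q hp hq => simp only [map_add, hp, hq]
  | mul_X p i hp => rw [map_mul, map_mul, hp, map_mul]; simp

lemma polyFun_dirDeriv_affineComp (h : ℝ) (u v z : Vec k) :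
    polyFun (dirDeriv (affineComp q h u) v) z = h * polyFun (dirDeriv q v) (u + h • z) := by
  have h1 : polyFun (affineComp q h u) = fun z => polyFun q (u + h • z) := by
    ext z; exact polyFun_affineComp q h u z
  have h2 : HasFDerivAt (fun z : Vec k => u + h • z) (h • ContinuousLinearMap.id ℝ (Vec k)) z :=
    ((hasFDerivAt_id z).const_smul h).const_add u
  have h3 := (differentiable_polyFun q (u + h • z)).hasFDerivAt.comp z h2
  rw [← fderiv_polyFun, h1]
  have h4 : fderiv ℝ (fun z => polyFun q (u + h • z)) z = _ := h3.fderiv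
  rw [h4]
  simp [fderiv_polyFun]

/-- Stein's identity for the smoothed gradient of a polynomial. -/
lemma integral_polyFun_affine_mul_inner (h : ℝ) (u v : Vec k) :
    ∫ z, polyFun q (u + h • z) * inner ℝ v z ∂(stdGaussian (Vec k)) =
      h * ∫ z, polyFun (dirDeriv q v) (u + h • z) ∂(stdGaussian (Vec k)) := by
  have := integral_polyFun_mul_inner (affineComp q h u) v
  simp_rw [polyFun_affineComp, polyFun_dirDeriv_affineComp, integral_const_mul] at this
  exact this

end

/-! ### Positivity of the signal strength -/

lemma minSignal_le {k : ℕ} (q : MvPolynomial (Fin k) ℝ) {η : Vec k} (hη : ‖η‖ = 1) :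
    minSignal (polyFun q) ≤ ∫ z, polyFun (dirDeriv q η) z ^ 2 ∂(stdGaussian (Vec k)) := by
  have h : minSignal (polyFun q) ≤ _ := ciInf_le
    (f := fun η : Metric.sphere (0 : Vec k) 1 =>
      ∫ z, inner ℝ (η : Vec k) (gradient (polyFun q) z) ^ 2 ∂(gaussianLaw k 1))
    ⟨0, by rintro _ ⟨η, rfl⟩; exact integral_nonneg fun z => sq_nonneg _⟩
    ⟨η, by simpa using hη⟩
  simpa only [inner_gradient_polyFun, gaussianLaw_one] using h

lemma exists_minSignal_eq {k : ℕ} (hk : 0 < k) (q : MvPolynomial (Fin k) ℝ) :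
    ∃ η : Vec k, ‖η‖ = 1 ∧
      minSignal (polyFun q) = ∫ z, polyFun (dirDeriv q η) z ^ 2 ∂(stdGaussian (Vec k)) := by
  have : Nonempty (Fin k) := ⟨⟨0, hk⟩⟩
  have hcont : Continuous fun η : Vec k => ‖polyL2 k (dirDeriv q η)‖ ^ 2 :=
    (((polyL2 k).comp (dirDeriv q)).continuous_of_finiteDimensional).norm.pow 2
  have hne : (Metric.sphere (0 : Vec k) 1).Nonempty := NormedSpace.sphere_nonempty.2 zero_le_one
  obtain ⟨η, hη, hmin⟩ := (isCompact_sphere (0 : Vec k) 1).exists_isMinOn hne hcont.continuousOn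
  have hη1 : ‖η‖ = 1 := by simpa using hη
  refine ⟨η, hη1, le_antisymm (minSignal_le q hη1) ?_⟩
  have : Nonempty (Metric.sphere (0 : Vec k) 1) := hne.to_subtype
  refine le_ciInf fun ζ => ?_
  simp only [inner_gradient_polyFun, gaussianLaw_one]
  rw [← norm_polyL2_sq, ← norm_polyL2_sq]
  exact hmin ζ.2

lemma polyFun_add_smul_of_dirDeriv_eq_zero {k : ℕ} {q : MvPolynomial (Fin k) ℝ} {η : Vec k}
    (h : dirDeriv q η = 0) (z : Vec k) (t : ℝ) : polyFun q (z + t • η) = polyFun q z := by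
  have hd : ∀ t, HasDerivAt (fun t : ℝ => polyFun q (z + t • η)) 0 t := by
    intro t
    have h2 : HasDerivAt (fun t : ℝ => z + t • η) η t := by
      simpa using ((hasDerivAt_id t).smul_const η).const_add z
    have h3 := (differentiable_polyFun q (z + t • η)).hasFDerivAt.comp_hasDerivAt t h2
    rw [fderiv_polyFun, h, show polyFun (0 : MvPolynomial (Fin k) ℝ) (z + t • η) = 0 by
      simp [polyFun]] at h3
    exact h3
  have := is_const_of_deriv_eq_zero (fun t => (hd t).differentiableAt) (fun t => (hd t).deriv) t 0
  simpa using this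

lemma matVec_mem_colSpace {d k : ℕ} (U : Matrix (Fin d) (Fin k) ℝ) (η : Vec k) :
    matVec U η ∈ colSpace U := by
  have : matVec U η = ∑ j, η j • (WithLp.toLp 2 fun i => U i j : Vec d) := by
    ext i
    simp [matVec, Matrix.mulVec, dotProduct, mul_comm]
  rw [this]
  exact Submodule.sum_mem _ fun j _ =>
    Submodule.smul_mem _ _ (Submodule.subset_span ⟨j, rfl⟩)

/-- If the link function were constant in a direction `η`, the orthogonal complement of `U η`
would be a mean dimension-reduction subspace that does not contain the column space of `U`. -/
lemma minSignal_pos {d k r : ℕ} (hk : 0 < k) {K σY : ℝ} {P : Measure (Vec d × ℝ)}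
    [IsProbabilityMeasure P] {U : Matrix (Fin d) (Fin k) ℝ} {q : MvPolynomial (Fin k) ℝ}
    (hmod : PolynomialModel r K σY P U (polyFun q)) : 0 < minSignal (polyFun q) := by
  obtain ⟨η, hη, heq⟩ := exists_minSignal_eq hk q
  rw [heq]
  refine (integral_nonneg fun z => sq_nonneg _).lt_of_ne' fun h0 => ?_
  have hdir := eq_zero_of_integral_sq_eq_zero _ h0
  set v := matVec U η with hv
  have hvn : ‖v‖ = 1 := by rw [hv, norm_matVec hmod.orthonormal, hη]
  have hW : IsMeanDimReduction P (ℝ ∙ v)ᗮ := by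
    refine ⟨fun x => polyFun q (index U x), by fun_prop, ?_⟩
    filter_upwards [hmod.regression] with x hx
    rw [hx, Submodule.starProjection_orthogonal_val,
      Submodule.starProjection_unit_singleton ℝ hvn, index_sub, index_smul, hv,
      index_matVec hmod.orthonormal, sub_eq_add_neg, ← neg_smul,
      polyFun_add_smul_of_dirDeriv_eq_zero hdir]
  have hle : colSpace U ≤ (ℝ ∙ v)ᗮ := by
    rw [hmod.centralMeanSubspace.1]
    exact sInf_le hW
  have hmem := hle (matVec_mem_colSpace U η)
  rw [Submodule.mem_orthogonal_singleton_iff_inner_right, ← hv, real_inner_self_eq_norm_sq,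
    hvn] at hmem
  norm_num at hmem

/-! ### Second moments of the response -/

/-- The bound `2 ∫₀^∞ t K exp (-t² / (2 σY²)) dt` for the conditional variance of the response. -/
def noiseBound (K σY : ℝ) : ℝ :=
  2 * ∫ t in Set.Ioi (0 : ℝ), K * (t * Real.exp (-(1 / (2 * σY ^ 2)) * t ^ 2))

lemma noiseBound_nonneg {K : ℝ} (hK : 0 < K) (σY : ℝ) : 0 ≤ noiseBound K σY := by
  refine mul_nonneg zero_le_two (setIntegral_nonneg measurableSet_Ioi fun t ht => ?_)
  have : (0 : ℝ) < t := ht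
  positivity

/-- A subgaussian tail bounds the second moment (layer cake formula). -/
lemma lintegral_sq_le_noiseBound {K σY : ℝ} (hK : 0 < K) (hσ : 0 < σY) (μ : Measure ℝ) (m : ℝ)
    (hμ : ∀ t : ℝ, 0 < t → μ {y : ℝ | t < |y - m|} ≤
      ENNReal.ofReal (K * Real.exp (-t ^ 2 / (2 * σY ^ 2)))) :
    ∫⁻ y, ENNReal.ofReal ((y - m) ^ 2) ∂μ ≤ ENNReal.ofReal (noiseBound K σY) := by
  have hlc := lintegral_rpow_eq_lintegral_meas_lt_mul μ (f := fun y => |y - m|)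
    (Filter.Eventually.of_forall fun y => abs_nonneg _) (by fun_prop) (p := 2) two_pos
  have h1 : ∀ y : ℝ, (y - m) ^ 2 = |y - m| ^ (2 : ℝ) := by
    intro y; rw [Real.rpow_two, sq_abs]
  simp_rw [h1]
  rw [hlc]
  have hint : IntegrableOn (fun t : ℝ => K * (t * Real.exp (-(1 / (2 * σY ^ 2)) * t ^ 2)))
      (Set.Ioi 0) :=
    ((integrable_mul_exp_neg_mul_sq (b := 1 / (2 * σY ^ 2)) (by positivity)).const_mul
      K).integrableOn
  rw [noiseBound, ENNReal.ofReal_mul zero_le_two, ofReal_integral_eq_lintegral_ofReal hint]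
  · gcongr 1
    refine setLIntegral_mono' measurableSet_Ioi fun t ht => ?_
    have ht0 : (0 : ℝ) < t := ht
    refine (mul_le_mul_left (hμ t ht0) _).trans (le_of_eq ?_)
    rw [← ENNReal.ofReal_mul (by positivity)]
    congr 1
    rw [show (2 : ℝ) - 1 = 1 by norm_num, Real.rpow_one,
      show -t ^ 2 / (2 * σY ^ 2) = -(1 / (2 * σY ^ 2)) * t ^ 2 by ring]
    ring
  · filter_upwards [ae_restrict_mem measurableSet_Ioi] with t ht
    have ht0 : (0 : ℝ) < t := ht
    simp only [Pi.zero_apply]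
    positivity

lemma lintegral_response_sq_le {K σY : ℝ} (hK : 0 < K) (hσ : 0 < σY) (μ : Measure ℝ)
    [IsProbabilityMeasure μ] (m : ℝ)
    (hμ : ∀ t : ℝ, 0 < t → μ {y : ℝ | t < |y - m|} ≤
      ENNReal.ofReal (K * Real.exp (-t ^ 2 / (2 * σY ^ 2)))) :
    ∫⁻ y, ENNReal.ofReal (y ^ 2) ∂μ ≤ ENNReal.ofReal (2 * noiseBound K σY + 2 * m ^ 2) := by
  have h : ∀ y : ℝ, ENNReal.ofReal (y ^ 2) ≤
      ENNReal.ofReal 2 * ENNReal.ofReal ((y - m) ^ 2) + ENNReal.ofReal (2 * m ^ 2) := by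
    intro y
    rw [← ENNReal.ofReal_mul zero_le_two, ← ENNReal.ofReal_add (by positivity) (by positivity)]
    apply ENNReal.ofReal_le_ofReal
    nlinarith [sq_nonneg (y - 2 * m)]
  refine (lintegral_mono h).trans ?_
  have hn := noiseBound_nonneg hK σY
  rw [lintegral_add_right _ measurable_const, lintegral_const_mul' _ _ (by simp), lintegral_const,
    measure_univ, mul_one, ENNReal.ofReal_add (by positivity) (by positivity),
    ENNReal.ofReal_mul (p := 2) (q := noiseBound K σY) zero_le_two]
  gcongr
  exact lintegral_sq_le_noiseBound hK hσ μ m hμ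

/-! ### A single gradient observation -/

/-- The contribution `h⁻² ρ_h(x; θ) y (x - θ)` of one observation `(x, y)` to the gradient estimate
at `θ`. -/
def gradObs {d : ℕ} (h : ℝ) (θ : Vec d) (z : Vec d × ℝ) : Vec d :=
  h ^ (-2 : ℤ) • ((densityRatio (gaussianDensity d 1) h z.1 θ * z.2) • (z.1 - θ))

lemma measurable_gradObs {d : ℕ} (h : ℝ) :
    Measurable fun q : Vec d × (Vec d × ℝ) => gradObs h q.1 q.2 := by
  have h1 : Measurable fun q : Vec d × (Vec d × ℝ) =>
      densityRatio (gaussianDensity d 1) h q.2.1 q.1 :=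
    Measurable.comp (g := fun q : Vec d × Vec d => densityRatio (gaussianDensity d 1) h q.1 q.2)
      (f := fun q : Vec d × (Vec d × ℝ) => (q.2.1, q.1)) (measurable_densityRatio h)
      ((measurable_fst.comp measurable_snd).prodMk measurable_fst)
  have h2 : Measurable fun q : Vec d × (Vec d × ℝ) => q.2.1 - q.1 :=
    (measurable_fst.comp measurable_snd).sub measurable_fst
  exact ((h1.mul (measurable_snd.comp measurable_snd)).smul h2).const_smul (h ^ (-2 : ℤ))

lemma measurable_gradObs_right {d : ℕ} (h : ℝ) (θ : Vec d) : Measurable (gradObs h θ) :=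
  Measurable.comp (g := fun q : Vec d × (Vec d × ℝ) => gradObs h q.1 q.2)
    (f := fun z : Vec d × ℝ => (θ, z)) (measurable_gradObs h) measurable_prodMk_left

lemma norm_gradObs_sq {d : ℕ} (h : ℝ) (θ : Vec d) (z : Vec d × ℝ) :
    ‖gradObs h θ z‖ ^ 2 =
      (h ^ (-2 : ℤ)) ^ 2 * (densityRatio (gaussianDensity d 1) h z.1 θ ^ 2 * ‖z.1 - θ‖ ^ 2) *
        z.2 ^ 2 := by
  rw [gradObs, norm_smul, norm_smul, mul_pow, mul_pow, Real.norm_eq_abs, Real.norm_eq_abs, sq_abs,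
    sq_abs]
  ring

/-- The envelope `κ exp (‖θ‖² / (2 - h²)) (1 + ‖Uᵀθ‖)^{2r} (1 + ‖θ‖² / d)` of the conditional
second moments of the gradient estimates, where `κ = (h² (2 - h²))^{-d/2}`. -/
def envelope {d k : ℕ} (U : Matrix (Fin d) (Fin k) ℝ) (r : ℕ) (h : ℝ) (θ : Vec d) : ℝ :=
  (h ^ 2 * (2 - h ^ 2)) ^ (-(d : ℝ) / 2) * Real.exp (‖θ‖ ^ 2 / (2 - h ^ 2)) *
    ((1 + ‖index U θ‖) ^ (2 * r) * (1 + ‖θ‖ ^ 2 / d))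

/-- At the shifted and rescaled point `(1 + σ²) θ + σ g` of the tilted design law, with
`σ² = h² / (2 - h²)`, the integrand separates into a factor in `θ` and a factor in `g`. The
condition `h² ≤ 5 / 4` keeps `σ²` below `4 h² / 3`. -/
lemma shifted_integrand_le {d k : ℕ} {U : Matrix (Fin d) (Fin k) ℝ} (hd : 0 < d) (r : ℕ) {h : ℝ}
    (hh : 0 < h) (hh2 : h ^ 2 ≤ 5 / 4) (θ g : Vec d) :
    (1 + ‖index U ((2 / (2 - h ^ 2)) • θ + √(h ^ 2 / (2 - h ^ 2)) • g)‖) ^ (2 * r) *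
        ‖(2 / (2 - h ^ 2)) • θ + √(h ^ 2 / (2 - h ^ 2)) • g - θ‖ ^ 2 ≤
      (3 ^ (2 * r) * 6 * h ^ 2 * d * ((1 + ‖index U θ‖) ^ (2 * r) * (1 + ‖θ‖ ^ 2 / d))) *
        ((1 + ‖index U g‖) ^ (2 * r) * (1 + ‖g‖ ^ 2 / d) ^ 1) := by
  have hd' : (0 : ℝ) < d := by exact_mod_cast hd
  have h2 : 0 < 2 - h ^ 2 := by linarith
  set a := 2 / (2 - h ^ 2) with ha
  set s := √(h ^ 2 / (2 - h ^ 2)) with hs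
  have hs0 : 0 ≤ s := Real.sqrt_nonneg _
  have hs2 : s ^ 2 = h ^ 2 / (2 - h ^ 2) := Real.sq_sqrt (by positivity)
  have has : a - 1 = s ^ 2 := by rw [hs2, ha]; field_simp; ring
  have hsq : s ^ 2 ≤ 4 / 3 * h ^ 2 := by
    rw [hs2, div_le_iff₀ h2]; nlinarith [sq_nonneg h]
  have hs53 : s ^ 2 ≤ 5 / 3 := by linarith
  have hs15 : s ≤ 3 := by nlinarith
  have ha3 : a ≤ 3 := by linarith
  have ha0 : 0 ≤ a := by positivity
  have hi : 1 + ‖index U (a • θ + s • g)‖ ≤ 3 * ((1 + ‖index U θ‖) * (1 + ‖index U g‖)) := by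
    rw [index_add, index_smul, index_smul]
    refine (add_le_add_right (norm_add_le _ _) 1).trans ?_
    rw [norm_smul, norm_smul, Real.norm_of_nonneg ha0, Real.norm_of_nonneg hs0]
    nlinarith [mul_nonneg (sub_nonneg.2 ha3) (norm_nonneg (index U θ)),
      mul_nonneg (sub_nonneg.2 hs15) (norm_nonneg (index U g)),
      mul_nonneg (norm_nonneg (index U θ)) (norm_nonneg (index U g))]
  have hn : ‖a • θ + s • g - θ‖ ^ 2 ≤ 6 * h ^ 2 * d * ((1 + ‖θ‖ ^ 2 / d) * (1 + ‖g‖ ^ 2 / d)) := by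
    have e1 : a • θ + s • g - θ = s ^ 2 • θ + s • g := by
      rw [← has, sub_smul, one_smul]; abel
    have e2 : ‖s ^ 2 • θ + s • g‖ ≤ s ^ 2 * ‖θ‖ + s * ‖g‖ := by
      refine (norm_add_le _ _).trans ?_
      rw [norm_smul, norm_smul, Real.norm_of_nonneg hs0, Real.norm_of_nonneg (sq_nonneg s)]
    rw [e1]
    calc ‖s ^ 2 • θ + s • g‖ ^ 2 ≤ (s ^ 2 * ‖θ‖ + s * ‖g‖) ^ 2 :=
          pow_le_pow_left₀ (norm_nonneg _) e2 2
      _ ≤ 2 * s ^ 2 * (s ^ 2 * ‖θ‖ ^ 2 + ‖g‖ ^ 2) := by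
          nlinarith [sq_nonneg (s ^ 2 * ‖θ‖ - s * ‖g‖)]
      _ ≤ 2 * (4 / 3 * h ^ 2) * (5 / 3 * ‖θ‖ ^ 2 + 5 / 3 * ‖g‖ ^ 2) := by
          gcongr
          nlinarith [sq_nonneg ‖g‖]
      _ ≤ 6 * h ^ 2 * (‖θ‖ ^ 2 + ‖g‖ ^ 2) := by
          nlinarith [mul_nonneg (sq_nonneg h) (add_nonneg (sq_nonneg ‖θ‖) (sq_nonneg ‖g‖))]
      _ ≤ 6 * h ^ 2 * (d * ((1 + ‖θ‖ ^ 2 / d) * (1 + ‖g‖ ^ 2 / d))) := by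
          gcongr
          have : d * ((1 + ‖θ‖ ^ 2 / d) * (1 + ‖g‖ ^ 2 / d)) =
              d + ‖θ‖ ^ 2 + ‖g‖ ^ 2 + ‖θ‖ ^ 2 * ‖g‖ ^ 2 / d := by
            field_simp
            ring
          rw [this]
          have : 0 ≤ ‖θ‖ ^ 2 * ‖g‖ ^ 2 / d := by positivity
          linarith
      _ = _ := by ring
  calc _ ≤ (3 * ((1 + ‖index U θ‖) * (1 + ‖index U g‖))) ^ (2 * r) *
        (6 * h ^ 2 * d * ((1 + ‖θ‖ ^ 2 / d) * (1 + ‖g‖ ^ 2 / d))) := by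
        gcongr
    _ = _ := by
        rw [mul_pow, mul_pow]
        ring

/-- The constant in the bound for the second moment of a gradient observation. -/
def obsConst (k r : ℕ) (C K σY : ℝ) : ℝ :=
  (2 * noiseBound K σY + 2 * C ^ 2) * (3 ^ (2 * r) * 6) *
    (gaussMoment k (2 * r * 2) + gaussMoment 1 (2 * (1 * 2)))

lemma lintegral_condKernel_gradObs_le {d k r : ℕ} {K σY : ℝ} (hK : 0 < K) (hσ : 0 < σY)
    {P : Measure (Vec d × ℝ)} [IsProbabilityMeasure P] {U : Matrix (Fin d) (Fin k) ℝ}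
    {f : Vec k → ℝ} (hmod : PolynomialModel r K σY P U f) {C : ℝ}
    (hC : ∀ z, |f z| ≤ C * (1 + ‖z‖) ^ r) (h : ℝ) (θ : Vec d) :
    ∀ᵐ x ∂P.fst,
      ∫⁻ y, ENNReal.ofReal (‖gradObs h θ (x, y)‖ ^ 2) ∂(P.condKernel x) ≤
        ENNReal.ofReal ((h ^ (-2 : ℤ)) ^ 2 * (2 * noiseBound K σY + 2 * C ^ 2)) *
          (ENNReal.ofReal (densityRatio (gaussianDensity d 1) h x θ ^ 2) *
            ENNReal.ofReal ((1 + ‖index U x‖) ^ (2 * r) * ‖x - θ‖ ^ 2)) := by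
  have hN := noiseBound_nonneg hK σY
  filter_upwards [hmod.noise, hmod.regression] with x hx hreg
  have hy := lintegral_response_sq_le hK hσ (P.condKernel x) (regressionFun P x) hx
  simp_rw [norm_gradObs_sq]
  have hsplit : ∀ y : ℝ, ENNReal.ofReal ((h ^ (-2 : ℤ)) ^ 2 *
      (densityRatio (gaussianDensity d 1) h x θ ^ 2 * ‖x - θ‖ ^ 2) * y ^ 2) =
      ENNReal.ofReal ((h ^ (-2 : ℤ)) ^ 2 *
      (densityRatio (gaussianDensity d 1) h x θ ^ 2 * ‖x - θ‖ ^ 2)) * ENNReal.ofReal (y ^ 2) :=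
    fun y => ENNReal.ofReal_mul (by positivity)
  simp_rw [hsplit]
  rw [lintegral_const_mul' _ _ ENNReal.ofReal_ne_top]
  refine (mul_le_mul_right hy _).trans ?_
  rw [← ENNReal.ofReal_mul (by positivity), ← ENNReal.ofReal_mul (by positivity),
    ← ENNReal.ofReal_mul (by positivity)]
  apply ENNReal.ofReal_le_ofReal
  have hf2 : regressionFun P x ^ 2 ≤ C ^ 2 * (1 + ‖index U x‖) ^ (2 * r) := by
    rw [hreg, ← sq_abs, mul_comm 2 r, pow_mul, ← mul_pow]
    exact pow_le_pow_left₀ (abs_nonneg _) (hC _) 2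
  have h1 : 1 ≤ (1 + ‖index U x‖) ^ (2 * r) := one_le_pow₀ (by simp)
  have h3 : 2 * noiseBound K σY + 2 * regressionFun P x ^ 2 ≤
      (2 * noiseBound K σY + 2 * C ^ 2) * (1 + ‖index U x‖) ^ (2 * r) := by
    nlinarith
  calc _ ≤ (h ^ (-2 : ℤ)) ^ 2 * (densityRatio (gaussianDensity d 1) h x θ ^ 2 * ‖x - θ‖ ^ 2) *
        ((2 * noiseBound K σY + 2 * C ^ 2) * (1 + ‖index U x‖) ^ (2 * r)) :=
        mul_le_mul_of_nonneg_left h3 (by positivity)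
    _ = _ := by ring

/-- Second moment of a gradient observation: the tilted design law is Gaussian with a shifted mean,
so that the growth of the regression function enters only through the index. -/
lemma lintegral_norm_gradObs_sq_le {d k r : ℕ} (hd : 0 < d) {K σY : ℝ} (hK : 0 < K) (hσ : 0 < σY)
    {P : Measure (Vec d × ℝ)} [IsProbabilityMeasure P] {U : Matrix (Fin d) (Fin k) ℝ}
    {f : Vec k → ℝ} (hmod : PolynomialModel r K σY P U f) {C : ℝ}
    (hC : ∀ z, |f z| ≤ C * (1 + ‖z‖) ^ r) {h : ℝ} (hh : 0 < h) (hh2 : h ^ 2 ≤ 5 / 4) (θ : Vec d) :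
    ∫⁻ z, ENNReal.ofReal (‖gradObs h θ z‖ ^ 2) ∂P ≤
      ENNReal.ofReal (d * (obsConst k r C K σY * h ^ (-2 : ℤ) * envelope U r h θ)) := by
  have hd' : (0 : ℝ) < d := by exact_mod_cast hd
  have h2 : 0 < 2 - h ^ 2 := by linarith
  have hN := noiseBound_nonneg hK σY
  have hgm := measurable_gradObs_right h θ
  have hF : Measurable fun x : Vec d =>
      ENNReal.ofReal ((1 + ‖index U x‖) ^ (2 * r) * ‖x - θ‖ ^ 2) := by fun_prop
  rw [← Measure.lintegral_condKernel (hgm.norm.pow_const 2).ennreal_ofReal]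
  have hCY0 : 0 ≤ 2 * noiseBound K σY + 2 * C ^ 2 := by positivity
  have hM : 0 ≤ gaussMoment k (2 * r * 2) + gaussMoment 1 (2 * (1 * 2)) :=
    add_nonneg (gaussMoment_nonneg _ _) (gaussMoment_nonneg _ _)
  refine (lintegral_mono_ae (lintegral_condKernel_gradObs_le hK hσ hmod hC h θ)).trans ?_
  rw [lintegral_const_mul' _ _ ENNReal.ofReal_ne_top, hmod.design, gaussianLaw_one,
    lintegral_densityRatio_sq_mul hh (by linarith) θ hF]
  have hA : 0 ≤ 3 ^ (2 * r) * 6 * h ^ 2 * d *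
      ((1 + ‖index U θ‖) ^ (2 * r) * (1 + ‖θ‖ ^ 2 / d)) := by positivity
  have hbd : ∫⁻ g, ENNReal.ofReal ((1 + ‖index U ((2 / (2 - h ^ 2)) • θ +
      √(h ^ 2 / (2 - h ^ 2)) • g)‖) ^ (2 * r) *
        ‖(2 / (2 - h ^ 2)) • θ + √(h ^ 2 / (2 - h ^ 2)) • g - θ‖ ^ 2) ∂(stdGaussian (Vec d)) ≤
      ENNReal.ofReal (3 ^ (2 * r) * 6 * h ^ 2 * d *
        ((1 + ‖index U θ‖) ^ (2 * r) * (1 + ‖θ‖ ^ 2 / d))) *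
      ENNReal.ofReal (gaussMoment k (2 * r * 2) + gaussMoment 1 (2 * (1 * 2))) := by
    refine le_trans ?_ (mul_le_mul_right (lintegral_index_norm_moment hmod.orthonormal hd
      (2 * r) 1) _)
    rw [← lintegral_const_mul' _ _ ENNReal.ofReal_ne_top]
    refine lintegral_mono fun g => ?_
    rw [← ENNReal.ofReal_mul hA]
    exact ENNReal.ofReal_le_ofReal (shifted_integrand_le hd r hh hh2 θ g)
  refine (mul_le_mul_right (mul_le_mul_right hbd _) _).trans ?_
  rw [← ENNReal.ofReal_mul hA, ← ENNReal.ofReal_mul (by positivity),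
    ← ENNReal.ofReal_mul (by positivity)]
  apply ENNReal.ofReal_le_ofReal
  apply le_of_eq
  rw [obsConst, envelope]
  have hz : h ^ (-2 : ℤ) * h ^ 2 = 1 := by
    rw [zpow_neg, zpow_ofNat, inv_mul_cancel₀ (by positivity)]
  generalize Real.exp (‖θ‖ ^ 2 / (2 - h ^ 2)) = E
  generalize (h ^ 2 * (2 - h ^ 2)) ^ (-(d : ℝ) / 2) = κ
  generalize (1 + ‖index U θ‖) ^ (2 * r) * (1 + ‖θ‖ ^ 2 / d) = G
  generalize gaussMoment k (2 * r * 2) + gaussMoment 1 (2 * (1 * 2)) = M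
  generalize h ^ (-2 : ℤ) = a at hz ⊢
  linear_combination ((2 * noiseBound K σY + 2 * C ^ 2) * (3 ^ (2 * r) * 6) * M * a * d *
    (κ * E * G)) * hz

/-! ### The smoothed gradient -/

/-- The mean of a gradient observation at `θ`, i.e. the smoothed gradient. -/
def gradMean {d : ℕ} (P : Measure (Vec d × ℝ)) (h : ℝ) (θ : Vec d) : Vec d :=
  ∫ z, gradObs h θ z ∂P

section
variable {d k r : ℕ} {K σY : ℝ} {P : Measure (Vec d × ℝ)} [IsProbabilityMeasure P]
  {U : Matrix (Fin d) (Fin k) ℝ} {q : MvPolynomial (Fin k) ℝ} {C h : ℝ}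

lemma memLp_gradObs {f : Vec k → ℝ} (hd : 0 < d) (hK : 0 < K) (hσ : 0 < σY)
    (hmod : PolynomialModel r K σY P U f)
    (hC : ∀ z, |f z| ≤ C * (1 + ‖z‖) ^ r) (hh : 0 < h) (hh2 : h ^ 2 ≤ 5 / 4) (θ : Vec d) :
    MemLp (gradObs h θ) 2 P := by
  have hm := measurable_gradObs_right h θ
  rw [memLp_two_iff_integrable_sq_norm hm.aestronglyMeasurable]
  refine ⟨(hm.norm.pow_const 2).aestronglyMeasurable, ?_⟩
  rw [hasFiniteIntegral_iff_ofReal (Filter.Eventually.of_forall fun z => sq_nonneg _)]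
  exact (lintegral_norm_gradObs_sq_le hd hK hσ hmod hC hh hh2 θ).trans_lt ENNReal.ofReal_lt_top

lemma inner_gradMean {f : Vec k → ℝ} (hf : Measurable f) (hd : 0 < d) (hK : 0 < K) (hσ : 0 < σY)
    (hmod : PolynomialModel r K σY P U f)
    (hC : ∀ z, |f z| ≤ C * (1 + ‖z‖) ^ r) (hh : 0 < h) (hh2 : h ^ 2 ≤ 5 / 4) (θ η : Vec d) :
    inner ℝ η (gradMean P h θ) =
      h⁻¹ * ∫ g, f (index U θ + h • index U g) * inner ℝ η g ∂(stdGaussian (Vec d)) := by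
  have hint : Integrable (gradObs h θ) P :=
    (memLp_gradObs hd hK hσ hmod hC hh hh2 θ).integrable one_le_two
  rw [gradMean, ← integral_inner hint, ← Measure.integral_condKernel (hint.const_inner η)]
  have h1 : ∀ᵐ x ∂P.fst, ∫ y, inner ℝ η (gradObs h θ (x, y)) ∂(P.condKernel x) =
      densityRatio (gaussianDensity d 1) h x θ *
        (h ^ (-2 : ℤ) * (f (index U x) * inner ℝ η (x - θ))) := by
    filter_upwards [hmod.regression] with x hx
    rw [← hx, regressionFun]
    simp_rw [gradObs, inner_smul_right]
    rw [integral_const_mul, integral_mul_const, integral_const_mul]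
    ring
  rw [integral_congr_ae h1, hmod.design, gaussianLaw_one, integral_densityRatio_mul hh θ
    (by fun_prop), ← integral_const_mul]
  congr 1
  ext g
  rw [index_add, index_smul, add_sub_cancel_left, inner_smul_right, zpow_neg, zpow_ofNat]
  field_simp

/-- A function of the index is uncorrelated with the directions orthogonal to the columns of `U`,
because the reflection in such a direction preserves the Gaussian law and the index. -/
lemma integral_index_mul_inner_eq_zero (F : Vec k → ℝ) {η : Vec d} (hη : index U η = 0) :
    ∫ g, F (index U g) * inner ℝ η g ∂(stdGaussian (Vec d)) = 0 := by
  set R := Submodule.reflection (ℝ ∙ η)ᗮ with hR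
  have hinner : ∀ x y : Vec d, inner ℝ (R x) y = inner ℝ x (R y) := by
    intro x y
    rw [← R.inner_map_map (R x) y, hR, Submodule.reflection_reflection]
  have hidx : ∀ g, index U (R g) = index U g := by
    intro g
    refine ext_inner_right ℝ fun z => ?_
    rw [inner_index, inner_index, hinner]
    congr 1
    refine Submodule.reflection_mem_subspace_eq_self ?_
    rw [Submodule.mem_orthogonal_singleton_iff_inner_right, ← inner_index, hη, inner_zero_left]
  have hneg : ∀ g, inner ℝ η (R g) = -inner ℝ η g := by
    intro g
    rw [← hinner, hR, Submodule.reflection_orthogonalComplement_singleton_eq_neg, inner_neg_left]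
  have hmap : (stdGaussian (Vec d)).map R = stdGaussian (Vec d) := stdGaussian_map R
  have h1 : ∫ g, F (index U g) * inner ℝ η g ∂(stdGaussian (Vec d)) =
      ∫ g, F (index U (R g)) * inner ℝ η (R g) ∂(stdGaussian (Vec d)) := by
    conv_lhs => rw [← hmap]
    exact integral_map_equiv R.toHomeomorph.toMeasurableEquiv _
  simp_rw [hidx, hneg, mul_neg, integral_neg] at h1
  linarith

lemma gradMean_eq_matVec {f : Vec k → ℝ} (hf : Measurable f) (hd : 0 < d) (hK : 0 < K)
    (hσ : 0 < σY) (hmod : PolynomialModel r K σY P U f)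
    (hC : ∀ z, |f z| ≤ C * (1 + ‖z‖) ^ r) (hh : 0 < h) (hh2 : h ^ 2 ≤ 5 / 4) (θ : Vec d) :
    gradMean P h θ = matVec U (index U (gradMean P h θ)) := by
  set b := gradMean P h θ with hb
  set e := b - matVec U (index U b) with he
  have hUe : index U e = 0 := by
    rw [he, index_sub, index_matVec hmod.orthonormal, sub_self]
  have h1 : inner ℝ e b = 0 := by
    rw [hb, inner_gradMean hf hd hK hσ hmod hC hh hh2,
      integral_index_mul_inner_eq_zero (fun u => f (index U θ + h • u)) hUe, mul_zero]
  have h2 : inner ℝ e (matVec U (index U b)) = 0 := by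
    rw [← inner_index, hUe, inner_zero_left]
  have h3 : inner ℝ e e = 0 := by
    nth_rewrite 2 [he]
    rw [inner_sub_right, h1, h2, sub_zero]
  exact sub_eq_zero.1 (inner_self_eq_zero.1 h3)

lemma inner_index_gradMean {f : Vec k → ℝ} (hf : Measurable f) (hd : 0 < d) (hK : 0 < K)
    (hσ : 0 < σY) (hmod : PolynomialModel r K σY P U f)
    (hC : ∀ z, |f z| ≤ C * (1 + ‖z‖) ^ r) (hh : 0 < h) (hh2 : h ^ 2 ≤ 5 / 4) (θ : Vec d)
    (ζ : Vec k) :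
    inner ℝ ζ (index U (gradMean P h θ)) =
      h⁻¹ * ∫ z, f (index U θ + h • z) * inner ℝ ζ z ∂(stdGaussian (Vec k)) := by
  rw [real_inner_comm, inner_index, real_inner_comm,
    inner_gradMean hf hd hK hσ hmod hC hh hh2 θ, ← integral_comp_index hmod.orthonormal
      (F := fun z => f (index U θ + h • z) * inner ℝ ζ z) (by fun_prop)]
  congr 2
  ext g
  rw [real_inner_comm g, ← inner_index, real_inner_comm ζ]

/-- The smoothed gradient is the Gaussian average of the gradient (Stein's identity). -/
lemma inner_index_gradMean_eq (hd : 0 < d) (hK : 0 < K) (hσ : 0 < σY)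
    (hmod : PolynomialModel r K σY P U (polyFun q))
    (hC : ∀ z, |polyFun q z| ≤ C * (1 + ‖z‖) ^ r) (hh : 0 < h) (hh2 : h ^ 2 ≤ 5 / 4) (θ : Vec d)
    (ζ : Vec k) :
    inner ℝ ζ (index U (gradMean P h θ)) =
      ∫ z, polyFun (dirDeriv q ζ) (index U θ + h • z) ∂(stdGaussian (Vec k)) := by
  rw [inner_index_gradMean (measurable_polyFun q) hd hK hσ hmod hC hh hh2,
    integral_polyFun_affine_mul_inner, ← mul_assoc, inv_mul_cancel₀ hh.ne', one_mul]

lemma norm_gradMean_le {f : Vec k → ℝ} (hf : Measurable f) (hd : 0 < d) (hK : 0 < K)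
    (hσ : 0 < σY) (hmod : PolynomialModel r K σY P U f) (hC0 : 0 ≤ C)
    (hC : ∀ z, |f z| ≤ C * (1 + ‖z‖) ^ r) (hh : 0 < h) (hh2 : h ^ 2 ≤ 5 / 4) (θ : Vec d) :
    ‖gradMean P h θ‖ ≤ h⁻¹ * (C * 3 ^ r * gaussMoment k (r + 1) * (1 + ‖index U θ‖) ^ r) := by
  set w := index U (gradMean P h θ) with hw
  have hwn : ‖gradMean P h θ‖ = ‖w‖ := by
    rw [gradMean_eq_matVec hf hd hK hσ hmod hC hh hh2 θ, norm_matVec hmod.orthonormal]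
  have hh3 : h ≤ 3 := by nlinarith
  have hpt : ∀ z : Vec k, f (index U θ + h • z) * inner ℝ w z ≤
      (C * 3 ^ r * (1 + ‖index U θ‖) ^ r * ‖w‖) * (1 + ‖z‖) ^ (r + 1) := by
    intro z
    have h1 : 1 + ‖index U θ + h • z‖ ≤ 3 * (1 + ‖index U θ‖) * (1 + ‖z‖) := by
      have := norm_add_le (index U θ) (h • z)
      rw [norm_smul, Real.norm_of_nonneg hh.le] at this
      nlinarith [mul_nonneg (sub_nonneg.2 hh3) (norm_nonneg z), norm_nonneg (index U θ),
        norm_nonneg z, mul_nonneg (norm_nonneg (index U θ)) (norm_nonneg z)]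
    calc f (index U θ + h • z) * inner ℝ w z ≤ |f (index U θ + h • z)| * |inner ℝ w z| := by
          rw [← abs_mul]; exact le_abs_self _
      _ ≤ (C * (3 * (1 + ‖index U θ‖) * (1 + ‖z‖)) ^ r) * (‖w‖ * (1 + ‖z‖)) := by
          have h2 : |inner ℝ w z| ≤ ‖w‖ * (1 + ‖z‖) :=
            (abs_real_inner_le_norm w z).trans (by nlinarith [norm_nonneg w])
          have h3 : |f (index U θ + h • z)| ≤ C * (3 * (1 + ‖index U θ‖) * (1 + ‖z‖)) ^ r :=
            (hC _).trans (by gcongr)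
          exact mul_le_mul h3 h2 (abs_nonneg _) (by positivity)
      _ = _ := by rw [mul_pow, mul_pow]; ring
  have hM := gaussMoment_nonneg k (r + 1)
  have hbd : ∫ z, f (index U θ + h • z) * inner ℝ w z ∂(stdGaussian (Vec k)) ≤
      (C * 3 ^ r * (1 + ‖index U θ‖) ^ r * ‖w‖) * gaussMoment k (r + 1) := by
    by_cases hi : Integrable (fun z => f (index U θ + h • z) * inner ℝ w z) (stdGaussian (Vec k))
    · rw [gaussMoment, ← integral_const_mul]
      exact integral_mono hi ((integrable_one_add_norm_pow k _).const_mul _) hpt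
    -- This case does not occur, but the junk value `0` also satisfies the bound.
    · rw [integral_undef hi]
      positivity
  have hsq : ‖w‖ * ‖w‖ ≤ h⁻¹ *
      (C * 3 ^ r * gaussMoment k (r + 1) * (1 + ‖index U θ‖) ^ r) * ‖w‖ := by
    rw [← real_inner_self_eq_norm_mul_norm]
    nth_rewrite 2 [hw]
    rw [inner_index_gradMean hf hd hK hσ hmod hC hh hh2]
    refine (mul_le_mul_of_nonneg_left hbd (by positivity)).trans (le_of_eq (by ring))
  rw [hwn]
  rcases (norm_nonneg w).eq_or_lt with h0 | h0
  · rw [← h0]; positivity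
  · exact le_of_mul_le_mul_right hsq h0

lemma one_le_rpow_factor (d : ℕ) (hh : 0 < h) (hh2 : h ^ 2 ≤ 5 / 4) :
    1 ≤ (h ^ 2 * (2 - h ^ 2)) ^ (-(d : ℝ) / 2) := by
  have h2 : 0 < 2 - h ^ 2 := by linarith
  refine Real.one_le_rpow_of_pos_of_le_one_of_nonpos (by positivity)
    (by nlinarith [sq_nonneg (h ^ 2 - 1)]) ?_
  have : (0 : ℝ) ≤ d := Nat.cast_nonneg d
  linarith

/-- The constant in the bound for the conditional second moment of a gradient estimate. -/
def estConst (k r : ℕ) (C K σY : ℝ) : ℝ :=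
  (C * 3 ^ r * gaussMoment k (r + 1)) ^ 2 + obsConst k r C K σY

lemma obsConst_nonneg (k r : ℕ) (C : ℝ) (hK : 0 < K) (σY : ℝ) : 0 ≤ obsConst k r C K σY := by
  have := noiseBound_nonneg hK σY
  have := gaussMoment_nonneg k (2 * r * 2)
  have := gaussMoment_nonneg 1 (2 * (1 * 2))
  unfold obsConst
  positivity

/-- Conditional second moment of a gradient estimate from `d` observations. -/
lemma gradMean_sq_add_le {f : Vec k → ℝ} (hf : Measurable f) (hd : 0 < d) (hK : 0 < K)
    (hσ : 0 < σY) (hmod : PolynomialModel r K σY P U f) (hC0 : 0 ≤ C)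
    (hC : ∀ z, |f z| ≤ C * (1 + ‖z‖) ^ r) (hh : 0 < h) (hh2 : h ^ 2 ≤ 5 / 4) (θ : Vec d) :
    ‖gradMean P h θ‖ ^ 2 + (1 / (d : ℝ)) * ∫ z, ‖gradObs h θ z‖ ^ 2 ∂P ≤
      estConst k r C K σY * h ^ (-2 : ℤ) * envelope U r h θ := by
  have hd' : (0 : ℝ) < d := by exact_mod_cast hd
  have h2 : 0 < 2 - h ^ 2 := by linarith
  have hO := obsConst_nonneg k r C hK σY
  have henv0 : 0 ≤ envelope U r h θ := by unfold envelope; positivity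
  have h1 : ∫ z, ‖gradObs h θ z‖ ^ 2 ∂P ≤
      d * (obsConst k r C K σY * h ^ (-2 : ℤ) * envelope U r h θ) := by
    rw [integral_eq_lintegral_of_nonneg_ae (Filter.Eventually.of_forall fun z => sq_nonneg _)
      ((measurable_gradObs_right h θ).norm.pow_const 2).aestronglyMeasurable]
    exact ENNReal.toReal_le_of_le_ofReal (by positivity)
      (lintegral_norm_gradObs_sq_le hd hK hσ hmod hC hh hh2 θ)
  have h3 : ‖gradMean P h θ‖ ^ 2 ≤
      (C * 3 ^ r * gaussMoment k (r + 1)) ^ 2 * h ^ (-2 : ℤ) * envelope U r h θ := by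
    have hb := pow_le_pow_left₀ (norm_nonneg _)
      (norm_gradMean_le hf hd hK hσ hmod hC0 hC hh hh2 θ) 2
    have henv : (1 + ‖index U θ‖) ^ (2 * r) ≤ envelope U r h θ := by
      have e1 := one_le_rpow_factor d hh hh2
      have e2 : 1 ≤ Real.exp (‖θ‖ ^ 2 / (2 - h ^ 2)) := Real.one_le_exp (by positivity)
      have e3 : 1 ≤ 1 + ‖θ‖ ^ 2 / d := by
        have : 0 ≤ ‖θ‖ ^ 2 / d := by positivity
        linarith
      have e4 : (0 : ℝ) ≤ (1 + ‖index U θ‖) ^ (2 * r) := by positivity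
      rw [envelope]
      calc (1 + ‖index U θ‖) ^ (2 * r) = 1 * ((1 + ‖index U θ‖) ^ (2 * r) * 1) := by ring
        _ ≤ _ := mul_le_mul (one_le_mul_of_one_le_of_one_le e1 e2)
          (mul_le_mul_of_nonneg_left e3 e4) (by positivity) (by positivity)
    calc ‖gradMean P h θ‖ ^ 2 ≤ _ := hb
      _ = (C * 3 ^ r * gaussMoment k (r + 1)) ^ 2 * h ^ (-2 : ℤ) *
          (1 + ‖index U θ‖) ^ (2 * r) := by
        rw [zpow_neg, zpow_ofNat, mul_pow, mul_pow, ← pow_mul, mul_comm r 2, inv_pow]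
        ring
      _ ≤ _ := mul_le_mul_of_nonneg_left henv (by positivity)
  calc _ ≤ (C * 3 ^ r * gaussMoment k (r + 1)) ^ 2 * h ^ (-2 : ℤ) * envelope U r h θ +
        (1 / (d : ℝ)) * (d * (obsConst k r C K σY * h ^ (-2 : ℤ) * envelope U r h θ)) := by
        gcongr
    _ = _ := by
      rw [estConst]
      field_simp

/-- Second moment of the envelope under the law of the locations. The tilt `exp (a ‖θ‖²)` with
`a = 2 / (2 - h²)` costs `(1 - 2 a s²)^{-d/2}`, and `2 a h² ≤ 20` since `h² ≤ 5 / 4`. -/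
lemma lintegral_envelope_sq_le (hU : U.transpose * U = 1) (hd : 0 < d) (r : ℕ) (hh : 0 < h)
    (hh2 : h ^ 2 ≤ 5 / 4) {s : ℝ} (hs : 0 < s) (hs2 : 20 * s ^ 2 < h ^ 2) :
    ∫⁻ θ, ENNReal.ofReal (envelope U r h θ ^ 2) ∂(gaussianLaw d s) ≤
      ENNReal.ofReal (((h ^ 2 * (2 - h ^ 2)) ^ (-(d : ℝ) / 2)) ^ 2 *
        (1 - 20 * (s ^ 2 / h ^ 2)) ^ (-(d : ℝ) / 2) *
        (gaussMoment k (2 * r * 2 * 2) + gaussMoment 1 (2 * (2 * 2)))) := by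
  have h2 : 0 < 2 - h ^ 2 := by linarith
  set a := 2 / (2 - h ^ 2) with ha
  set κ := (h ^ 2 * (2 - h ^ 2)) ^ (-(d : ℝ) / 2) with hκ
  have ha3 : a ≤ 8 / 3 := by rw [ha, div_le_iff₀ h2]; linarith
  have ha0 : 0 < a := by positivity
  have hs1 : s ^ 2 ≤ 1 / 16 := by linarith
  have hv : 2 * a * s ^ 2 ≤ 1 / 3 := by nlinarith [sq_nonneg s]
  have hG : Measurable fun θ : Vec d =>
      ENNReal.ofReal ((1 + ‖index U θ‖) ^ (2 * r * 2) * (1 + ‖θ‖ ^ 2 / d) ^ 2) := by fun_prop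
  have hsplit : ∀ θ : Vec d, ENNReal.ofReal (envelope U r h θ ^ 2) =
      ENNReal.ofReal (κ ^ 2) * (ENNReal.ofReal (Real.exp (a * ‖θ‖ ^ 2)) *
        ENNReal.ofReal ((1 + ‖index U θ‖) ^ (2 * r * 2) * (1 + ‖θ‖ ^ 2 / d) ^ 2)) := by
    intro θ
    rw [← ENNReal.ofReal_mul (Real.exp_pos _).le, ← ENNReal.ofReal_mul (sq_nonneg _), envelope]
    congr 1
    have : Real.exp (a * ‖θ‖ ^ 2) = Real.exp (‖θ‖ ^ 2 / (2 - h ^ 2)) ^ 2 := by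
      rw [← Real.exp_nat_mul, ha]
      congr 1
      push_cast
      ring
    rw [this, pow_mul _ (2 * r) 2]
    ring
  simp_rw [hsplit]
  rw [lintegral_const_mul' _ _ ENNReal.ofReal_ne_top,
    lintegral_exp_sq_mul_gaussianLaw hs (by linarith) hG]
  set t := √(s ^ 2 / (1 - 2 * a * s ^ 2)) with ht
  have ht0 : 0 ≤ t := Real.sqrt_nonneg _
  have ht1 : t ≤ 1 := by
    rw [ht, Real.sqrt_le_left (by norm_num), one_pow, div_le_one (by linarith)]
    linarith
  have hmono : ∀ g : Vec d,
      ENNReal.ofReal ((1 + ‖index U (t • g)‖) ^ (2 * r * 2) * (1 + ‖t • g‖ ^ 2 / d) ^ 2) ≤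
        ENNReal.ofReal ((1 + ‖index U g‖) ^ (2 * r * 2) * (1 + ‖g‖ ^ 2 / d) ^ 2) := by
    intro g
    apply ENNReal.ofReal_le_ofReal
    rw [index_smul, norm_smul, norm_smul, Real.norm_of_nonneg ht0]
    have e1 : t * ‖index U g‖ ≤ ‖index U g‖ := mul_le_of_le_one_left (norm_nonneg _) ht1
    have e2 : t * ‖g‖ ≤ ‖g‖ := mul_le_of_le_one_left (norm_nonneg _) ht1
    gcongr
  refine (mul_le_mul_right (mul_le_mul_right ((lintegral_mono hmono).trans
    (lintegral_index_norm_moment hU hd _ _)) _) _).trans ?_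
  rw [← ENNReal.ofReal_mul (Real.rpow_nonneg (by linarith) _), ← ENNReal.ofReal_mul (sq_nonneg _),
    mul_assoc (κ ^ 2)]
  apply ENNReal.ofReal_le_ofReal
  have hM := add_nonneg (gaussMoment_nonneg k (2 * r * 2 * 2)) (gaussMoment_nonneg 1 (2 * (2 * 2)))
  refine mul_le_mul_of_nonneg_left (mul_le_mul_of_nonneg_right ?_ hM) (sq_nonneg _)
  have hh0 : 0 < h ^ 2 := by positivity
  have h20 : 20 * (s ^ 2 / h ^ 2) < 1 := by
    rw [← mul_div_assoc, div_lt_one hh0]; exact hs2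
  have hle : 2 * a * s ^ 2 ≤ 20 * (s ^ 2 / h ^ 2) := by
    rw [← mul_div_assoc 20, le_div_iff₀ hh0]
    have : a * h ^ 2 ≤ 10 := by nlinarith
    nlinarith [sq_nonneg s]
  refine Real.rpow_le_rpow_of_nonpos (by linarith) (by linarith) ?_
  have : (0 : ℝ) ≤ d := Nat.cast_nonneg d
  linarith

end

/-! ### Averages over disjoint parts of an i.i.d. sample -/

section
variable {Z : Type*} {n : ℕ}

/-- The average of `φ` over the observations with index in `D`. -/
def blockMean (φ : Z → ℝ) (D : Finset (Fin n)) (z : Fin n → Z) : ℝ :=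
  (1 / (D.card : ℝ)) * ∑ i ∈ D, φ (z i)

lemma dependsOn_blockMean (φ : Z → ℝ) (D : Finset (Fin n)) : DependsOn (blockMean φ D) D := by
  intro z z' h
  rw [blockMean, blockMean, Finset.sum_congr rfl fun i hi => by rw [h i hi]]

/-- The symmetrized product of the averages of `φ` and `χ` over two parts of the sample. -/
def symProd (φ χ : Z → ℝ) (D D' : Finset (Fin n)) (z : Fin n → Z) : ℝ :=
  (1 / 2) * (blockMean φ D z * blockMean χ D' z + blockMean φ D' z * blockMean χ D z)

lemma dependsOn_symProd [DecidableEq (Fin n)] (φ χ : Z → ℝ) (D D' : Finset (Fin n)) :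
    DependsOn (symProd φ χ D D') ↑(D ∪ D') := by
  intro z z' h
  have h1 : ∀ i ∈ D, z i = z' i := fun i hi => h i (by simp [hi])
  have h2 : ∀ i ∈ D', z i = z' i := fun i hi => h i (by simp [hi])
  rw [symProd, symProd, dependsOn_blockMean φ D h1, dependsOn_blockMean χ D h1,
    dependsOn_blockMean φ D' h2, dependsOn_blockMean χ D' h2]

end

section
variable {Z : Type*} [MeasurableSpace Z] {P : Measure Z} [IsProbabilityMeasure P] {n : ℕ}

/-- Functions of disjoint parts of an i.i.d. sample are independent. -/
lemma indepFun_of_disjoint {F G : (Fin n → Z) → ℝ} (hF : Measurable F) (hG : Measurable G)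
    {D D' : Finset (Fin n)} (hD : Disjoint D D') (hFD : DependsOn F D) (hGD : DependsOn G D') :
    IndepFun F G (Measure.pi fun _ : Fin n => P) := by
  classical
  obtain ⟨z₀⟩ : Nonempty Z := nonempty_of_isProbabilityMeasure P
  have hext : ∀ D : Finset (Fin n),
      Measurable fun (w : D → Z) (i : Fin n) => if hi : i ∈ D then w ⟨i, hi⟩ else z₀ := by
    intro D
    refine measurable_pi_lambda _ fun i => ?_
    by_cases hi : i ∈ D
    · simp only [hi, dite_true]; exact measurable_pi_apply _
    · simp only [hi, dite_false]; exact measurable_const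
  have h1 : iIndepFun (fun (i : Fin n) (z : Fin n → Z) => z i) (Measure.pi fun _ : Fin n => P) :=
    iIndepFun_pi (X := fun _ x => x) fun _ => aemeasurable_id
  have h2 := h1.indepFun_finset D D' hD fun i => measurable_pi_apply i
  have h3 := h2.comp (hF.comp (hext D)) (hG.comp (hext D'))
  have e : ∀ {F : (Fin n → Z) → ℝ} {D : Finset (Fin n)}, DependsOn F D →
      (F ∘ fun (w : D → Z) (i : Fin n) => if hi : i ∈ D then w ⟨i, hi⟩ else z₀) ∘
        (fun (z : Fin n → Z) (i : D) => z i) = F := by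
    intro F D hFD
    ext z
    refine hFD fun i hi => ?_
    have hi' : i ∈ D := hi
    simp [hi']
  rwa [e hFD, e hGD] at h3

variable {φ χ : Z → ℝ} {D D' : Finset (Fin n)}

lemma measurable_blockMean (hφ : Measurable φ) (D : Finset (Fin n)) :
    Measurable (blockMean φ D) := by
  unfold blockMean; fun_prop

lemma memLp_eval (hφ2 : MemLp φ 2 P) (i : Fin n) :
    MemLp (fun z : Fin n → Z => φ (z i)) 2 (Measure.pi fun _ : Fin n => P) :=
  hφ2.comp_measurePreserving (measurePreserving_eval (fun _ : Fin n => P) i)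

lemma memLp_blockMean (hφ2 : MemLp φ 2 P) (D : Finset (Fin n)) :
    MemLp (blockMean φ D) 2 (Measure.pi fun _ : Fin n => P) :=
  (memLp_finsetSum D fun i _ => memLp_eval hφ2 i).const_mul _

lemma integral_eval (hφ : Measurable φ) (i : Fin n) :
    ∫ z : Fin n → Z, φ (z i) ∂(Measure.pi fun _ : Fin n => P) = ∫ x, φ x ∂P := by
  have h := (measurePreserving_eval (fun _ : Fin n => P) i).map_eq
  conv_rhs => rw [← h]
  rw [integral_map (measurable_pi_apply i).aemeasurable hφ.aestronglyMeasurable]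

lemma integral_blockMean (hφ : Measurable φ) (hφ2 : MemLp φ 2 P) (hD : D.Nonempty) :
    ∫ z, blockMean φ D z ∂(Measure.pi fun _ : Fin n => P) = ∫ x, φ x ∂P := by
  have hc : (D.card : ℝ) ≠ 0 := by exact_mod_cast hD.card_ne_zero
  simp_rw [blockMean]
  rw [integral_const_mul, integral_finsetSum _ fun i _ => (memLp_eval hφ2 i).integrable one_le_two]
  simp_rw [integral_eval hφ]
  rw [Finset.sum_const, nsmul_eq_mul]
  field_simp

/-- The second moment bound `(E φ)² + E φ² / N` for an average of `N` independent copies of `φ`. -/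
def avgMoment (P : Measure Z) (N : ℕ) (φ : Z → ℝ) : ℝ :=
  (∫ x, φ x ∂P) ^ 2 + (1 / (N : ℝ)) * ∫ x, φ x ^ 2 ∂P

lemma avgMoment_nonneg (P : Measure Z) (N : ℕ) (φ : Z → ℝ) : 0 ≤ avgMoment P N φ := by
  have : 0 ≤ ∫ x, φ x ^ 2 ∂P := integral_nonneg fun x => sq_nonneg _
  unfold avgMoment
  positivity

lemma integral_blockMean_sq_le (hφ : Measurable φ) (hφ2 : MemLp φ 2 P) (hD : D.Nonempty) :
    ∫ z, blockMean φ D z ^ 2 ∂(Measure.pi fun _ : Fin n => P) ≤ avgMoment P D.card φ := by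
  have hc : (0 : ℝ) < D.card := by exact_mod_cast hD.card_pos
  have hvar := variance_eq_sub (memLp_blockMean (n := n) hφ2 D)
  have hv : Var[blockMean φ D; Measure.pi fun _ : Fin n => P] ≤
      (1 / (D.card : ℝ)) * ∫ x, φ x ^ 2 ∂P := by
    have e1 : Var[blockMean φ D; Measure.pi fun _ : Fin n => P] =
        (1 / (D.card : ℝ)) ^ 2 * Var[fun z : Fin n → Z => ∑ i ∈ D, φ (z i);
          Measure.pi fun _ : Fin n => P] := variance_const_mul _ _ _
    have e2 : (fun z : Fin n → Z => ∑ i ∈ D, φ (z i)) = ∑ i ∈ D, fun z : Fin n → Z => φ (z i) := by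
      ext z; simp
    have e3 : ∀ i ∈ D, Var[fun z : Fin n → Z => φ (z i); Measure.pi fun _ : Fin n => P] ≤
        ∫ x, φ x ^ 2 ∂P := by
      intro i _
      refine (variance_le_expectation_sq (μ := Measure.pi fun _ : Fin n => P)
        (X := fun z => φ (z i)) (memLp_eval hφ2 i).aestronglyMeasurable).trans (le_of_eq ?_)
      exact integral_eval (P := P) (φ := fun x => φ x ^ 2) (by fun_prop) i
    rw [e1, e2, IndepFun.variance_sum (fun i _ => memLp_eval hφ2 i)]
    · refine (mul_le_mul_of_nonneg_left (Finset.sum_le_sum e3) (by positivity)).trans ?_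
      rw [Finset.sum_const, nsmul_eq_mul]
      apply le_of_eq
      field_simp
    · intro i _ j _ hij
      exact (iIndepFun_pi (X := fun _ : Fin n => φ) fun _ => hφ.aemeasurable).indepFun hij
  rw [integral_blockMean hφ hφ2 hD] at hvar
  rw [avgMoment]
  have : ∫ z, blockMean φ D z ^ 2 ∂(Measure.pi fun _ : Fin n => P) =
    (Measure.pi fun _ : Fin n => P)[blockMean φ D ^ 2] := rfl
  linarith

lemma indepFun_blockMean (hφ : Measurable φ) (hχ : Measurable χ) (hDD : Disjoint D D') :
    IndepFun (blockMean φ D) (blockMean χ D') (Measure.pi fun _ : Fin n => P) :=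
  indepFun_of_disjoint (measurable_blockMean hφ D) (measurable_blockMean hχ D') hDD
    (dependsOn_blockMean φ D) (dependsOn_blockMean χ D')

lemma memLp_blockMean_mul (hφ : Measurable φ) (hχ : Measurable χ) (hφ2 : MemLp φ 2 P)
    (hχ2 : MemLp χ 2 P) (hDD : Disjoint D D') :
    MemLp (fun z => blockMean φ D z * blockMean χ D' z) 2 (Measure.pi fun _ : Fin n => P) := by
  have hm1 := measurable_blockMean hφ D
  have hm2 := measurable_blockMean hχ D'
  rw [memLp_two_iff_integrable_sq (Measurable.aestronglyMeasurable (by fun_prop))]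
  simp_rw [mul_pow]
  exact ((indepFun_blockMean hφ hχ hDD).comp (φ := fun x => x ^ 2) (ψ := fun x => x ^ 2)
    (by fun_prop) (by fun_prop)).integrable_mul (memLp_blockMean hφ2 D).integrable_sq
    (memLp_blockMean hχ2 D').integrable_sq

lemma integral_blockMean_mul (hφ : Measurable φ) (hχ : Measurable χ) (hφ2 : MemLp φ 2 P)
    (hχ2 : MemLp χ 2 P) (hD : D.Nonempty) (hD' : D'.Nonempty) (hDD : Disjoint D D') :
    ∫ z, blockMean φ D z * blockMean χ D' z ∂(Measure.pi fun _ : Fin n => P) =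
      (∫ x, φ x ∂P) * ∫ x, χ x ∂P := by
  rw [(indepFun_blockMean hφ hχ hDD).integral_fun_mul_eq_mul_integral
    (measurable_blockMean hφ D).aestronglyMeasurable
    (measurable_blockMean hχ D').aestronglyMeasurable, integral_blockMean hφ hφ2 hD,
    integral_blockMean hχ hχ2 hD']

lemma integral_blockMean_mul_sq_le (hφ : Measurable φ) (hχ : Measurable χ) (hφ2 : MemLp φ 2 P)
    (hχ2 : MemLp χ 2 P) (hD : D.Nonempty) (hD' : D'.Nonempty) (hDD : Disjoint D D') :
    ∫ z, (blockMean φ D z * blockMean χ D' z) ^ 2 ∂(Measure.pi fun _ : Fin n => P) ≤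
      avgMoment P D.card φ * avgMoment P D'.card χ := by
  simp_rw [mul_pow]
  have hm1 := measurable_blockMean hφ D
  have hm2 := measurable_blockMean hχ D'
  have hi := (indepFun_blockMean (P := P) hφ hχ hDD).comp (φ := fun x => x ^ 2) (ψ := fun x => x ^ 2)
    (by fun_prop) (by fun_prop)
  have := hi.integral_fun_mul_eq_mul_integral
    (hm1.pow_const 2).aestronglyMeasurable (hm2.pow_const 2).aestronglyMeasurable
  simp only [Function.comp_apply] at this
  rw [this]
  exact mul_le_mul (integral_blockMean_sq_le hφ hφ2 hD) (integral_blockMean_sq_le hχ hχ2 hD')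
    (integral_nonneg fun _ => sq_nonneg _) (avgMoment_nonneg _ _ _)

lemma measurable_symProd (hφ : Measurable φ) (hχ : Measurable χ) (D D' : Finset (Fin n)) :
    Measurable (symProd φ χ D D') := by
  have h1 := measurable_blockMean hφ D
  have h2 := measurable_blockMean hφ D'
  have h3 := measurable_blockMean hχ D
  have h4 := measurable_blockMean hχ D'
  unfold symProd
  fun_prop

lemma memLp_symProd (hφ : Measurable φ) (hχ : Measurable χ) (hφ2 : MemLp φ 2 P)
    (hχ2 : MemLp χ 2 P) (hDD : Disjoint D D') :
    MemLp (symProd φ χ D D') 2 (Measure.pi fun _ : Fin n => P) :=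
  ((memLp_blockMean_mul hφ hχ hφ2 hχ2 hDD).add
    (memLp_blockMean_mul hφ hχ hφ2 hχ2 hDD.symm)).const_mul _

lemma integral_symProd (hφ : Measurable φ) (hχ : Measurable χ) (hφ2 : MemLp φ 2 P)
    (hχ2 : MemLp χ 2 P) (hD : D.Nonempty) (hD' : D'.Nonempty) (hDD : Disjoint D D') :
    ∫ z, symProd φ χ D D' z ∂(Measure.pi fun _ : Fin n => P) =
      (∫ x, φ x ∂P) * ∫ x, χ x ∂P := by
  simp_rw [symProd]
  rw [integral_const_mul, integral_add
    ((memLp_blockMean_mul hφ hχ hφ2 hχ2 hDD).integrable one_le_two)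
    ((memLp_blockMean_mul hφ hχ hφ2 hχ2 hDD.symm).integrable one_le_two),
    integral_blockMean_mul hφ hχ hφ2 hχ2 hD hD' hDD,
    integral_blockMean_mul hφ hχ hφ2 hχ2 hD' hD hDD.symm]
  ring

lemma lintegral_symProd_sq_le (hφ : Measurable φ) (hχ : Measurable χ) (hφ2 : MemLp φ 2 P)
    (hχ2 : MemLp χ 2 P) {N : ℕ} (hN : 0 < N) (hD : D.card = N) (hD' : D'.card = N)
    (hDD : Disjoint D D') :
    ∫⁻ z, ENNReal.ofReal (symProd φ χ D D' z ^ 2) ∂(Measure.pi fun _ : Fin n => P) ≤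
      ENNReal.ofReal (avgMoment P N φ * avgMoment P N χ) := by
  have hDn : D.Nonempty := Finset.card_pos.1 (by omega)
  have hDn' : D'.Nonempty := Finset.card_pos.1 (by omega)
  rw [← ofReal_integral_eq_lintegral_ofReal (memLp_symProd hφ hχ hφ2 hχ2 hDD).integrable_sq
    (Filter.Eventually.of_forall fun _ => sq_nonneg _)]
  apply ENNReal.ofReal_le_ofReal
  have i1 := (memLp_blockMean_mul hφ hχ hφ2 hχ2 hDD).integrable_sq
  have i2 := (memLp_blockMean_mul hφ hχ hφ2 hχ2 hDD.symm).integrable_sq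
  have b1 := integral_blockMean_mul_sq_le hφ hχ hφ2 hχ2 hDn hDn' hDD
  have b2 := integral_blockMean_mul_sq_le hφ hχ hφ2 hχ2 hDn' hDn hDD.symm
  rw [hD, hD'] at b1 b2
  calc ∫ z, symProd φ χ D D' z ^ 2 ∂(Measure.pi fun _ : Fin n => P) ≤
      ∫ z, ((1 / 2) * (blockMean φ D z * blockMean χ D' z) ^ 2 +
        (1 / 2) * (blockMean φ D' z * blockMean χ D z) ^ 2) ∂(Measure.pi fun _ : Fin n => P) := by
        refine integral_mono (memLp_symProd hφ hχ hφ2 hχ2 hDD).integrable_sq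
          ((i1.const_mul _).add (i2.const_mul _)) fun z => ?_
        simp only [symProd]
        nlinarith [sq_nonneg (blockMean φ D z * blockMean χ D' z -
          blockMean φ D' z * blockMean χ D z)]
    _ ≤ _ := by
        rw [integral_add (i1.const_mul _) (i2.const_mul _), integral_const_mul, integral_const_mul]
        linarith

end

/-! ### The variance of the averaged products -/

section
variable {Θ Z : Type*} [MeasurableSpace Θ] [MeasurableSpace Z] {ν : Measure Θ}
  [IsProbabilityMeasure ν] {P : Measure Z} [IsProbabilityMeasure P] {n m N : ℕ}
  {part : Fin n → Fin m × Fin 2} {φ χ : Θ → Z → ℝ}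

/-- The indices of the observations in the part with label `a`. -/
def partSet {n m : ℕ} (part : Fin n → Fin m × Fin 2) (a : Fin m × Fin 2) : Finset (Fin n) :=
  Finset.univ.filter fun i => part i = a

lemma disjoint_partSet {a b : Fin m × Fin 2} (h : a ≠ b) :
    Disjoint (partSet part a) (partSet part b) := by
  rw [Finset.disjoint_left]
  intro i hi hi'
  simp only [partSet, Finset.mem_filter, Finset.mem_univ, true_and] at hi hi'
  exact h (hi.symm.trans hi')

/-- The `j`-th product of averages, at the location `θ_j`, from the two parts of the data
belonging to `j`. -/
def locProd (part : Fin n → Fin m × Fin 2) (φ χ : Θ → Z → ℝ) (j : Fin m)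
    (ω : (Fin m → Θ) × (Fin n → Z)) : ℝ :=
  symProd (φ (ω.1 j)) (χ (ω.1 j)) (partSet part (j, 0)) (partSet part (j, 1)) ω.2

lemma measurable_locProd (hφ : Measurable fun q : Θ × Z => φ q.1 q.2)
    (hχ : Measurable fun q : Θ × Z => χ q.1 q.2) (j : Fin m) :
    Measurable (locProd part φ χ j) := by
  have h : ∀ {φ : Θ → Z → ℝ}, (Measurable fun q : Θ × Z => φ q.1 q.2) → ∀ D : Finset (Fin n),
      Measurable fun ω : (Fin m → Θ) × (Fin n → Z) => blockMean (φ (ω.1 j)) D ω.2 := by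
    intro φ hφ D
    refine Measurable.const_mul (Finset.measurable_sum _ fun i _ => ?_) _
    exact Measurable.comp (g := fun q : Θ × Z => φ q.1 q.2)
      (f := fun ω : (Fin m → Θ) × (Fin n → Z) => (ω.1 j, ω.2 i)) hφ
      (((measurable_pi_apply j).comp measurable_fst).prodMk
        ((measurable_pi_apply i).comp measurable_snd))
  have h1 := h hφ (partSet part (j, 0))
  have h2 := h hφ (partSet part (j, 1))
  have h3 := h hχ (partSet part (j, 0))
  have h4 := h hχ (partSet part (j, 1))
  unfold locProd symProd
  fun_prop

lemma measurable_section (hφ : Measurable fun q : Θ × Z => φ q.1 q.2) (θ : Θ) :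
    Measurable (φ θ) :=
  Measurable.comp (g := fun q : Θ × Z => φ q.1 q.2) (f := fun z : Z => (θ, z)) hφ
    measurable_prodMk_left

lemma measurable_integral_section (hφ : Measurable fun q : Θ × Z => φ q.1 q.2) :
    Measurable fun θ => ∫ z, φ θ z ∂P :=
  (hφ.stronglyMeasurable.integral_prod_right (ν := P)).measurable

lemma measurable_avgMoment (hφ : Measurable fun q : Θ × Z => φ q.1 q.2) :
    Measurable fun θ => avgMoment P N (φ θ) := by
  have h1 := measurable_integral_section (P := P) hφ
  have h2 := measurable_integral_section (P := P) (φ := fun θ z => φ θ z ^ 2) (hφ.pow_const 2)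
  unfold avgMoment
  fun_prop

lemma lintegral_eval_pi {m : ℕ} (j : Fin m) {F : Θ → ℝ≥0∞} (hF : Measurable F) :
    ∫⁻ θ : Fin m → Θ, F (θ j) ∂(Measure.pi fun _ : Fin m => ν) = ∫⁻ θ, F θ ∂ν :=
  (measurePreserving_eval (fun _ : Fin m => ν) j).lintegral_comp hF

variable (hφ : Measurable fun q : Θ × Z => φ q.1 q.2) (hχ : Measurable fun q : Θ × Z => χ q.1 q.2)
  (hφ2 : ∀ θ, MemLp (φ θ) 2 P) (hχ2 : ∀ θ, MemLp (χ θ) 2 P) (hN : 0 < N)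
  (hpart : ∀ a, (partSet part a).card = N)

include hφ hχ hφ2 hχ2 hN hpart

lemma lintegral_locProd_sq_le (j : Fin m) :
    ∫⁻ ω, ENNReal.ofReal (locProd part φ χ j ω ^ 2)
        ∂((Measure.pi fun _ : Fin m => ν).prod (Measure.pi fun _ : Fin n => P)) ≤
      ∫⁻ θ, ENNReal.ofReal (avgMoment P N (φ θ) * avgMoment P N (χ θ)) ∂ν := by
  have hm := measurable_locProd (part := part) hφ hχ j
  have h1 := measurable_avgMoment (P := P) (N := N) hφ
  have h2 := measurable_avgMoment (P := P) (N := N) hχ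
  rw [lintegral_prod _ (by fun_prop), ← lintegral_eval_pi (ν := ν) (m := m)
    (F := fun θ => ENNReal.ofReal (avgMoment P N (φ θ) * avgMoment P N (χ θ))) j (by fun_prop)]
  refine lintegral_mono fun θ => ?_
  exact lintegral_symProd_sq_le (measurable_section hφ _) (measurable_section hχ _) (hφ2 _) (hχ2 _)
    hN (hpart _) (hpart _) (disjoint_partSet (by simp))

variable (hfin : ∫⁻ θ, ENNReal.ofReal (avgMoment P N (φ θ) * avgMoment P N (χ θ)) ∂ν < ∞)
include hfin

lemma memLp_locProd (j : Fin m) :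
    MemLp (locProd part φ χ j) 2
      ((Measure.pi fun _ : Fin m => ν).prod (Measure.pi fun _ : Fin n => P)) := by
  have hm := measurable_locProd (part := part) hφ hχ j
  rw [memLp_two_iff_integrable_sq hm.aestronglyMeasurable]
  refine ⟨(hm.pow_const 2).aestronglyMeasurable, ?_⟩
  rw [hasFiniteIntegral_iff_ofReal (Filter.Eventually.of_forall fun z => sq_nonneg _)]
  exact (lintegral_locProd_sq_le hφ hχ hφ2 hχ2 hN hpart j).trans_lt hfin

lemma integral_locProd (j : Fin m) :
    ∫ ω, locProd part φ χ j ω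
        ∂((Measure.pi fun _ : Fin m => ν).prod (Measure.pi fun _ : Fin n => P)) =
      ∫ θ, (∫ z, φ θ z ∂P) * (∫ z, χ θ z ∂P) ∂ν := by
  have hne : ∀ a, (partSet part a).Nonempty := fun a => Finset.card_pos.1 (by rw [hpart]; exact hN)
  rw [integral_prod _ ((memLp_locProd hφ hχ hφ2 hχ2 hN hpart hfin j).integrable one_le_two)]
  have h1 := measurable_integral_section (P := P) hφ
  have h2 := measurable_integral_section (P := P) hχ
  rw [← integral_eval (P := ν) (φ := fun θ => (∫ z, φ θ z ∂P) * (∫ z, χ θ z ∂P))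
    (h1.mul h2) j]
  congr 1
  ext θ
  exact integral_symProd (measurable_section hφ _) (measurable_section hχ _) (hφ2 _) (hχ2 _)
    (hne _) (hne _) (disjoint_partSet (by simp))

/-- Products at different locations use disjoint parts of the data, so that their conditional
covariance given the locations vanishes; their conditional means are independent. -/
lemma covariance_locProd {i j : Fin m} (hij : i ≠ j) :
    cov[locProd part φ χ i, locProd part φ χ j;
      (Measure.pi fun _ : Fin m => ν).prod (Measure.pi fun _ : Fin n => P)] = 0 := by
  classical
  have hne : ∀ a, (partSet part a).Nonempty := fun a => Finset.card_pos.1 (by rw [hpart]; exact hN)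
  have hLi := memLp_locProd (ν := ν) hφ hχ hφ2 hχ2 hN hpart hfin i
  have hLj := memLp_locProd (ν := ν) hφ hχ hφ2 hχ2 hN hpart hfin j
  rw [covariance_eq_sub hLi hLj, integral_locProd hφ hχ hφ2 hχ2 hN hpart hfin,
    integral_locProd hφ hχ hφ2 hχ2 hN hpart hfin, sub_eq_zero,
    integral_prod _ (hLi.integrable_mul hLj)]
  have h1 := measurable_integral_section (P := P) hφ
  have h2 := measurable_integral_section (P := P) hχ
  have hG : Measurable fun θ => (∫ z, φ θ z ∂P) * (∫ z, χ θ z ∂P) := h1.mul h2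
  have hinner : ∀ θ : Fin m → Θ, ∫ z, (locProd part φ χ i * locProd part φ χ j) (θ, z)
      ∂(Measure.pi fun _ : Fin n => P) =
      ((∫ z, φ (θ i) z ∂P) * (∫ z, χ (θ i) z ∂P)) *
        ((∫ z, φ (θ j) z ∂P) * (∫ z, χ (θ j) z ∂P)) := by
    intro θ
    have hdisj : Disjoint (partSet part (i, 0) ∪ partSet part (i, 1))
        (partSet part (j, 0) ∪ partSet part (j, 1)) := by
      simp only [Finset.disjoint_union_left, Finset.disjoint_union_right]
      refine ⟨⟨?_, ?_⟩, ?_, ?_⟩ <;> exact disjoint_partSet (by simp [hij])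
    have hms : ∀ a, Measurable (symProd (φ (θ a)) (χ (θ a)) (partSet part (a, 0))
        (partSet part (a, 1))) := fun a =>
      measurable_symProd (measurable_section hφ _) (measurable_section hχ _) _ _
    have hind := indepFun_of_disjoint (P := P) (hms i) (hms j) hdisj
      (dependsOn_symProd _ _ _ _) (dependsOn_symProd _ _ _ _)
    have := hind.integral_fun_mul_eq_mul_integral (hms i).aestronglyMeasurable
      (hms j).aestronglyMeasurable
    have hs : ∀ a, ∫ z, symProd (φ (θ a)) (χ (θ a)) (partSet part (a, 0)) (partSet part (a, 1)) z
        ∂(Measure.pi fun _ : Fin n => P) = (∫ z, φ (θ a) z ∂P) * (∫ z, χ (θ a) z ∂P) := fun a =>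
      integral_symProd (measurable_section hφ _) (measurable_section hχ _) (hφ2 _) (hχ2 _)
        (hne _) (hne _) (disjoint_partSet (by simp))
    rw [← hs, ← hs, ← this]
    rfl
  simp_rw [hinner]
  have hind2 := (iIndepFun_pi (μ := fun _ : Fin m => ν)
    (X := fun _ θ => (∫ z, φ θ z ∂P) * (∫ z, χ θ z ∂P)) fun _ => hG.aemeasurable).indepFun hij
  have := hind2.integral_fun_mul_eq_mul_integral
    (hG.comp (measurable_pi_apply i)).aestronglyMeasurable
    (hG.comp (measurable_pi_apply j)).aestronglyMeasurable
  rw [this, integral_eval (P := ν) hG i, integral_eval (P := ν) hG j]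

/-- The mean square error of the average of the `m` uncorrelated products is of order `1 / m`. -/
theorem lintegral_average_locProd_sub_sq_le (hm : 0 < m) :
    ∫⁻ ω, ENNReal.ofReal (((1 / (m : ℝ)) * ∑ j, locProd part φ χ j ω -
          ∫ θ, (∫ z, φ θ z ∂P) * (∫ z, χ θ z ∂P) ∂ν) ^ 2)
        ∂((Measure.pi fun _ : Fin m => ν).prod (Measure.pi fun _ : Fin n => P)) ≤
      ENNReal.ofReal (1 / (m : ℝ)) *
        ∫⁻ θ, ENNReal.ofReal (avgMoment P N (φ θ) * avgMoment P N (χ θ)) ∂ν := by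
  have hm' : (0 : ℝ) < m := by exact_mod_cast hm
  set μ := (Measure.pi fun _ : Fin m => ν).prod (Measure.pi fun _ : Fin n => P) with hμ
  set W := ∫⁻ θ, ENNReal.ofReal (avgMoment P N (φ θ) * avgMoment P N (χ θ)) ∂ν with hW
  have hL := memLp_locProd (ν := ν) hφ hχ hφ2 hχ2 hN hpart hfin
  set X : (Fin m → Θ) × (Fin n → Z) → ℝ := fun ω => (1 / (m : ℝ)) * ∑ j, locProd part φ χ j ω
    with hX
  have hXL : MemLp X 2 μ := (memLp_finsetSum _ fun j _ => hL j).const_mul _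
  have hmean : ∫ ω, X ω ∂μ = ∫ θ, (∫ z, φ θ z ∂P) * (∫ z, χ θ z ∂P) ∂ν := by
    rw [hX, integral_const_mul, integral_finsetSum _ fun j _ => (hL j).integrable one_le_two]
    rw [Finset.sum_congr rfl fun j _ => integral_locProd hφ hχ hφ2 hχ2 hN hpart hfin j,
      Finset.sum_const, Finset.card_univ, Fintype.card_fin, nsmul_eq_mul]
    field_simp
  have hvar : Var[X; μ] ≤ (1 / (m : ℝ)) * W.toReal := by
    have e1 : Var[X; μ] = (1 / (m : ℝ)) ^ 2 * Var[fun ω => ∑ j, locProd part φ χ j ω; μ] :=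
      variance_const_mul _ _ _
    have e2 : ∀ j : Fin m, ∑ i, cov[locProd part φ χ j, locProd part φ χ i; μ] ≤ W.toReal := by
      intro j
      rw [Finset.sum_eq_single_of_mem j (Finset.mem_univ j) fun i _ hi =>
        covariance_locProd hφ hχ hφ2 hχ2 hN hpart hfin hi.symm,
        covariance_self (hL j).aemeasurable]
      refine (variance_le_expectation_sq (hL j).aestronglyMeasurable).trans ?_
      have := integral_eq_lintegral_of_nonneg_ae (μ := μ) (f := fun ω => locProd part φ χ j ω ^ 2)
        (Filter.Eventually.of_forall fun ω => sq_nonneg _) (hL j).integrable_sq.1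
      have e4 : μ[locProd part φ χ j ^ 2] = ∫ ω, locProd part φ χ j ω ^ 2 ∂μ := rfl
      rw [e4, this]
      exact ENNReal.toReal_mono hfin.ne (lintegral_locProd_sq_le hφ hχ hφ2 hχ2 hN hpart j)
    rw [e1, variance_fun_sum hL]
    refine (mul_le_mul_of_nonneg_left (Finset.sum_le_sum fun j _ => e2 j) (by positivity)).trans ?_
    rw [Finset.sum_const, Finset.card_univ, Fintype.card_fin, nsmul_eq_mul]
    apply le_of_eq
    field_simp
  have hev := ofReal_variance hXL
  rw [evariance_eq_lintegral_ofReal, hmean] at hev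
  rw [← hev]
  refine (ENNReal.ofReal_le_ofReal hvar).trans ?_
  rw [ENNReal.ofReal_mul (by positivity), ENNReal.ofReal_toReal hfin.ne]

end

/-! ### The mean square error of the estimated matrix -/

lemma card_partSet {n m d : ℕ} {part : Fin n → Fin m × Fin 2} (hm : 0 < m) (hn : n = 2 * d * m)
    (hpart : IsEqualSplit part) (a : Fin m × Fin 2) : (partSet part a).card = d := by
  have h1 : ∑ b : Fin m × Fin 2, (partSet part b).card = n := by
    have := Finset.card_eq_sum_card_fiberwise (f := part) (s := Finset.univ)
      (t := Finset.univ) (fun _ _ => Finset.mem_coe.2 (Finset.mem_univ _))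
    rw [Finset.card_univ, Fintype.card_fin] at this
    exact this.symm
  have h3 : ∀ b ∈ Finset.univ, (partSet part b).card = (partSet part a).card :=
    fun b _ => hpart b a
  rw [Finset.sum_congr rfl h3, Finset.sum_const, Finset.card_univ,
    Fintype.card_prod, Fintype.card_fin, Fintype.card_fin, smul_eq_mul] at h1
  have h2 : (m * 2) * (partSet part a).card = (m * 2) * d := by
    rw [h1, hn]; ring
  exact Nat.eq_of_mul_eq_mul_left (by omega) h2

/-- The population matrix `E[b(θ) b(θ)ᵀ]`, where `b` is the smoothed gradient. -/
def popMatrix {d : ℕ} (P : Measure (Vec d × ℝ)) (h σθ : ℝ) : Matrix (Fin d) (Fin d) ℝ :=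
  Matrix.of fun a b => ∫ θ, gradMean P h θ a * gradMean P h θ b ∂(gaussianLaw d σθ)

lemma memLp_gradObs_apply {d : ℕ} {P : Measure (Vec d × ℝ)} {h : ℝ}
    (hint : ∀ θ, MemLp (gradObs h θ) 2 P) (θ : Vec d) (a : Fin d) :
    MemLp (fun z => gradObs h θ z a) 2 P :=
  (EuclideanSpace.proj a : Vec d →L[ℝ] ℝ).comp_memLp' (hint θ)

section
variable {d k r n m : ℕ} {K σY : ℝ} {P : Measure (Vec d × ℝ)} [IsProbabilityMeasure P]
  {U : Matrix (Fin d) (Fin k) ℝ} {f : Vec k → ℝ} {C h : ℝ} {part : Fin n → Fin m × Fin 2}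

lemma splitGradEstimate_apply (h : ℝ) (part : Fin n → Fin m × Fin 2) (θ : Fin m → Vec d)
    (data : Fin n → Vec d × ℝ) (j : Fin m) (l : Fin 2) (a : Fin d) :
    splitGradEstimate (gaussianDensity d 1) h part θ data j l a =
      blockMean (fun z => gradObs h (θ j) z a) (partSet part (j, l)) data := by
  simp only [splitGradEstimate, gradEstimate, blockMean, gradObs, partSet, PiLp.smul_apply,
    WithLp.ofLp_sum, Finset.sum_apply, smul_eq_mul, ← Finset.mul_sum]
  ring

lemma estMatrix_apply (h : ℝ) (part : Fin n → Fin m × Fin 2)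
    (ω : (Fin m → Vec d) × (Fin n → Vec d × ℝ)) (a b : Fin d) :
    estMatrix (gaussianDensity d 1) h part ω.1 ω.2 a b =
      (1 / (m : ℝ)) * ∑ j, locProd part (fun θ z => gradObs h θ z a)
        (fun θ z => gradObs h θ z b) j ω := by
  rw [estMatrix, Matrix.smul_apply, Matrix.sum_apply, smul_eq_mul]
  simp only [Matrix.add_apply, Matrix.vecMulVec_apply, splitGradEstimate_apply, locProd, symProd,
    ← Finset.mul_sum]
  rw [← mul_assoc]
  congr 1
  ring

lemma measurable_gradObs_apply (h : ℝ) (a : Fin d) :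
    Measurable fun q : Vec d × (Vec d × ℝ) => gradObs h q.1 q.2 a := by
  have hc : Measurable fun v : Vec d => v a := by fun_prop
  exact Measurable.comp (g := fun v : Vec d => v a)
    (f := fun q : Vec d × (Vec d × ℝ) => gradObs h q.1 q.2) hc (measurable_gradObs h)

lemma measurable_estMatrix (h : ℝ) (part : Fin n → Fin m × Fin 2) (a b : Fin d) :
    Measurable fun ω : (Fin m → Vec d) × (Fin n → Vec d × ℝ) =>
      estMatrix (gaussianDensity d 1) h part ω.1 ω.2 a b := by
  simp_rw [estMatrix_apply]
  refine Measurable.const_mul (Finset.measurable_sum _ fun j _ => ?_) _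
  exact measurable_locProd (measurable_gradObs_apply h a) (measurable_gradObs_apply h b) j

lemma gradMean_apply (hint : ∀ θ, MemLp (gradObs h θ) 2 P) (θ : Vec d) (a : Fin d) :
    ∫ z, gradObs h θ z a ∂P = gradMean P h θ a :=
  (EuclideanSpace.proj a : Vec d →L[ℝ] ℝ).integral_comp_comm ((hint θ).integrable one_le_two)

lemma sum_avgMoment (hint : ∀ θ, MemLp (gradObs h θ) 2 P) (N : ℕ) (θ : Vec d) :
    ∑ a, avgMoment P N (fun z => gradObs h θ z a) =
      ‖gradMean P h θ‖ ^ 2 + (1 / (N : ℝ)) * ∫ z, ‖gradObs h θ z‖ ^ 2 ∂P := by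
  simp_rw [avgMoment, Finset.sum_add_distrib, gradMean_apply hint, EuclideanSpace.real_norm_sq_eq]
  rw [integral_finsetSum _ fun a _ => (memLp_gradObs_apply hint θ a).integrable_sq, Finset.mul_sum]

/-- The mean square error of the estimated matrix in the Frobenius norm is at most `1 / m` times the
mean of the squared conditional second moments. -/
theorem lintegral_estMatrix_sub_sq_le (hd : 0 < d) (hm : 0 < m) (hn : n = 2 * d * m)
    (hpart : IsEqualSplit part) (hint : ∀ θ, MemLp (gradObs h θ) 2 P) {σθ : ℝ} {H : Vec d → ℝ}
    (hH : ∀ θ, ‖gradMean P h θ‖ ^ 2 + (1 / (d : ℝ)) * ∫ z, ‖gradObs h θ z‖ ^ 2 ∂P ≤ H θ)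
    (hfin : ∫⁻ θ, ENNReal.ofReal (H θ ^ 2) ∂(gaussianLaw d σθ) < ∞) :
    ∫⁻ ω, ENNReal.ofReal (∑ a, ∑ b, (estMatrix (gaussianDensity d 1) h part ω.1 ω.2 a b -
        popMatrix P h σθ a b) ^ 2) ∂(samplingLaw n m σθ P) ≤
      ENNReal.ofReal (1 / (m : ℝ)) * ∫⁻ θ, ENNReal.ofReal (H θ ^ 2) ∂(gaussianLaw d σθ) := by
  have hga := measurable_gradObs_apply (d := d) h
  have hsum : ∀ θ, ∑ a, avgMoment P d (fun z => gradObs h θ z a) ≤ H θ := fun θ => by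
    rw [sum_avgMoment hint]; exact hH θ
  have hnn : ∀ θ a, 0 ≤ avgMoment P d (fun z => gradObs h θ z a) := fun θ a =>
    avgMoment_nonneg _ _ _
  have hle : ∀ θ a, avgMoment P d (fun z => gradObs h θ z a) ≤ H θ := fun θ a =>
    (Finset.single_le_sum (fun a _ => hnn θ a) (Finset.mem_univ a)).trans (hsum θ)
  have hpair : ∀ a b, ∫⁻ θ, ENNReal.ofReal (avgMoment P d (fun z => gradObs h θ z a) *
      avgMoment P d (fun z => gradObs h θ z b)) ∂(gaussianLaw d σθ) < ∞ := by
    intro a b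
    refine lt_of_le_of_lt (lintegral_mono fun θ => ENNReal.ofReal_le_ofReal ?_) hfin
    rw [sq]
    exact mul_le_mul (hle θ a) (hle θ b) (hnn θ b) ((hnn θ a).trans (hle θ a))
  have hentry : ∀ a b, ∫⁻ ω, ENNReal.ofReal ((estMatrix (gaussianDensity d 1) h part ω.1 ω.2 a b -
        popMatrix P h σθ a b) ^ 2) ∂(samplingLaw n m σθ P) ≤
      ENNReal.ofReal (1 / (m : ℝ)) * ∫⁻ θ, ENNReal.ofReal
        (avgMoment P d (fun z => gradObs h θ z a) * avgMoment P d (fun z => gradObs h θ z b))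
        ∂(gaussianLaw d σθ) := by
    intro a b
    have := lintegral_average_locProd_sub_sq_le (ν := gaussianLaw d σθ) (hga a) (hga b)
      (fun θ => memLp_gradObs_apply hint θ a) (fun θ => memLp_gradObs_apply hint θ b) hd
      (card_partSet hm hn hpart) (hpair a b) hm
    simp_rw [gradMean_apply hint] at this
    simp_rw [estMatrix_apply]
    exact this
  have hmeas : ∀ a b, Measurable fun ω : (Fin m → Vec d) × (Fin n → Vec d × ℝ) =>
      ENNReal.ofReal ((estMatrix (gaussianDensity d 1) h part ω.1 ω.2 a b -
        popMatrix P h σθ a b) ^ 2) := fun a b =>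
    (((measurable_estMatrix h part a b).sub_const _).pow_const 2).ennreal_ofReal
  have hmq : ∀ a, Measurable fun θ => avgMoment P d (fun z => gradObs h θ z a) := fun a =>
    measurable_avgMoment (hga a)
  simp_rw [ENNReal.ofReal_sum_of_nonneg fun a _ =>
      Finset.sum_nonneg fun b _ => sq_nonneg (_ : ℝ),
    ENNReal.ofReal_sum_of_nonneg fun b _ => sq_nonneg (_ : ℝ)]
  rw [lintegral_finsetSum _ fun a _ => Finset.measurable_sum _ fun b _ => hmeas a b]
  simp_rw [lintegral_finsetSum _ fun b _ => hmeas _ b]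
  refine (Finset.sum_le_sum fun a _ => Finset.sum_le_sum fun b _ => hentry a b).trans ?_
  simp_rw [← Finset.mul_sum]
  gcongr
  have hmm : ∀ a b, Measurable fun θ => ENNReal.ofReal (avgMoment P d (fun z => gradObs h θ z a) *
      avgMoment P d (fun z => gradObs h θ z b)) := fun a b =>
    ((hmq a).mul (hmq b)).ennreal_ofReal
  simp_rw [← lintegral_finsetSum _ fun b _ => hmm _ b]
  rw [← lintegral_finsetSum _ fun a _ => Finset.measurable_sum _ fun b _ => hmm a b]
  refine lintegral_mono fun θ => ?_
  simp_rw [← ENNReal.ofReal_sum_of_nonneg fun b _ => mul_nonneg (hnn θ _) (hnn θ b)]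
  rw [← ENNReal.ofReal_sum_of_nonneg fun a _ =>
    Finset.sum_nonneg fun b _ => mul_nonneg (hnn θ a) (hnn θ b)]
  apply ENNReal.ofReal_le_ofReal
  rw [← Finset.sum_mul_sum, ← sq]
  exact pow_le_pow_left₀ (Finset.sum_nonneg fun a _ => hnn θ a) (hsum θ) 2

/-- The constant in the bound for the mean square error of the estimated matrix. -/
def mseConst (k r : ℕ) (C K σY : ℝ) : ℝ :=
  estConst k r C K σY ^ 2 * (gaussMoment k (2 * r * 2 * 2) + gaussMoment 1 (2 * (2 * 2)))

theorem lintegral_estMatrix_sub_sq_le_explicit (hf : Measurable f) (hd : 0 < d) (hK : 0 < K)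
    (hσ : 0 < σY) (hmod : PolynomialModel r K σY P U f) (hC0 : 0 ≤ C)
    (hC : ∀ z, |f z| ≤ C * (1 + ‖z‖) ^ r) (hm : 0 < m) (hn : n = 2 * d * m)
    (hpart : IsEqualSplit part) (hh : 0 < h) (hh2 : h ^ 2 ≤ 5 / 4) {σθ : ℝ} (hs : 0 < σθ)
    (hs2 : 20 * σθ ^ 2 < h ^ 2) :
    ∫⁻ ω, ENNReal.ofReal (∑ a, ∑ b, (estMatrix (gaussianDensity d 1) h part ω.1 ω.2 a b -
        popMatrix P h σθ a b) ^ 2) ∂(samplingLaw n m σθ P) ≤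
      ENNReal.ofReal ((1 / (m : ℝ)) * (mseConst k r C K σY * (h ^ (-2 : ℤ)) ^ 2 *
        ((h ^ 2 * (2 - h ^ 2)) ^ (-(d : ℝ) / 2)) ^ 2 *
        (1 - 20 * (σθ ^ 2 / h ^ 2)) ^ (-(d : ℝ) / 2))) := by
  have hsq : ∀ θ, ENNReal.ofReal ((estConst k r C K σY * h ^ (-2 : ℤ) * envelope U r h θ) ^ 2) =
      ENNReal.ofReal ((estConst k r C K σY * h ^ (-2 : ℤ)) ^ 2) *
        ENNReal.ofReal (envelope U r h θ ^ 2) := fun θ => by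
    rw [mul_pow, ENNReal.ofReal_mul (sq_nonneg _)]
  have henv : ∫⁻ θ, ENNReal.ofReal ((estConst k r C K σY * h ^ (-2 : ℤ) * envelope U r h θ) ^ 2)
      ∂(gaussianLaw d σθ) ≤ ENNReal.ofReal ((estConst k r C K σY * h ^ (-2 : ℤ)) ^ 2 *
        (((h ^ 2 * (2 - h ^ 2)) ^ (-(d : ℝ) / 2)) ^ 2 *
        (1 - 20 * (σθ ^ 2 / h ^ 2)) ^ (-(d : ℝ) / 2) *
        (gaussMoment k (2 * r * 2 * 2) + gaussMoment 1 (2 * (2 * 2))))) := by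
    simp_rw [hsq]
    rw [lintegral_const_mul' _ _ ENNReal.ofReal_ne_top, ENNReal.ofReal_mul (sq_nonneg _)]
    gcongr
    exact lintegral_envelope_sq_le hmod.orthonormal hd r hh hh2 hs hs2
  refine (lintegral_estMatrix_sub_sq_le hd hm hn hpart
    (memLp_gradObs hd hK hσ hmod hC hh hh2)
    (gradMean_sq_add_le hf hd hK hσ hmod hC0 hC hh hh2)
    (henv.trans_lt ENNReal.ofReal_lt_top)).trans ?_
  refine (mul_le_mul_right henv _).trans (le_of_eq ?_)
  rw [← ENNReal.ofReal_mul (by positivity), mseConst]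
  congr 1
  ring

end

/-! ### Perturbation of the leading eigenspace -/

/-- The square of the Frobenius norm. -/
def frobSq {p q : ℕ} (M : Matrix (Fin p) (Fin q) ℝ) : ℝ := ∑ a, ∑ b, M a b ^ 2

section
variable {d k p q : ℕ}

lemma frobSq_nonneg (M : Matrix (Fin p) (Fin q) ℝ) : 0 ≤ frobSq M :=
  Finset.sum_nonneg fun _ _ => Finset.sum_nonneg fun _ _ => sq_nonneg _

lemma trace_transpose_mul_self (M : Matrix (Fin p) (Fin q) ℝ) :
    (M.transpose * M).trace = frobSq M := by
  simp only [Matrix.trace, Matrix.diag, Matrix.mul_apply, Matrix.transpose_apply, frobSq]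
  rw [Finset.sum_comm]
  simp only [sq]

lemma opNorm_le_sqrt_frobSq (M : Matrix (Fin p) (Fin q) ℝ) : opNorm M ≤ √(frobSq M) := by
  refine ContinuousLinearMap.opNorm_le_bound _ (Real.sqrt_nonneg _) fun x => ?_
  refine (pow_le_pow_iff_left₀ (norm_nonneg _) (by positivity) two_ne_zero).1 ?_
  rw [mul_pow, Real.sq_sqrt (frobSq_nonneg M), EuclideanSpace.real_norm_sq_eq,
    EuclideanSpace.real_norm_sq_eq, frobSq, Finset.sum_mul]
  refine Finset.sum_le_sum fun a _ => ?_
  exact Finset.sum_mul_sq_le_sq_mul_sq Finset.univ (M a) x.ofLp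

lemma rotDist_le_opNorm (V U : Matrix (Fin d) (Fin k) ℝ) (R : Matrix.orthogonalGroup (Fin k) ℝ) :
    rotDist V U ≤ opNorm (V * (R : Matrix (Fin k) (Fin k) ℝ) - U) :=
  ciInf_le ⟨0, by rintro _ ⟨R, rfl⟩; exact norm_nonneg _⟩ R

lemma rotDist_nonneg (V U : Matrix (Fin d) (Fin k) ℝ) : 0 ≤ rotDist V U :=
  Real.iInf_nonneg fun _ => norm_nonneg _

lemma rotDist_sq_le_frobSq (V U : Matrix (Fin d) (Fin k) ℝ) {R : Matrix (Fin k) (Fin k) ℝ}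
    (hR : R.transpose * R = 1) : rotDist V U ^ 2 ≤ frobSq (V * R - U) := by
  have hR' : R ∈ Matrix.orthogonalGroup (Fin k) ℝ := by
    rw [Matrix.mem_orthogonalGroup_iff']
    exact hR
  have := (rotDist_le_opNorm V U ⟨R, hR'⟩).trans (opNorm_le_sqrt_frobSq _)
  calc rotDist V U ^ 2 ≤ √(frobSq (V * R - U)) ^ 2 :=
        pow_le_pow_left₀ (rotDist_nonneg V U) this 2
    _ = _ := Real.sq_sqrt (frobSq_nonneg _)

lemma IsTopEigenvectors.orthonormal {M : Matrix (Fin d) (Fin d) ℝ} {V : Matrix (Fin d) (Fin k) ℝ}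
    (h : IsTopEigenvectors M V) : V.transpose * V = 1 := by
  obtain ⟨hk, Q, ev, hQ, -, -, rfl⟩ := h
  have hQ' : Q.transpose * Q = 1 := (Matrix.mem_orthogonalGroup_iff' _ _).1 hQ
  ext i j
  have := congrFun (congrFun hQ' (Fin.castLE hk i)) (Fin.castLE hk j)
  simp only [Matrix.mul_apply, Matrix.transpose_apply, Matrix.submatrix_apply, id,
    Matrix.one_apply, Fin.ext_iff, Fin.val_castLE] at this ⊢
  exact this

/-- The rows of a matrix with orthonormal columns have norm at most one. -/
lemma sum_sq_row_le_one {W : Matrix (Fin d) (Fin k) ℝ} (hW : W.transpose * W = 1) (i : Fin d) :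
    ∑ j, W i j ^ 2 ≤ 1 := by
  have hii : (W * W.transpose) i i = ∑ j, W i j ^ 2 := by
    simp only [Matrix.mul_apply, Matrix.transpose_apply, sq]
  have hP : (W * W.transpose) * (W * W.transpose) = W * W.transpose := by
    rw [Matrix.mul_assoc, ← Matrix.mul_assoc W.transpose, hW, Matrix.one_mul]
  have hsymm : ∀ a b, (W * W.transpose) a b = (W * W.transpose) b a := fun a b => by
    simp only [Matrix.mul_apply, Matrix.transpose_apply, mul_comm]
  have h1 : (W * W.transpose) i i = ∑ j, (W * W.transpose) i j ^ 2 := by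
    conv_lhs => rw [← hP]
    rw [Matrix.mul_apply]
    exact Finset.sum_congr rfl fun j _ => by rw [hsymm j i, sq]
  have h2 : (W * W.transpose) i i ^ 2 ≤ (W * W.transpose) i i := by
    conv_rhs => rw [h1]
    exact Finset.single_le_sum (f := fun j => (W * W.transpose) i j ^ 2)
      (fun j _ => sq_nonneg _) (Finset.mem_univ i)
  rw [← hii]
  nlinarith

/-- Ky Fan's maximum principle: the leading eigenvectors maximize the trace of the compression
among all orthonormal systems of the same size. -/
lemma trace_compression_le {M : Matrix (Fin d) (Fin d) ℝ} {V U : Matrix (Fin d) (Fin k) ℝ}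
    (h : IsTopEigenvectors M V) (hU : U.transpose * U = 1) :
    (U.transpose * M * U).trace ≤ (V.transpose * M * V).trace := by
  obtain ⟨hk, Q, ev, hQ, hev, rfl, rfl⟩ := h
  have hQ' : Q.transpose * Q = 1 := (Matrix.mem_orthogonalGroup_iff' _ _).1 hQ
  have hQQ : Q * Q.transpose = 1 := (Matrix.mem_orthogonalGroup_iff _ _).1 hQ
  have key : ∀ W : Matrix (Fin d) (Fin k) ℝ,
      (W.transpose * (Q * Matrix.diagonal ev * Q.transpose) * W).trace =
        ∑ i, ev i * ∑ j, (Q.transpose * W) i j ^ 2 := by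
    intro W
    have : W.transpose * (Q * Matrix.diagonal ev * Q.transpose) * W =
        (Q.transpose * W).transpose * (Matrix.diagonal ev * (Q.transpose * W)) := by
      simp only [Matrix.transpose_mul, Matrix.transpose_transpose, Matrix.mul_assoc]
    rw [this]
    generalize Q.transpose * W = X
    simp only [Matrix.trace, Matrix.diag, Matrix.mul_apply (M := X.transpose),
      Matrix.diagonal_mul, Matrix.transpose_apply]
    rw [Finset.sum_comm]
    refine Finset.sum_congr rfl fun i _ => ?_
    rw [Finset.mul_sum]
    exact Finset.sum_congr rfl fun j _ => by ring
  rw [key, key]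
  set W := Q.transpose * U with hW
  have hWW : W.transpose * W = 1 := by
    rw [hW, Matrix.transpose_mul, Matrix.transpose_transpose, Matrix.mul_assoc,
      ← Matrix.mul_assoc Q, hQQ, Matrix.one_mul, hU]
  have hV : ∀ i j, (Q.transpose * Q.submatrix id (Fin.castLE hk)) i j =
      if i = Fin.castLE hk j then 1 else 0 := by
    intro i j
    have := congrFun (congrFun hQ' i) (Fin.castLE hk j)
    rw [Matrix.one_apply] at this
    rw [← this]
    simp only [Matrix.mul_apply, Matrix.submatrix_apply, id]
  have hVsum : ∀ i : Fin d, ∑ j, (Q.transpose * Q.submatrix id (Fin.castLE hk)) i j ^ 2 =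
      if (i : ℕ) < k then 1 else 0 := by
    intro i
    simp_rw [hV]
    split_ifs with hi
    · rw [Finset.sum_eq_single ⟨i, hi⟩]
      · simp
      · intro b _ hb
        rw [if_neg, zero_pow two_ne_zero]
        intro h
        exact hb (Fin.ext (by simp [h]))
      · simp
    · refine Finset.sum_eq_zero fun j _ => ?_
      rw [if_neg, zero_pow two_ne_zero]
      intro h
      exact hi (by rw [h]; exact j.2)
  have htot : ∀ X : Matrix (Fin d) (Fin k) ℝ, X.transpose * X = 1 → ∑ i, ∑ j, X i j ^ 2 = k := by
    intro X hX
    have := trace_transpose_mul_self X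
    rw [hX, Matrix.trace_one, Fintype.card_fin] at this
    exact this.symm
  have hVV : (Q.transpose * Q.submatrix id (Fin.castLE hk)).transpose *
      (Q.transpose * Q.submatrix id (Fin.castLE hk)) = 1 := by
    have := IsTopEigenvectors.orthonormal (M := Q * Matrix.diagonal ev * Q.transpose)
      (V := Q.submatrix id (Fin.castLE hk)) ⟨hk, Q, ev, hQ, hev, rfl, rfl⟩
    rw [Matrix.transpose_mul, Matrix.transpose_transpose, Matrix.mul_assoc,
      ← Matrix.mul_assoc Q, hQQ, Matrix.one_mul, this]
  have e1 := htot W hWW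
  have e2 := htot _ hVV
  simp_rw [hVsum] at e2 ⊢
  rcases Nat.eq_zero_or_pos k with rfl | hk0
  · simp
  have hlast : k - 1 < d := by omega
  -- The rows of `W` carry weights in `[0, 1]` of total `k`; moving them to the first `k` indices
  -- can only increase the weighted sum, as seen relative to the `k`-th eigenvalue `μ`.
  set μ := ev ⟨k - 1, hlast⟩ with hμ
  have hterm : ∀ i : Fin d, 0 ≤ (ev i - μ) * ((if (i : ℕ) < k then 1 else 0) - ∑ j, W i j ^ 2) := by
    intro i
    split_ifs with hi
    · refine mul_nonneg (sub_nonneg.2 (hev ?_)) (sub_nonneg.2 (sum_sq_row_le_one hWW i))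
      rw [Fin.le_def]
      change (i : ℕ) ≤ k - 1
      omega
    · refine mul_nonneg_of_nonpos_of_nonpos (sub_nonpos.2 (hev ?_)) ?_
      · rw [Fin.le_def]
        change k - 1 ≤ (i : ℕ)
        omega
      · rw [zero_sub, neg_nonpos]
        exact Finset.sum_nonneg fun j _ => sq_nonneg _
  have hs := Finset.sum_nonneg fun i (_ : i ∈ Finset.univ) => hterm i
  have hexp : ∑ i : Fin d, (ev i - μ) * ((if (i : ℕ) < k then 1 else 0) - ∑ j, W i j ^ 2) =
      (∑ i : Fin d, ev i * (if (i : ℕ) < k then 1 else 0) - ∑ i, ev i * ∑ j, W i j ^ 2) -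
        μ * (∑ i : Fin d, (if (i : ℕ) < k then 1 else 0) - ∑ i, ∑ j, W i j ^ 2) := by
    rw [← Finset.sum_sub_distrib, ← Finset.sum_sub_distrib, Finset.mul_sum,
      ← Finset.sum_sub_distrib]
    exact Finset.sum_congr rfl fun i _ => by ring
  rw [hexp, e1, e2] at hs
  linarith

/-- The component of the columns of `U` orthogonal to the columns of `V`. -/
def residual (V U : Matrix (Fin d) (Fin k) ℝ) : Matrix (Fin d) (Fin k) ℝ :=
  U - V * (V.transpose * U)

lemma transpose_residual_mul {V U : Matrix (Fin d) (Fin k) ℝ} (hV : V.transpose * V = 1)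
    (hU : U.transpose * U = 1) :
    (residual V U).transpose * residual V U =
      1 - (V.transpose * U).transpose * (V.transpose * U) := by
  have h1 : V.transpose * (V * (V.transpose * U)) = V.transpose * U := by
    rw [← Matrix.mul_assoc, hV, Matrix.one_mul]
  simp only [residual, Matrix.transpose_sub, Matrix.transpose_mul, Matrix.transpose_transpose,
    Matrix.sub_mul, Matrix.mul_sub, hU, Matrix.mul_assoc, h1]
  abel

/-- The eigenspace perturbation bound in terms of the residual: compare the compressions of the
perturbed matrix to both column spaces by Ky Fan's principle. -/
lemma frobSq_residual_le {A : Matrix (Fin d) (Fin d) ℝ} {V U : Matrix (Fin d) (Fin k) ℝ}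
    (hV : IsTopEigenvectors A V) (hU : U.transpose * U = 1) {B : Matrix (Fin k) (Fin k) ℝ} {l : ℝ}
    (hl : 0 < l) (hB : ∀ η : Fin k → ℝ, l * ∑ i, η i ^ 2 ≤ ∑ i, ∑ j, η i * B i j * η j) :
    frobSq (residual V U) ≤ 2 * frobSq (A - U * B * U.transpose) / l ^ 2 := by
  have hVV := hV.orthonormal
  set E := A - U * B * U.transpose with hE
  set T := residual V U with hT
  set D := V * V.transpose - U * U.transpose with hD
  have hA : A = U * B * U.transpose + E := by rw [hE]; abel
  have hTT := transpose_residual_mul hVV hU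
  rw [← hT] at hTT
  have hp : frobSq T = k - ((V.transpose * U).transpose * (V.transpose * U)).trace := by
    rw [← trace_transpose_mul_self, hTT, Matrix.trace_sub, Matrix.trace_one, Fintype.card_fin]
  have hUVVU : (V.transpose * U).transpose * (V.transpose * U) =
      U.transpose * V * V.transpose * U := by
    simp only [Matrix.transpose_mul, Matrix.transpose_transpose, Matrix.mul_assoc]
  -- The Frobenius distance of the two orthogonal projections.
  have hDs : D.transpose = D := by
    simp only [hD, Matrix.transpose_sub, Matrix.transpose_mul, Matrix.transpose_transpose]
  have hDD : frobSq D = 2 * frobSq T := by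
    have h1 : D * D = V * V.transpose + U * U.transpose - V * V.transpose * (U * U.transpose) -
        U * U.transpose * (V * V.transpose) := by
      have e1 : V * V.transpose * (V * V.transpose) = V * V.transpose := by
        rw [Matrix.mul_assoc, ← Matrix.mul_assoc V.transpose, hVV, Matrix.one_mul]
      have e2 : U * U.transpose * (U * U.transpose) = U * U.transpose := by
        rw [Matrix.mul_assoc, ← Matrix.mul_assoc U.transpose, hU, Matrix.one_mul]
      rw [hD, Matrix.sub_mul, Matrix.mul_sub, Matrix.mul_sub, e1, e2]
      abel
    have e3 : (V * V.transpose).trace = k := by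
      rw [Matrix.trace_mul_comm, hVV, Matrix.trace_one, Fintype.card_fin]
    have e4 : (U * U.transpose).trace = k := by
      rw [Matrix.trace_mul_comm, hU, Matrix.trace_one, Fintype.card_fin]
    have e5 : (U * U.transpose * (V * V.transpose)).trace =
        (U.transpose * V * V.transpose * U).trace := by
      rw [Matrix.mul_assoc, Matrix.trace_mul_comm]
      simp only [Matrix.mul_assoc]
    have e6 : (V * V.transpose * (U * U.transpose)).trace =
        (U.transpose * V * V.transpose * U).trace := by
      rw [Matrix.trace_mul_comm, e5]
    rw [← trace_transpose_mul_self, hDs, h1, Matrix.trace_sub, Matrix.trace_sub, Matrix.trace_add,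
      e3, e4, e5, e6, hp, hUVVU]
    ring
  -- The loss of signal is controlled by the residual.
  have hloss : l * frobSq T ≤ (B * (T.transpose * T)).trace := by
    have h1 : (B * (T.transpose * T)).trace = ∑ a, ∑ i, ∑ j, T a i * B i j * T a j := by
      rw [← Matrix.mul_assoc, Matrix.trace_mul_comm]
      simp only [Matrix.trace, Matrix.diag, Matrix.mul_apply, Matrix.transpose_apply,
        Finset.mul_sum, mul_assoc]
    rw [h1, frobSq, Finset.mul_sum]
    exact Finset.sum_le_sum fun a _ => hB (T a)
  have hsplit : ∀ W : Matrix (Fin d) (Fin k) ℝ, (W.transpose * A * W).trace =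
      (W.transpose * (U * B * U.transpose) * W).trace + (E * (W * W.transpose)).trace := by
    intro W
    conv_lhs => rw [hA]
    rw [Matrix.mul_add, Matrix.add_mul, Matrix.trace_add]
    congr 1
    rw [Matrix.mul_assoc, Matrix.trace_mul_comm, Matrix.mul_assoc]
  have hky := trace_compression_le hV hU
  rw [hsplit, hsplit] at hky
  have hsU : (U.transpose * (U * B * U.transpose) * U).trace = B.trace := by
    have : U.transpose * (U * B * U.transpose) * U =
        (U.transpose * U) * B * (U.transpose * U) := by simp only [Matrix.mul_assoc]
    rw [this, hU, Matrix.one_mul, Matrix.mul_one]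
  have hsV : (V.transpose * (U * B * U.transpose) * V).trace =
      B.trace - (B * (T.transpose * T)).trace := by
    have h1 : V.transpose * (U * B * U.transpose) * V =
        (V.transpose * U) * (B * (U.transpose * V)) := by simp only [Matrix.mul_assoc]
    rw [h1, Matrix.trace_mul_comm, hTT, hUVVU, Matrix.mul_sub, Matrix.mul_one, Matrix.trace_sub]
    simp only [Matrix.mul_assoc, sub_sub_cancel]
  have hcs : (E * D).trace ≤ frobSq E / l + l / 4 * frobSq D := by
    have h1 : (E * D).trace = ∑ a, ∑ b, E a b * D a b := by
      simp only [Matrix.trace, Matrix.diag, Matrix.mul_apply]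
      refine Finset.sum_congr rfl fun a _ => Finset.sum_congr rfl fun b _ => ?_
      rw [show D b a = D.transpose a b from rfl, hDs]
    rw [h1, frobSq, frobSq, Finset.sum_div, Finset.mul_sum, ← Finset.sum_add_distrib]
    refine Finset.sum_le_sum fun a _ => ?_
    rw [Finset.sum_div, Finset.mul_sum, ← Finset.sum_add_distrib]
    refine Finset.sum_le_sum fun b _ => ?_
    have : E a b ^ 2 / l + l / 4 * D a b ^ 2 - E a b * D a b = (E a b - l / 2 * D a b) ^ 2 / l := by
      field_simp
      ring
    have h2 : 0 ≤ (E a b - l / 2 * D a b) ^ 2 / l := by positivity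
    linarith
  have hED : (E * D).trace = (E * (V * V.transpose)).trace - (E * (U * U.transpose)).trace := by
    rw [hD, Matrix.mul_sub, Matrix.trace_sub]
  rw [le_div_iff₀ (by positivity)]
  have hfin : l * frobSq T ≤ frobSq E / l + l / 4 * (2 * frobSq T) := by
    rw [← hDD]
    linarith
  have hq : frobSq E / l * l = frobSq E := by field_simp
  nlinarith [mul_le_mul_of_nonneg_right hfin hl.le]

/-- A near-isometry `VᵀU` is close to an orthogonal matrix, namely the orthogonal factor of its
polar decomposition. -/
lemma exists_rotation {V U : Matrix (Fin d) (Fin k) ℝ} (hV : V.transpose * V = 1)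
    (hU : U.transpose * U = 1) (hT : frobSq (residual V U) < 1) :
    ∃ R : Matrix (Fin k) (Fin k) ℝ, R.transpose * R = 1 ∧
      frobSq (V * R - U) ≤ 2 * frobSq (residual V U) := by
  set S := V.transpose * U with hS
  set T := residual V U
  have hTT : T.transpose * T = 1 - S.transpose * S := transpose_residual_mul hV hU
  have hH : (S.transpose * S).IsHermitian := Matrix.isHermitian_conjTranspose_mul_self S
  set e := hH.eigenvalues with he
  set O : Matrix (Fin k) (Fin k) ℝ := (hH.eigenvectorUnitary : Matrix (Fin k) (Fin k) ℝ) with hO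
  have hOO : O.transpose * O = 1 :=
    (Matrix.mem_orthogonalGroup_iff' _ _).1 hH.eigenvectorUnitary.2
  have hspec : S.transpose * S = O * Matrix.diagonal e * O.transpose := by
    have := hH.spectral_theorem
    rw [Unitary.conjStarAlgAut_apply] at this
    exact this
  have hdiag : O.transpose * (S.transpose * S) * O = Matrix.diagonal e := by
    rw [hspec]
    calc _ = (O.transpose * O) * Matrix.diagonal e * (O.transpose * O) := by
          simp only [Matrix.mul_assoc]
      _ = _ := by rw [hOO, Matrix.one_mul, Matrix.mul_one]
  have h1e : (T * O).transpose * (T * O) = 1 - Matrix.diagonal e := by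
    calc _ = O.transpose * (T.transpose * T) * O := by
          simp only [Matrix.transpose_mul, Matrix.mul_assoc]
      _ = _ := by rw [hTT, Matrix.mul_sub, Matrix.sub_mul, hdiag, Matrix.mul_one, hOO]
  have hentry : ∀ i, 1 - e i = ∑ a, (T * O) a i ^ 2 := by
    intro i
    have := congrFun (congrFun h1e i) i
    rw [Matrix.mul_apply, Matrix.sub_apply, Matrix.one_apply_eq, Matrix.diagonal_apply_eq] at this
    rw [← this]
    exact Finset.sum_congr rfl fun a _ => by rw [Matrix.transpose_apply, sq]
  have hle : ∀ i, 0 ≤ 1 - e i := fun i => by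
    rw [hentry]; exact Finset.sum_nonneg fun _ _ => sq_nonneg _
  -- The eigenvalues of `SᵀS` are in `(0, 1]`, since their deficits `1 - e i` sum to `‖T‖_F² < 1`.
  have hsum : ∑ i, (1 - e i) = frobSq T := by
    have h1 : O * O.transpose = 1 := (Matrix.mem_orthogonalGroup_iff _ _).1 hH.eigenvectorUnitary.2
    rw [← trace_transpose_mul_self, hTT, hspec, Matrix.trace_sub, Matrix.trace_mul_comm,
      ← Matrix.mul_assoc, hOO, Matrix.one_mul, Matrix.trace_diagonal, Matrix.trace_one,
      Finset.sum_sub_distrib]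
    simp
  have hpos : ∀ i, 0 < e i := fun i => by
    have := Finset.single_le_sum (fun j _ => hle j) (Finset.mem_univ i)
    rw [hsum] at this
    linarith
  -- The orthogonal factor `S (SᵀS)^{-1/2}`.
  set g : Fin k → ℝ := fun i => (√(e i))⁻¹ with hg
  set R := S * O * Matrix.diagonal g * O.transpose with hR
  have hRR : R.transpose * R = 1 := by
    have h1 : R.transpose * R = O * (Matrix.diagonal g *
        (O.transpose * (S.transpose * S) * O) * Matrix.diagonal g) * O.transpose := by
      simp only [hR, Matrix.transpose_mul, Matrix.transpose_transpose, Matrix.diagonal_transpose,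
        Matrix.mul_assoc]
    have h2 : ∀ i, g i * e i * g i = 1 := fun i => by
      have := Real.mul_self_sqrt (hpos i).le
      have h3 := Real.sqrt_pos.2 (hpos i)
      simp only [hg]
      field_simp
      rw [sq, this]
    rw [h1, hdiag, Matrix.diagonal_mul_diagonal, Matrix.diagonal_mul_diagonal]
    simp_rw [h2]
    rw [Matrix.diagonal_one, Matrix.mul_one]
    exact (Matrix.mem_orthogonalGroup_iff _ _).1 hH.eigenvectorUnitary.2
  have htr : (R.transpose * S).trace = ∑ i, √(e i) := by
    have h1 : R.transpose * S = O * (Matrix.diagonal g * (O.transpose * (S.transpose * S))) := by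
      simp only [hR, Matrix.transpose_mul, Matrix.transpose_transpose, Matrix.diagonal_transpose,
        Matrix.mul_assoc]
    rw [h1, Matrix.trace_mul_comm, Matrix.mul_assoc, hdiag, Matrix.diagonal_mul_diagonal,
      Matrix.trace_diagonal]
    refine Finset.sum_congr rfl fun i _ => ?_
    have := Real.mul_self_sqrt (hpos i).le
    have h3 := Real.sqrt_pos.2 (hpos i)
    simp only [hg]
    field_simp
    rw [sq, this]
  refine ⟨R, hRR, ?_⟩
  have hexp : (V * R - U).transpose * (V * R - U) =
      (1 - R.transpose * S) - (S.transpose * R - 1) := by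
    have h1 : R.transpose * (V.transpose * (V * R)) = 1 := by
      rw [← Matrix.mul_assoc V.transpose, hV, Matrix.one_mul, hRR]
    simp only [Matrix.transpose_sub, Matrix.transpose_mul, Matrix.sub_mul, Matrix.mul_sub, hU,
      Matrix.mul_assoc, h1, hS, Matrix.transpose_transpose]
    abel
  have htr2 : (S.transpose * R).trace = (R.transpose * S).trace := by
    rw [← Matrix.trace_transpose, Matrix.transpose_mul, Matrix.transpose_transpose]
  rw [← trace_transpose_mul_self, hexp, Matrix.trace_sub, Matrix.trace_sub, Matrix.trace_sub, htr2,
    htr, Matrix.trace_one, Fintype.card_fin, ← hsum, Finset.sum_sub_distrib]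
  have hsq : ∑ i, e i ≤ ∑ i, √(e i) := by
    refine Finset.sum_le_sum fun i _ => Real.le_sqrt_of_sq_le ?_
    nlinarith [hle i, hpos i]
  simp only [Finset.sum_const, Finset.card_univ, Fintype.card_fin, nsmul_eq_mul, mul_one]
  linarith

/-- A Davis-Kahan bound for the distance with optimal rotation. -/
theorem rotDist_sq_le {A : Matrix (Fin d) (Fin d) ℝ} {V U : Matrix (Fin d) (Fin k) ℝ} (hk : 0 < k)
    (hV : IsTopEigenvectors A V) (hU : U.transpose * U = 1) {B : Matrix (Fin k) (Fin k) ℝ} {l : ℝ}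
    (hl : 0 < l) (hB : ∀ η : Fin k → ℝ, l * ∑ i, η i ^ 2 ≤ ∑ i, ∑ j, η i * B i j * η j) :
    rotDist V U ^ 2 ≤ 8 * k * frobSq (A - U * B * U.transpose) / l ^ 2 := by
  have hVV := hV.orthonormal
  have hres := frobSq_residual_le hV hU hl hB
  have hk1 : (1 : ℝ) ≤ k := by exact_mod_cast hk
  set p := frobSq (residual V U) with hp
  have hgoal : rotDist V U ^ 2 ≤ 4 * k * p := by
    rcases lt_or_ge p 1 with h | h
    · obtain ⟨R, hR, hRU⟩ := exists_rotation hVV hU h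
      have := rotDist_sq_le_frobSq V U hR
      nlinarith [frobSq_nonneg (residual V U)]
    -- For a large residual the trivial bound `‖V - U‖_F² ≤ 4 k` suffices.
    · have h1 := rotDist_sq_le_frobSq V U (R := 1) (by simp)
      have h2 : frobSq (V * (1 : Matrix (Fin k) (Fin k) ℝ) - U) + frobSq (V + U) = 4 * k := by
        rw [← trace_transpose_mul_self, ← trace_transpose_mul_self, ← Matrix.trace_add,
          Matrix.mul_one]
        have : (V - U).transpose * (V - U) + (V + U).transpose * (V + U) = (4 : ℝ) • 1 := by
          simp only [Matrix.transpose_sub, Matrix.transpose_add, Matrix.sub_mul, Matrix.mul_sub,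
            Matrix.add_mul, Matrix.mul_add, hU, hVV]
          module
        rw [this, Matrix.trace_smul, Matrix.trace_one, Fintype.card_fin, smul_eq_mul]
      have h3 := frobSq_nonneg (V + U)
      nlinarith
  refine hgoal.trans ?_
  calc 4 * k * p ≤ 4 * k * (2 * frobSq (A - U * B * U.transpose) / l ^ 2) := by gcongr
    _ = _ := by ring

/-- Square matrices with orthonormal columns differ by a rotation. -/
lemma rotDist_eq_zero {V U : Matrix (Fin d) (Fin d) ℝ} (hV : V.transpose * V = 1)
    (hU : U.transpose * U = 1) : rotDist V U = 0 := by
  have hVV : V * V.transpose = 1 := mul_eq_one_comm.1 hV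
  have h := rotDist_sq_le_frobSq V U (R := V.transpose * U) (by
    rw [Matrix.transpose_mul, Matrix.transpose_transpose, Matrix.mul_assoc, ← Matrix.mul_assoc V,
      hVV, Matrix.one_mul, hU])
  rw [← Matrix.mul_assoc, hVV, Matrix.one_mul, sub_self] at h
  have h0 : frobSq (0 : Matrix (Fin d) (Fin d) ℝ) = 0 := by simp [frobSq]
  rw [h0] at h
  exact pow_eq_zero_iff two_ne_zero |>.1 (le_antisymm h (sq_nonneg _))

/-- A matrix with orthonormal columns has at least as many rows as columns. -/
lemma le_of_orthonormal {U : Matrix (Fin d) (Fin k) ℝ} (hU : U.transpose * U = 1) : k ≤ d := by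
  have h1 := Matrix.rank_mul_le_right U.transpose U
  rw [hU, Matrix.rank_one, Fintype.card_fin] at h1
  exact h1.trans (by simpa using Matrix.rank_le_card_height U)

end

/-! ### The signal in the population matrix -/

section
variable {d k r : ℕ} {K σY : ℝ} {P : Measure (Vec d × ℝ)}
  {U : Matrix (Fin d) (Fin k) ℝ} {C h s : ℝ}

/-- The population matrix in the coordinates given by the columns of `U`. -/
def popIndexMatrix (P : Measure (Vec d × ℝ)) (U : Matrix (Fin d) (Fin k) ℝ) (h s : ℝ) :
    Matrix (Fin k) (Fin k) ℝ :=
  Matrix.of fun i j =>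
    ∫ θ, index U (gradMean P h θ) i * index U (gradMean P h θ) j ∂(gaussianLaw d s)

lemma memLp_index_gradMean (hL : MemLp (fun θ => gradMean P h θ) 2 (gaussianLaw d s))
    (i : Fin k) : MemLp (fun θ => index U (gradMean P h θ) i) 2 (gaussianLaw d s) := by
  have h1 : (fun θ => index U (gradMean P h θ) i) =
      fun θ => ∑ a, U a i * gradMean P h θ a := by
    ext θ
    simp [index, Matrix.mulVec, dotProduct]
  rw [h1]
  exact memLp_finsetSum _ fun a _ =>
    ((EuclideanSpace.proj a : Vec d →L[ℝ] ℝ).comp_memLp' hL).const_mul _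

lemma popMatrix_eq (hL : MemLp (fun θ => gradMean P h θ) 2 (gaussianLaw d s))
    (hU : ∀ θ, gradMean P h θ = matVec U (index U (gradMean P h θ))) :
    popMatrix P h s = U * popIndexMatrix P U h s * U.transpose := by
  have hint : ∀ i j, Integrable (fun θ =>
      index U (gradMean P h θ) i * index U (gradMean P h θ) j) (gaussianLaw d s) := fun i j =>
    (memLp_index_gradMean hL i).integrable_mul (memLp_index_gradMean hL j)
  ext a b
  have h1 : ∀ θ, gradMean P h θ a * gradMean P h θ b =
      ∑ i, ∑ j, U a i * U b j * (index U (gradMean P h θ) i * index U (gradMean P h θ) j) := by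
    intro θ
    have e : ∀ a, gradMean P h θ a = ∑ i, U a i * index U (gradMean P h θ) i := fun a => by
      conv_lhs => rw [hU θ]
      simp [matVec, Matrix.mulVec, dotProduct]
    rw [e a, e b, Finset.sum_mul_sum]
    exact Finset.sum_congr rfl fun i _ => Finset.sum_congr rfl fun j _ => by ring
  rw [popMatrix, Matrix.of_apply]
  simp_rw [h1]
  rw [integral_finsetSum _ fun i _ => integrable_finsetSum _ fun j _ => (hint i j).const_mul _]
  simp_rw [integral_finsetSum _ fun j _ => (hint _ j).const_mul _, integral_const_mul]
  simp only [Matrix.mul_apply, Matrix.transpose_apply, Finset.sum_mul, popIndexMatrix,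
    Matrix.of_apply]
  rw [Finset.sum_comm]
  exact Finset.sum_congr rfl fun j _ => Finset.sum_congr rfl fun i _ => by ring

lemma popIndexMatrix_quadForm (hL : MemLp (fun θ => gradMean P h θ) 2 (gaussianLaw d s))
    (η : Vec k) :
    ∑ i, ∑ j, η i * popIndexMatrix P U h s i j * η j =
      ∫ θ, inner ℝ η (index U (gradMean P h θ)) ^ 2 ∂(gaussianLaw d s) := by
  have hint : ∀ i j, Integrable (fun θ =>
      index U (gradMean P h θ) i * index U (gradMean P h θ) j) (gaussianLaw d s) := fun i j =>
    (memLp_index_gradMean hL i).integrable_mul (memLp_index_gradMean hL j)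
  have h1 : ∀ θ, inner ℝ η (index U (gradMean P h θ)) ^ 2 =
      ∑ i, ∑ j, η i * η j * (index U (gradMean P h θ) i * index U (gradMean P h θ) j) := by
    intro θ
    rw [inner_eq_dotProduct, dotProduct, sq, Finset.sum_mul_sum]
    exact Finset.sum_congr rfl fun i _ => Finset.sum_congr rfl fun j _ => by ring
  simp_rw [h1]
  rw [integral_finsetSum _ fun i _ => integrable_finsetSum _ fun j _ => (hint i j).const_mul _]
  simp_rw [integral_finsetSum _ fun j _ => (hint _ j).const_mul _, integral_const_mul]
  refine Finset.sum_congr rfl fun i _ => Finset.sum_congr rfl fun j _ => ?_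
  rw [popIndexMatrix, Matrix.of_apply]
  ring

variable [IsProbabilityMeasure P]

lemma measurable_gradMean (h : ℝ) : Measurable fun θ => gradMean P h θ :=
  ((measurable_gradObs h).stronglyMeasurable.integral_prod_right (ν := P)).measurable

lemma memLp_gradMean {f : Vec k → ℝ} (hf : Measurable f) (hd : 0 < d) (hK : 0 < K) (hσ : 0 < σY)
    (hmod : PolynomialModel r K σY P U f) (hC0 : 0 ≤ C) (hC : ∀ z, |f z| ≤ C * (1 + ‖z‖) ^ r)
    (hh : 0 < h) (hh2 : h ^ 2 ≤ 5 / 4) (hs : 0 < s) (hs2 : 20 * s ^ 2 < h ^ 2) :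
    MemLp (fun θ => gradMean P h θ) 2 (gaussianLaw d s) := by
  have hm := measurable_gradMean (P := P) h
  have := isProbabilityMeasure_gaussianLaw d s
  rw [memLp_two_iff_integrable_sq_norm hm.aestronglyMeasurable]
  refine ⟨(hm.norm.pow_const 2).aestronglyMeasurable, ?_⟩
  rw [hasFiniteIntegral_iff_ofReal (Filter.Eventually.of_forall fun z => sq_nonneg _)]
  set c := estConst k r C K σY * h ^ (-2 : ℤ) with hc
  have hle : ∀ θ, ENNReal.ofReal (‖gradMean P h θ‖ ^ 2) ≤
      1 + ENNReal.ofReal (c ^ 2) * ENNReal.ofReal (envelope U r h θ ^ 2) := by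
    intro θ
    have h1 := gradMean_sq_add_le hf hd hK hσ hmod hC0 hC hh hh2 θ
    have h2 : 0 ≤ (1 / (d : ℝ)) * ∫ z, ‖gradObs h θ z‖ ^ 2 ∂P :=
      mul_nonneg (by positivity) (integral_nonneg fun z => sq_nonneg _)
    rw [← ENNReal.ofReal_mul (sq_nonneg _), ← ENNReal.ofReal_one,
      ← ENNReal.ofReal_add zero_le_one (by positivity)]
    refine ENNReal.ofReal_le_ofReal ?_
    nlinarith [sq_nonneg (c * envelope U r h θ - 1)]
  refine (lintegral_mono hle).trans_lt ?_
  rw [lintegral_add_left measurable_const, lintegral_const_mul' _ _ ENNReal.ofReal_ne_top]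
  refine ENNReal.add_lt_top.2 ⟨by simp, ENNReal.mul_lt_top ENNReal.ofReal_lt_top ?_⟩
  exact (lintegral_envelope_sq_le hmod.orthonormal hd r hh hh2 hs hs2).trans_lt
    ENNReal.ofReal_lt_top

lemma integral_gaussianLaw_comp_index (hU : U.transpose * U = 1) {F : Vec k → ℝ}
    (hF : Measurable F) (s : ℝ) :
    ∫ θ, F (index U θ) ∂(gaussianLaw d s) = ∫ w, F (s • w) ∂(stdGaussian (Vec k)) := by
  rw [gaussianLaw, integral_map (by fun_prop) (Measurable.aestronglyMeasurable (by fun_prop)),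
    ← integral_comp_index hU (F := fun w => F (s • w)) (by fun_prop)]
  simp_rw [index_smul]

lemma norm_sq_mul_minSignal_le (q : MvPolynomial (Fin k) ℝ) (η : Vec k) :
    ‖η‖ ^ 2 * minSignal (polyFun q) ≤
      ∫ z, polyFun (dirDeriv q η) z ^ 2 ∂(stdGaussian (Vec k)) := by
  rcases eq_or_ne η 0 with rfl | hη
  · simp only [norm_zero, ne_eq, OfNat.ofNat_ne_zero, not_false_eq_true, zero_pow, zero_mul]
    exact integral_nonneg fun z => sq_nonneg _
  have hn : 0 < ‖η‖ := norm_pos_iff.2 hη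
  have h1 := minSignal_le q (η := ‖η‖⁻¹ • η) (by
    rw [norm_smul, norm_inv, norm_norm, inv_mul_cancel₀ hn.ne'])
  rw [← norm_polyL2_sq, map_smul, map_smul, norm_smul, mul_pow, Real.norm_eq_abs, sq_abs] at h1
  rw [← norm_polyL2_sq]
  calc ‖η‖ ^ 2 * minSignal (polyFun q) ≤
        ‖η‖ ^ 2 * ((‖η‖⁻¹) ^ 2 * ‖polyL2 k (dirDeriv q η)‖ ^ 2) := by gcongr
    _ = _ := by field_simp

/-- The population matrix restricted to the central mean subspace is bounded below: smoothing a
polynomial of bounded degree at the scales `h` and `s` keeps a positive part of its norm. -/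
theorem exists_popIndexMatrix_lower_bound (k r : ℕ) :
    ∃ c : ℝ, 0 < c ∧ ∀ {d : ℕ} {K σY C h s : ℝ} {P : Measure (Vec d × ℝ)} [IsProbabilityMeasure P]
      {U : Matrix (Fin d) (Fin k) ℝ} {q : MvPolynomial (Fin k) ℝ}, 0 < d → 0 < K → 0 < σY →
      q.totalDegree ≤ r → PolynomialModel r K σY P U (polyFun q) → 0 ≤ C →
      (∀ z, |polyFun q z| ≤ C * (1 + ‖z‖) ^ r) → 0 < h → h ^ 2 ≤ 5 / 4 → 0 < s →
      20 * s ^ 2 < h ^ 2 → ∀ η : Fin k → ℝ,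
      (c * ((s / h) ^ (r - 1) * min 1 h ^ (r - 1)) ^ 2 * minSignal (polyFun q)) * ∑ i, η i ^ 2 ≤
        ∑ i, ∑ j, η i * popIndexMatrix P U h s i j * η j := by
  obtain ⟨c, hc, hsmooth⟩ := exists_smoothing_lower_bound k (r - 1)
  refine ⟨c, hc, ?_⟩
  intro d K σY C h s P _ U q hd hK hσ hq hmod hC0 hC hh hh2 hs hs2 η
  have hL := memLp_gradMean (measurable_polyFun q) hd hK hσ hmod hC0 hC hh hh2 hs hs2
  have e1 := popIndexMatrix_quadForm (U := U) hL (WithLp.toLp 2 η)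
  simp only [inner_index_gradMean_eq hd hK hσ hmod hC hh hh2] at e1
  have hmeas : Measurable fun w : Vec k =>
      (∫ z, polyFun (dirDeriv q (WithLp.toLp 2 η)) (w + h • z) ∂(stdGaussian (Vec k))) ^ 2 := by
    refine Measurable.pow_const (StronglyMeasurable.integral_prod_right'
      (f := fun p : Vec k × Vec k =>
      polyFun (dirDeriv q (WithLp.toLp 2 η)) (p.1 + h • p.2)) ?_).measurable 2
    have := measurable_polyFun (dirDeriv q (WithLp.toLp 2 η))
    exact Measurable.stronglyMeasurable (by fun_prop)
  rw [integral_gaussianLaw_comp_index hmod.orthonormal hmeas] at e1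
  have hsh : s / h ≤ 1 := by
    rw [div_le_one hh]
    nlinarith
  have h2 := hsmooth (dirDeriv q (WithLp.toLp 2 η))
    ((totalDegree_dirDeriv_le q _).trans (Nat.sub_le_sub_right hq 1)) h (s / h) hh
    (div_pos hs hh) hsh
  have e2 : ∀ w z : Vec k, h • ((s / h) • w + z) = s • w + h • z := fun w z => by
    rw [smul_add, smul_smul, mul_div_cancel₀ _ hh.ne']
  simp only [e2] at h2
  refine le_trans ?_ (h2.trans (le_of_eq e1.symm))
  have h3 := norm_sq_mul_minSignal_le q (WithLp.toLp 2 η)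
  rw [EuclideanSpace.real_norm_sq_eq] at h3
  calc _ = c * ((s / h) ^ (r - 1) * min 1 h ^ (r - 1)) ^ 2 *
        ((∑ i, η i ^ 2) * minSignal (polyFun q)) := by ring
    _ ≤ _ := by gcongr

/-- A normalized polynomial of degree at most `r` grows at most like a fixed multiple of
`(1 + ‖z‖) ^ r`. -/
theorem exists_growth_const (k r : ℕ) :
    ∃ C : ℝ, 0 < C ∧ ∀ q : MvPolynomial (Fin k) ℝ, q.totalDegree ≤ r →
      ∫ z, polyFun q z ^ 2 ∂(gaussianLaw k 1) = 1 → ∀ z, |polyFun q z| ≤ C * (1 + ‖z‖) ^ r := by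
  obtain ⟨C, hC, h⟩ := exists_coeffNorm_le r (polyL2 k) (polyL2_injective k)
  refine ⟨C, hC, fun q hq hnorm z => ?_⟩
  rw [gaussianLaw_one, ← norm_polyL2_sq] at hnorm
  have h1 : ‖polyL2 k q‖ = 1 := by
    exact (pow_eq_one_iff_of_nonneg (norm_nonneg _) two_ne_zero).1 hnorm
  have h2 := h q hq
  rw [h1, mul_one] at h2
  exact (abs_polyFun_le q hq z).trans (by gcongr)

/-- The gradient signal of a link function of degree zero vanishes. -/
lemma one_le_degree (hk : 0 < k) {q : MvPolynomial (Fin k) ℝ} (hq : q.totalDegree ≤ r)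
    (hτ : 0 < minSignal (polyFun q)) : 1 ≤ r := by
  by_contra hr
  obtain rfl : r = 0 := by omega
  have h1 := minSignal_le q (η := EuclideanSpace.single ⟨0, hk⟩ 1) (by simp)
  rw [MvPolynomial.totalDegree_eq_zero_iff_eq_C.1 (Nat.le_zero.1 hq)] at h1 hτ
  have h2 : ∀ (a : ℝ) (η : Vec k), dirDeriv (MvPolynomial.C a) η = 0 := fun a η => by
    simp [dirDeriv_apply]
  simp only [h2] at h1
  simp only [polyFun, map_zero, ne_eq, OfNat.ofNat_ne_zero, not_false_eq_true, zero_pow,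
    integral_zero] at h1
  exact absurd h1 (not_le.2 hτ)

end

/-! ### The error of the estimated directions -/

/-- The error bound before the simplification of the factors, in squared form: Chebyshev's
inequality for the Frobenius error of the matrix, combined with the perturbation bound for the
leading eigenspace and the lower bound for the signal. -/
theorem exists_errorBound_of_sq_le {k : ℕ} (hk : 0 < k) (r : ℕ) {K σY : ℝ} (hK : 0 < K)
    (hσ : 0 < σY) :
    ∃ C : ℝ, 0 < C ∧ ∀ {d n m : ℕ} {P : Measure (Vec d × ℝ)} [IsProbabilityMeasure P]
      {U : Matrix (Fin d) (Fin k) ℝ} {f : Vec k → ℝ} {part : Fin n → Fin m × Fin 2}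
      {h s δ ε : ℝ}, PolynomialModel r K σY P U f → 0 < m → n = 2 * d * m → IsEqualSplit part →
      0 < h → h ^ 2 ≤ 5 / 4 → 0 < s → 20 * s ^ 2 < h ^ 2 → 0 < ε →
      C * ((1 / (m : ℝ)) * ((h ^ (-2 : ℤ)) ^ 2 * ((h ^ 2 * (2 - h ^ 2)) ^ (-(d : ℝ) / 2)) ^ 2 *
        (1 - 20 * (s ^ 2 / h ^ 2)) ^ (-(d : ℝ) / 2))) ≤
        δ * (ε * (((s / h) ^ (r - 1) * min 1 h ^ (r - 1)) ^ 2 * minSignal f)) ^ 2 →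
      ErrorBound P U part h s δ ε := by
  obtain ⟨C₀, hC₀, hgrowth⟩ := exists_growth_const k r
  obtain ⟨c, hc, hsignal⟩ := exists_popIndexMatrix_lower_bound k r
  set E := mseConst k r C₀ K σY with hE
  have hE0 : 0 ≤ E := by
    have := gaussMoment_nonneg k (2 * r * 2 * 2)
    have := gaussMoment_nonneg 1 (2 * (2 * 2))
    rw [hE, mseConst]
    positivity
  have hk' : (0 : ℝ) < k := by exact_mod_cast hk
  refine ⟨8 * k * (E + 1) / c ^ 2, by positivity, ?_⟩
  intro d n m P _ U f part h s δ ε hmod hm hn hpart hh hh2 hs hs2 hε hbound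
  obtain ⟨q, hq, hfq⟩ := hmod.polynomial
  obtain rfl : f = polyFun q := funext hfq
  have hd : 0 < d := hk.trans_le (le_of_orthonormal hmod.orthonormal)
  have hC := hgrowth q hq hmod.normalized
  have hτ := minSignal_pos hk hmod
  have hL := memLp_gradMean (measurable_polyFun q) hd hK hσ hmod hC₀.le hC hh hh2 hs hs2
  have hpop := popMatrix_eq hL
    (gradMean_eq_matVec (measurable_polyFun q) hd hK hσ hmod hC hh hh2)
  have hmse := lintegral_estMatrix_sub_sq_le_explicit (measurable_polyFun q) hd hK hσ hmod hC₀.le hC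
    hm hn hpart hh hh2 hs hs2
  set W := (1 / (m : ℝ)) * ((h ^ (-2 : ℤ)) ^ 2 * ((h ^ 2 * (2 - h ^ 2)) ^ (-(d : ℝ) / 2)) ^ 2 *
        (1 - 20 * (s ^ 2 / h ^ 2)) ^ (-(d : ℝ) / 2)) with hW
  have hω : 0 < 1 - 20 * (s ^ 2 / h ^ 2) := by
    have : 20 * (s ^ 2 / h ^ 2) < 1 := by
      rw [← mul_div_assoc, div_lt_one (by positivity)]
      exact hs2
    linarith
  have hW0 : 0 ≤ W := by
    have := (Real.rpow_pos_of_pos hω (-(d : ℝ) / 2)).le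
    rw [hW]
    positivity
  set g := ((s / h) ^ (r - 1) * min 1 h ^ (r - 1)) ^ 2 with hg
  have hg0 : 0 < g := by
    have : 0 < min 1 h := lt_min one_pos hh
    positivity
  set l := c * g * minSignal (polyFun q) with hl
  have hl0 : 0 < l := by positivity
  set F : (Fin m → Vec d) × (Fin n → Vec d × ℝ) → ℝ := fun ω =>
    ∑ a, ∑ b, (estMatrix (gaussianDensity d 1) h part ω.1 ω.2 a b - popMatrix P h s a b) ^ 2 with hF
  have hFm : Measurable F := Finset.measurable_sum _ fun a _ => Finset.measurable_sum _ fun b _ =>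
    ((measurable_estMatrix h part a b).sub_const _).pow_const 2
  set t := ε ^ 2 * l ^ 2 / (8 * k) with ht
  have ht0 : 0 < t := by positivity
  have hsub : {ω | ∃ V : Matrix (Fin d) (Fin k) ℝ,
      IsTopEigenvectors (estMatrix (gaussianDensity d 1) h part ω.1 ω.2) V ∧
        ε < rotDist V U} ⊆ {ω | ENNReal.ofReal t ≤ ENNReal.ofReal (F ω)} := by
    rintro ω ⟨V, hV, hεV⟩
    have h1 := rotDist_sq_le hk hV hmod.orthonormal hl0
      (hsignal hd hK hσ hq hmod hC₀.le hC hh hh2 hs hs2)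
    rw [← hpop] at h1
    have h2 : ε ^ 2 ≤ rotDist V U ^ 2 := pow_le_pow_left₀ hε.le hεV.le 2
    have h3 : frobSq (estMatrix (gaussianDensity d 1) h part ω.1 ω.2 - popMatrix P h s) = F ω := rfl
    rw [h3] at h1
    refine ENNReal.ofReal_le_ofReal ?_
    rw [ht, div_le_iff₀ (by positivity)]
    have h4 := h2.trans h1
    rw [le_div_iff₀ (by positivity)] at h4
    linarith
  refine (measure_mono hsub).trans ?_
  have hmarkov := (mul_meas_ge_le_lintegral₀ (μ := samplingLaw n m s P)
    hFm.ennreal_ofReal.aemeasurable (ENNReal.ofReal t)).trans hmse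
  have hfin : ENNReal.ofReal ((1 / (m : ℝ)) * (E * (h ^ (-2 : ℤ)) ^ 2 *
      ((h ^ 2 * (2 - h ^ 2)) ^ (-(d : ℝ) / 2)) ^ 2 *
        (1 - 20 * (s ^ 2 / h ^ 2)) ^ (-(d : ℝ) / 2))) ≤ ENNReal.ofReal t * ENNReal.ofReal δ := by
    rw [← ENNReal.ofReal_mul ht0.le]
    refine ENNReal.ofReal_le_ofReal ?_
    have e1 : (1 / (m : ℝ)) * (E * (h ^ (-2 : ℤ)) ^ 2 *
      ((h ^ 2 * (2 - h ^ 2)) ^ (-(d : ℝ) / 2)) ^ 2 *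
        (1 - 20 * (s ^ 2 / h ^ 2)) ^ (-(d : ℝ) / 2)) = E * W := by rw [hW]; ring
    have e2 : t * δ = δ * (ε * (g * minSignal (polyFun q))) ^ 2 * (c ^ 2 / (8 * k)) := by
      rw [ht, hl]; ring
    rw [e1, e2]
    calc E * W ≤ (E + 1) * W := by gcongr; linarith
      _ = 8 * k * (E + 1) / c ^ 2 * W * (c ^ 2 / (8 * k)) := by field_simp
      _ ≤ _ := by gcongr
  exact (ENNReal.mul_le_mul_iff_right (ENNReal.ofReal_pos.2 ht0).ne' ENNReal.ofReal_ne_top).1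
    (hmarkov.trans hfin)

/-- If the central mean subspace is the whole space, the estimate is exact. -/
lemma errorBound_of_le {d k r n m : ℕ} {K σY : ℝ} {P : Measure (Vec d × ℝ)} [IsProbabilityMeasure P]
    {U : Matrix (Fin d) (Fin k) ℝ} {f : Vec k → ℝ} {part : Fin n → Fin m × Fin 2} {h s δ ε : ℝ}
    (hmod : PolynomialModel r K σY P U f) (hdk : d ≤ k) (hε : 0 ≤ ε) :
    ErrorBound P U part h s δ ε := by
  obtain rfl : k = d := le_antisymm (le_of_orthonormal hmod.orthonormal) hdk
  have : {ω : (Fin m → Vec k) × (Fin n → Vec k × ℝ) | ∃ V : Matrix (Fin k) (Fin k) ℝ,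
      IsTopEigenvectors (estMatrix (gaussianDensity k 1) h part ω.1 ω.2) V ∧
        ε < rotDist V U} = ∅ := by
    rw [Set.eq_empty_iff_forall_notMem]
    rintro ω ⟨V, hV, hεV⟩
    rw [rotDist_eq_zero hV.orthonormal hmod.orthonormal] at hεV
    exact absurd hεV (not_lt.2 hε)
  rw [ErrorBound, this, measure_empty]
  exact zero_le

/-! ### The explicit factors -/

section
variable {d r : ℕ} {h s : ℝ}

lemma factorB_base_pos (hh : 0 < h) (hh2 : h ^ 2 < 5 / 4) : 0 < 5 * h ^ 8 - 4 * h ^ 10 := by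
  have : 5 * h ^ 8 - 4 * h ^ 10 = h ^ 8 * (5 - 4 * h ^ 2) := by ring
  rw [this]
  exact mul_pos (by positivity) (by linarith)

lemma factorB_base_le_one (h : ℝ) : 5 * h ^ 8 - 4 * h ^ 10 ≤ 1 := by
  have : 1 - (5 * h ^ 8 - 4 * h ^ 10) =
      (1 - h ^ 2) ^ 2 * (1 + 2 * h ^ 2 + 3 * h ^ 4 + 4 * h ^ 6) := by ring
  have h2 : 0 ≤ (1 - h ^ 2) ^ 2 * (1 + 2 * h ^ 2 + 3 * h ^ 4 + 4 * h ^ 6) := by positivity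
  linarith

lemma factorB_base_le_cube (hh2 : h ^ 2 < 5 / 4) :
    5 * h ^ 8 - 4 * h ^ 10 ≤ (h ^ 2 * (2 - h ^ 2)) ^ 3 := by
  have : (h ^ 2 * (2 - h ^ 2)) ^ 3 - (5 * h ^ 8 - 4 * h ^ 10) =
      h ^ 6 * (1 - h ^ 2) ^ 2 * (8 - h ^ 2) := by ring
  have h2 : 0 ≤ h ^ 6 * (1 - h ^ 2) ^ 2 * (8 - h ^ 2) :=
    mul_nonneg (by positivity) (by linarith)
  linarith

lemma factorB_one (d r : ℕ) : factorB 1 d r = 1 := by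
  norm_num [factorB]

lemma one_le_factorB (hr : 1 ≤ r) (hh : 0 < h) (hh2 : h ^ 2 < 5 / 4) : 1 ≤ factorB h d r := by
  have hr' : (1 : ℝ) ≤ r := by exact_mod_cast hr
  have h1 : 1 ≤ max (h ^ (-2 * (r : ℝ) + 1)) (h ^ ((r : ℝ) - 1)) := by
    rcases le_total h 1 with h1 | h1
    · exact (Real.one_le_rpow_of_pos_of_le_one_of_nonpos hh h1 (by linarith)).trans
        (le_max_left _ _)
    · exact (Real.one_le_rpow h1 (by linarith)).trans (le_max_right _ _)
  have h2 : 1 ≤ (5 * h ^ 8 - 4 * h ^ 10) ^ (-(d : ℝ) / 6) := by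
    refine Real.one_le_rpow_of_pos_of_le_one_of_nonpos (factorB_base_pos hh hh2)
      (factorB_base_le_one h) ?_
    have : (0 : ℝ) ≤ d := Nat.cast_nonneg d
    linarith
  exact one_le_mul_of_one_le_of_one_le h1 h2

lemma rpow_neg_half_eq (hh : 0 < h) (hh2 : h ^ 2 < 5 / 4) (d : ℕ) :
    (h ^ 2 * (2 - h ^ 2)) ^ (-(d : ℝ) / 2) = ((h ^ 2 * (2 - h ^ 2)) ^ 3) ^ (-(d : ℝ) / 6) := by
  have : 0 < h ^ 2 * (2 - h ^ 2) := mul_pos (by positivity) (by linarith)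
  rw [← Real.rpow_natCast _ 3, ← Real.rpow_mul this.le]
  congr 1
  push_cast
  ring

/-- The bandwidth factor dominates the contributions of the bandwidth to the variance and to the
signal. In dimension at least three, a factor `h⁻¹` can be absorbed for small `h`. -/
lemma variance_factor_le (hd : 3 ≤ d) (hr : 1 ≤ r) (hh : 0 < h) (hh2 : h ^ 2 < 5 / 4) :
    h ^ (-2 : ℤ) * (h ^ 2 * (2 - h ^ 2)) ^ (-(d : ℝ) / 2) ≤
      3 * ((min 1 h ^ (r - 1)) ^ 2 * factorB h d r) := by
  have hd' : (3 : ℝ) ≤ d := by exact_mod_cast hd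
  have hr1 : ((r - 1 : ℕ) : ℝ) = (r : ℝ) - 1 := by rw [Nat.cast_sub hr, Nat.cast_one]
  have hK0 : 0 < (h ^ 2 * (2 - h ^ 2)) ^ 3 :=
    pow_pos (mul_pos (by positivity) (by linarith)) 3
  have hG0 := factorB_base_pos hh hh2
  have hGK := factorB_base_le_cube hh2
  rw [rpow_neg_half_eq hh hh2]
  have hexp : -(d : ℝ) / 6 ≤ 0 := by linarith
  have hmono := Real.rpow_le_rpow_of_nonpos hG0 hGK hexp
  have hGp := Real.rpow_pos_of_pos hG0 (-(d : ℝ) / 6)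
  set G := 5 * h ^ 8 - 4 * h ^ 10 with hG
  set A := (h ^ 2 * (2 - h ^ 2)) ^ 3 with hA
  rw [factorB, ← hG]
  rcases le_total 1 h with h1 | h1
  · rw [min_eq_left h1, one_pow, one_pow, one_mul]
    have h2 : h ^ (-2 : ℤ) ≤ 1 := zpow_le_one_of_nonpos₀ h1 (by norm_num)
    have h3 : 1 ≤ max (h ^ (-2 * (r : ℝ) + 1)) (h ^ ((r : ℝ) - 1)) :=
      (Real.one_le_rpow h1 (by rw [← hr1]; positivity)).trans (le_max_right _ _)
    have h4 := Real.rpow_pos_of_pos hK0 (-(d : ℝ) / 6)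
    calc h ^ (-2 : ℤ) * A ^ (-(d : ℝ) / 6) ≤ 1 * G ^ (-(d : ℝ) / 6) := by gcongr
      _ ≤ 3 * (max (h ^ (-2 * (r : ℝ) + 1)) (h ^ ((r : ℝ) - 1)) * G ^ (-(d : ℝ) / 6)) := by
        nlinarith
  · rw [min_eq_right h1]
    have hratio : 1 / (5 * h ^ 2) ≤ A / G := by
      rw [div_le_div_iff₀ (by positivity) hG0]
      have e1 : A * (5 * h ^ 2) - 1 * G = h ^ 8 * (5 * ((2 - h ^ 2) ^ 3 - 1) + 4 * h ^ 2) := by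
        rw [hA, hG]; ring
      have e2 : 1 ≤ (2 - h ^ 2) ^ 3 := one_le_pow₀ (by nlinarith)
      have e3 : 0 ≤ h ^ 8 * (5 * ((2 - h ^ 2) ^ 3 - 1) + 4 * h ^ 2) := by
        refine mul_nonneg (by positivity) ?_
        nlinarith [sq_nonneg h]
      linarith
    have hone : 1 ≤ A / G := (one_le_div hG0).2 hGK
    -- The exponent `d / 6` is at least `1 / 2` because `d ≥ 3`.
    have hroot : h⁻¹ ≤ 3 * (A / G) ^ ((d : ℝ) / 6) := by
      have e1 : √(1 / (5 * h ^ 2)) ≤ (A / G) ^ ((d : ℝ) / 6) := by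
        rw [Real.sqrt_eq_rpow]
        exact (Real.rpow_le_rpow (by positivity) hratio (by norm_num)).trans
          (Real.rpow_le_rpow_of_exponent_le hone (by linarith))
      have e2 : h⁻¹ / 3 ≤ √(1 / (5 * h ^ 2)) := by
        refine Real.le_sqrt_of_sq_le ?_
        rw [div_pow, inv_pow, div_le_div_iff₀ (by norm_num) (by positivity)]
        have : (h ^ 2)⁻¹ * h ^ 2 = 1 := inv_mul_cancel₀ (by positivity)
        nlinarith
      linarith
    have hsplit : (A / G) ^ ((d : ℝ) / 6) * A ^ (-(d : ℝ) / 6) = G ^ (-(d : ℝ) / 6) := by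
      rw [Real.div_rpow hK0.le hG0.le, neg_div, Real.rpow_neg hK0.le, Real.rpow_neg hG0.le]
      have := (Real.rpow_pos_of_pos hK0 ((d : ℝ) / 6)).ne'
      field_simp
    have hpow : (h ^ (r - 1)) ^ 2 * h ^ (-2 * (r : ℝ) + 1) = h⁻¹ := by
      rw [← pow_mul, ← Real.rpow_natCast, ← Real.rpow_add hh, ← Real.rpow_neg_one]
      congr 1
      push_cast
      rw [hr1]
      ring
    have hz : h ^ (-2 : ℤ) = h⁻¹ * h⁻¹ := by
      rw [zpow_neg, ← mul_inv, ← sq]; norm_cast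
    have hA4 := Real.rpow_pos_of_pos hK0 (-(d : ℝ) / 6)
    calc h ^ (-2 : ℤ) * A ^ (-(d : ℝ) / 6) = h⁻¹ * (h⁻¹ * A ^ (-(d : ℝ) / 6)) := by
          rw [hz]; ring
      _ ≤ h⁻¹ * (3 * (A / G) ^ ((d : ℝ) / 6) * A ^ (-(d : ℝ) / 6)) := by gcongr
      _ = 3 * (((h ^ (r - 1)) ^ 2 * h ^ (-2 * (r : ℝ) + 1)) * G ^ (-(d : ℝ) / 6)) := by
          rw [hpow, ← hsplit]; ring
      _ ≤ 3 * ((h ^ (r - 1)) ^ 2 * (max (h ^ (-2 * (r : ℝ) + 1)) (h ^ ((r : ℝ) - 1)) *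
            G ^ (-(d : ℝ) / 6))) := by
          rw [mul_assoc ((h ^ (r - 1)) ^ 2)]
          gcongr
          exact le_max_left _ _

lemma factorA_pos (hs : 0 < s) (hs2 : 20 * s < 1) : 0 < factorA s d r :=
  mul_pos (Real.rpow_pos_of_pos hs _) (Real.rpow_pos_of_pos (by linarith) _)

lemma factorA_eq_exp (hs : 0 < s) (hs2 : 20 * s < 1) :
    factorA s d r =
      Real.exp (-(((r : ℝ) - 1) * Real.log s + (d : ℝ) / 2 * Real.log (1 - 20 * s))) := by
  rw [factorA, Real.rpow_def_of_pos hs, Real.rpow_def_of_pos (by linarith), ← Real.exp_add]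
  congr 1
  ring

lemma optRatio_pos (hr : 2 ≤ r) : 0 < optRatio d r := by
  have : (2 : ℝ) ≤ r := by exact_mod_cast hr
  have : (0 : ℝ) ≤ d := Nat.cast_nonneg d
  exact div_pos (by linarith) (by linarith)

lemma one_sub_optRatio (hr : 2 ≤ r) :
    1 - 20 * optRatio d r = (d : ℝ) / (d + 2 * ((r : ℝ) - 1)) := by
  have : (2 : ℝ) ≤ r := by exact_mod_cast hr
  have : (0 : ℝ) ≤ d := Nat.cast_nonneg d
  have h1 : 20 * ((r : ℝ) - 1) + 10 * d ≠ 0 := by linarith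
  have h2 : (d : ℝ) + 2 * ((r : ℝ) - 1) ≠ 0 := by linarith
  rw [optRatio, eq_div_iff h2, sub_mul, ← mul_div_assoc, div_mul_eq_mul_div,
    sub_eq_iff_eq_add, ← sub_eq_iff_eq_add', eq_div_iff h1]
  ring

lemma optRatio_lt (hd : 0 < d) (hr : 2 ≤ r) : 20 * optRatio d r < 1 := by
  have : (2 : ℝ) ≤ r := by exact_mod_cast hr
  have hd' : (0 : ℝ) < d := by exact_mod_cast hd
  have h1 : 0 < (d : ℝ) / (d + 2 * ((r : ℝ) - 1)) := div_pos hd' (by linarith)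
  rw [← one_sub_optRatio hr] at h1
  linarith

/-- The optimal ratio is the maximizer of `s ^ a * (1 - 20 s) ^ b`, by `log t ≤ t - 1`. -/
lemma factorA_optRatio_le (hd : 0 < d) (hr : 2 ≤ r) (hs : 0 < s) (hs2 : 20 * s < 1) :
    factorA (optRatio d r) d r ≤ factorA s d r := by
  have hr' : (2 : ℝ) ≤ r := by exact_mod_cast hr
  have hd' : (0 : ℝ) < d := by exact_mod_cast hd
  have ho := optRatio_pos (d := d) hr
  have ho2 := optRatio_lt hd hr
  rw [factorA_eq_exp ho ho2, factorA_eq_exp hs hs2, Real.exp_le_exp, neg_le_neg_iff]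
  have h1 := Real.log_le_sub_one_of_pos (div_pos hs ho)
  have h2 := Real.log_le_sub_one_of_pos
    (div_pos (by linarith : 0 < 1 - 20 * s) (by linarith : 0 < 1 - 20 * optRatio d r))
  rw [Real.log_div hs.ne' ho.ne'] at h1
  rw [Real.log_div (by linarith) (by linarith)] at h2
  have h3 := mul_le_mul_of_nonneg_left h1 (by linarith : (0 : ℝ) ≤ (r : ℝ) - 1)
  have h4 := mul_le_mul_of_nonneg_left h2 (by linarith : (0 : ℝ) ≤ (d : ℝ) / 2)
  have h5 : ((r : ℝ) - 1) * (s / optRatio d r - 1) +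
      (d : ℝ) / 2 * ((1 - 20 * s) / (1 - 20 * optRatio d r) - 1) = 0 := by
    rw [one_sub_optRatio hr, optRatio]
    have h6 : (r : ℝ) - 1 ≠ 0 := by linarith
    have h7 : 20 * ((r : ℝ) - 1) + 10 * d ≠ 0 := by linarith
    have h8 : (d : ℝ) + 2 * ((r : ℝ) - 1) ≠ 0 := by linarith
    field_simp
    ring
  linarith

lemma rpow_neg_half_le_exp {a x : ℝ} (hd : 0 < d) (ha : 0 < a) (hx : (d : ℝ) / (d + 2 * a) ≤ x) :
    x ^ (-(d : ℝ) / 2) ≤ Real.exp a := by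
  have hd' : (0 : ℝ) < d := by exact_mod_cast hd
  have hx0 : 0 < x := (div_pos hd' (by linarith)).trans_le hx
  rw [Real.rpow_def_of_pos hx0, Real.exp_le_exp]
  have h1 := Real.one_sub_inv_le_log_of_pos hx0
  have h2 : x⁻¹ ≤ (d + 2 * a) / d := by
    rw [← inv_div]
    exact inv_anti₀ (by positivity) hx
  have h3 : ((d : ℝ) + 2 * a) / d = 1 + 2 * a / d := by field_simp
  have h4 : (2 * a / d) * d = 2 * a := by field_simp
  nlinarith

/-- With the optimal ratio, respectively any small ratio for linear link functions, the prefactor is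
of order `d ^ r`. -/
lemma factorA_bounds (hd : 0 < d) (hs : 0 < s)
    (h : (2 ≤ r ∧ s = optRatio d r) ∨ (r = 1 ∧ s ≤ 1 / (20 + 10 * (d : ℝ)))) :
    20 * s < 1 ∧ (1 / ((r : ℝ) + 1)) ^ (r - 1) * (d : ℝ) ^ r ≤ factorA s d r * d ∧
      factorA s d r * d ≤ 30 ^ (r - 1) * Real.exp r * (d : ℝ) ^ r := by
  have hd' : (1 : ℝ) ≤ d := by exact_mod_cast hd
  have hr : 1 ≤ r := by rcases h with h | h <;> omega
  have hr1 : (1 : ℝ) ≤ r := by exact_mod_cast hr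
  have hcast : (r : ℝ) - 1 = ((r - 1 : ℕ) : ℝ) := by rw [Nat.cast_sub hr, Nat.cast_one]
  have hA : factorA s d r = (s⁻¹) ^ (r - 1) * (1 - 20 * s) ^ (-(d : ℝ) / 2) := by
    rw [factorA, hcast, Real.rpow_neg hs.le, Real.rpow_natCast, inv_pow]
  have hdr : (d : ℝ) ^ r = (d : ℝ) ^ (r - 1) * d := by
    rw [← pow_succ, Nat.sub_add_cancel hr]
  suffices H : 20 * s < 1 ∧ ((1 / ((r : ℝ) + 1)) * d) ^ (r - 1) ≤ (s⁻¹) ^ (r - 1) ∧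
      (s⁻¹) ^ (r - 1) ≤ (30 * d) ^ (r - 1) ∧ (1 - 20 * s) ^ (-(d : ℝ) / 2) ≤ Real.exp r by
    obtain ⟨h1, h2, h3, h4⟩ := H
    have h5 : 1 ≤ (1 - 20 * s) ^ (-(d : ℝ) / 2) :=
      Real.one_le_rpow_of_pos_of_le_one_of_nonpos (by linarith) (by linarith) (by linarith)
    have h6 : 0 ≤ (s⁻¹) ^ (r - 1) := by positivity
    rw [mul_pow] at h2 h3
    refine ⟨h1, ?_, ?_⟩
    · rw [hA, hdr, ← mul_assoc]
      exact mul_le_mul_of_nonneg_right (h2.trans (le_mul_of_one_le_right h6 h5)) (by linarith)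
    · rw [hA, hdr, ← mul_assoc]
      refine mul_le_mul_of_nonneg_right ?_ (by linarith)
      calc _ ≤ (30 ^ (r - 1) * (d : ℝ) ^ (r - 1)) * Real.exp r := by gcongr
        _ = _ := by ring
  rcases h with ⟨hr2, rfl⟩ | ⟨rfl, hs2⟩
  · have hr2' : (2 : ℝ) ≤ r := by exact_mod_cast hr2
    have ha : 0 < (r : ℝ) - 1 := by linarith
    have hinv : (optRatio d r)⁻¹ = 20 + 10 * d / ((r : ℝ) - 1) := by
      rw [optRatio, inv_div]
      field_simp
    refine ⟨optRatio_lt hd hr2, pow_le_pow_left₀ (by positivity) ?_ _,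
      pow_le_pow_left₀ (by positivity) ?_ _, ?_⟩
    · rw [hinv, one_div_mul_eq_div]
      have : (d : ℝ) / (r + 1) ≤ 10 * d / ((r : ℝ) - 1) := by
        gcongr <;> linarith
      linarith
    · rw [hinv]
      have : 10 * d / ((r : ℝ) - 1) ≤ 10 * d := div_le_self (by positivity) (by linarith)
      linarith
    · refine (rpow_neg_half_le_exp hd ha (one_sub_optRatio hr2).ge).trans ?_
      exact Real.exp_le_exp.2 (by linarith)
  · have h0 : 20 * s ≤ 20 / (20 + 10 * d) := by
      calc 20 * s ≤ 20 * (1 / (20 + 10 * (d : ℝ))) := by gcongr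
        _ = _ := by ring
    have h1 : (20 : ℝ) / (20 + 10 * d) < 1 := by
      rw [div_lt_one (by positivity)]
      linarith
    refine ⟨by linarith, by simp, by simp, rpow_neg_half_le_exp hd (by norm_num) ?_⟩
    have h2 : (d : ℝ) / (d + 2 * ((1 : ℕ) : ℝ)) = 1 - 20 / (20 + 10 * d) := by
      push_cast
      field_simp
      ring
    rw [h2]
    linarith

end

/-! ### The error bound with explicit factors -/

lemma ErrorBound.mono {d k n m : ℕ} {P : Measure (Vec d × ℝ)} {U : Matrix (Fin d) (Fin k) ℝ}
    {part : Fin n → Fin m × Fin 2} {h s δ ε ε' : ℝ} (hb : ErrorBound P U part h s δ ε)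
    (hε : ε ≤ ε') : ErrorBound P U part h s δ ε' :=
  (measure_mono (by rintro ω ⟨V, hV, hlt⟩; exact ⟨V, hV, hε.trans_lt hlt⟩)).trans hb

lemma one_le_log_div {d : ℕ} {δ : ℝ} (hd : 0 < d) (hδ : 0 < δ) (hδ1 : δ < 1) :
    1 ≤ Real.log (8 * d / δ) := by
  have hd' : (1 : ℝ) ≤ d := by exact_mod_cast hd
  have h1 : 8 ≤ 8 * d / δ := by
    rw [le_div_iff₀ hδ]
    nlinarith
  rw [Real.le_log_iff_exp_le (by linarith)]
  linarith [Real.exp_one_lt_d9]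

lemma PolynomialModel.minSignal_pos_and_one_le {d k r : ℕ} (hk : 0 < k) {K σY : ℝ}
    {P : Measure (Vec d × ℝ)} [IsProbabilityMeasure P] {U : Matrix (Fin d) (Fin k) ℝ}
    {f : Vec k → ℝ} (hmod : PolynomialModel r K σY P U f) : 0 < minSignal f ∧ 1 ≤ r := by
  obtain ⟨q, hq, hfq⟩ := hmod.polynomial
  obtain rfl : f = polyFun q := funext hfq
  have := minSignal_pos hk hmod
  exact ⟨this, one_le_degree hk hq this⟩

/-- The error bound, for every factor `b` of the bandwidth that dominates the contributions of the
bandwidth to the variance and to the signal. -/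
theorem exists_errorBound_of_factor {k : ℕ} (hk : 0 < k) (r : ℕ) {K σY : ℝ} (hK : 0 < K)
    (hσ : 0 < σY) :
    ∃ C : ℝ, 0 < C ∧ ∀ {d n m : ℕ} {P : Measure (Vec d × ℝ)} [IsProbabilityMeasure P]
      {U : Matrix (Fin d) (Fin k) ℝ} {f : Vec k → ℝ} {part : Fin n → Fin m × Fin 2}
      {h s δ b : ℝ}, PolynomialModel r K σY P U f → 0 < m → n = 2 * d * m → IsEqualSplit part →
      0 < h → h ^ 2 ≤ 5 / 4 → 0 < s → 20 * s ^ 2 < h ^ 2 → 0 < δ → δ < 1 → 0 < b →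
      h ^ (-2 : ℤ) * (h ^ 2 * (2 - h ^ 2)) ^ (-(d : ℝ) / 2) ≤
        3 * ((min 1 h ^ (r - 1)) ^ 2 * b) →
      ErrorBound P U part h s δ
        (C * factorA (s ^ 2 / h ^ 2) d r * b * ((d : ℝ) / (minSignal f * √(n : ℝ))) *
          (Real.log (8 * d / δ) / √δ)) := by
  obtain ⟨C, hC, hmain⟩ := exists_errorBound_of_sq_le hk r hK hσ
  refine ⟨√(18 * C), by positivity, ?_⟩
  intro d n m P _ U f part h s δ b hmod hm hn hpart hh hh2 hs hs2 hδ hδ1 hb hle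
  obtain ⟨hτ, hr⟩ := hmod.minSignal_pos_and_one_le hk
  have hd : 0 < d := hk.trans_le (le_of_orthonormal hmod.orthonormal)
  have hd' : (1 : ℝ) ≤ d := by exact_mod_cast hd
  have hm' : (0 : ℝ) < m := by exact_mod_cast hm
  have hn' : (n : ℝ) = 2 * d * m := by rw [hn]; push_cast; ring
  have hn0 : (0 : ℝ) < n := by rw [hn']; positivity
  have hlog := one_le_log_div hd hδ hδ1
  have hq0 : 0 < s ^ 2 / h ^ 2 := by positivity
  have hq1 : 20 * (s ^ 2 / h ^ 2) < 1 := by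
    rw [← mul_div_assoc, div_lt_one (by positivity)]
    exact hs2
  have hA := factorA_pos (d := d) (r := r) hq0 hq1
  refine hmain hmod hm hn hpart hh hh2 hs hs2 (by positivity) ?_
  set ω := (1 - 20 * (s ^ 2 / h ^ 2)) ^ (-(d : ℝ) / 2) with hω
  have hω1 : 1 ≤ ω :=
    Real.one_le_rpow_of_pos_of_le_one_of_nonpos (by linarith) (by linarith) (by linarith)
  set X := h ^ (-2 : ℤ) * (h ^ 2 * (2 - h ^ 2)) ^ (-(d : ℝ) / 2) with hX
  set Y := (min 1 h ^ (r - 1)) ^ 2 * b with hY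
  set L := Real.log (8 * d / δ) with hL
  have hX0 : 0 ≤ X := by
    have : 0 ≤ h ^ 2 * (2 - h ^ 2) := mul_nonneg (by positivity) (by linarith)
    have := Real.rpow_nonneg this (-(d : ℝ) / 2)
    positivity
  -- The power of the ratio `s² / h²` cancels between the factor and the signal.
  have hcancel : factorA (s ^ 2 / h ^ 2) d r * ((s / h) ^ (r - 1)) ^ 2 = ω := by
    have h1 : ((s / h) ^ (r - 1)) ^ 2 = (s ^ 2 / h ^ 2) ^ ((r : ℝ) - 1) := by
      have : (r : ℝ) - 1 = ((r - 1 : ℕ) : ℝ) := by rw [Nat.cast_sub hr, Nat.cast_one]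
      rw [this, Real.rpow_natCast, ← div_pow, ← pow_mul, ← pow_mul, mul_comm]
    rw [factorA, h1, mul_right_comm, ← Real.rpow_add hq0, neg_add_cancel, Real.rpow_zero, one_mul]
  have hsq : δ * (√(18 * C) * factorA (s ^ 2 / h ^ 2) d r * b *
      ((d : ℝ) / (minSignal f * √(n : ℝ))) * (L / √δ) *
        (((s / h) ^ (r - 1) * min 1 h ^ (r - 1)) ^ 2 * minSignal f)) ^ 2 =
      9 * C * ω ^ 2 * Y ^ 2 * (d * L ^ 2) / m := by
    have e1 : √(18 * C) * factorA (s ^ 2 / h ^ 2) d r * b *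
        ((d : ℝ) / (minSignal f * √(n : ℝ))) * (L / √δ) *
          (((s / h) ^ (r - 1) * min 1 h ^ (r - 1)) ^ 2 * minSignal f) =
        √(18 * C) * (factorA (s ^ 2 / h ^ 2) d r * ((s / h) ^ (r - 1)) ^ 2) * Y * d * L /
          (√(n : ℝ) * √δ) := by
      have h1 := (Real.sqrt_pos.2 hn0).ne'
      have h2 := (Real.sqrt_pos.2 hδ).ne'
      rw [hY]
      field_simp
    rw [e1, hcancel, div_pow, mul_pow (√(n : ℝ)), mul_pow, mul_pow, mul_pow, mul_pow,
      Real.sq_sqrt (by positivity), Real.sq_sqrt hn0.le, Real.sq_sqrt hδ.le, hn']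
    field_simp
    ring
  rw [hsq]
  have h1 : (h ^ (-2 : ℤ)) ^ 2 * ((h ^ 2 * (2 - h ^ 2)) ^ (-(d : ℝ) / 2)) ^ 2 = X ^ 2 := by
    rw [hX, mul_pow]
  rw [h1]
  have h2 : X ^ 2 ≤ 9 * Y ^ 2 := by
    calc X ^ 2 ≤ (3 * Y) ^ 2 := pow_le_pow_left₀ hX0 hle 2
      _ = 9 * Y ^ 2 := by ring
  have h3 : (1 : ℝ) ≤ d * L ^ 2 := one_le_mul_of_one_le_of_one_le hd' (one_le_pow₀ hlog)
  have h4 : ω ≤ ω ^ 2 := by nlinarith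
  calc C * (1 / (m : ℝ) * (X ^ 2 * ω)) ≤ C * (1 / (m : ℝ) * (9 * Y ^ 2 * ω ^ 2)) := by gcongr
    _ = 9 * C * ω ^ 2 * Y ^ 2 * 1 / m := by ring
    _ ≤ 9 * C * ω ^ 2 * Y ^ 2 * (d * L ^ 2) / m := by gcongr

lemma sq_lt_of_lt_sqrt_five_div_two {h : ℝ} (hh : 0 < h) (hh2 : h < √5 / 2) : h ^ 2 < 5 / 4 := by
  calc h ^ 2 < (√5 / 2) ^ 2 := by gcongr
    _ = 5 / 4 := by rw [div_pow, Real.sq_sqrt (by norm_num)]; norm_num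

lemma twenty_mul_sq_lt {h s : ℝ} (hs : 0 < s) (hs2 : s < h / √20) : 20 * s ^ 2 < h ^ 2 := by
  have h20 : (0 : ℝ) < √20 := by positivity
  rw [lt_div_iff₀ h20] at hs2
  calc 20 * s ^ 2 = (s * √20) ^ 2 := by rw [mul_pow, Real.sq_sqrt (by norm_num)]; ring
    _ < h ^ 2 := by gcongr

end CMS

end

theorem corollary3p10 (k r : ℕ) (hk : 0 < k) (K σY : ℝ) (hK : 0 < K) (hσY : 0 < σY) :
    -- the error bound for all admissible bandwidths
    (∃ C₂ : ℝ, 0 < C₂ ∧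
      ∀ (d n m : ℕ) (P : MeasureTheory.Measure (CMS.Vec d × ℝ))
        [MeasureTheory.IsProbabilityMeasure P]
        (U : Matrix (Fin d) (Fin k) ℝ) (f : CMS.Vec k → ℝ) (part : Fin n → Fin m × Fin 2)
        (h σθ δ : ℝ),
        CMS.PolynomialModel r K σY P U f → ¬ (d = 2 ∧ k = 1) →
        0 < m → n = 2 * d * m → CMS.IsEqualSplit part →
        0 < h → h < √5 / 2 → 0 < σθ → σθ < h / √20 → 0 < δ → δ < 1 →
        CMS.ErrorBound P U part h σθ δ
          (C₂ * CMS.factorA (σθ ^ 2 / h ^ 2) d r * CMS.factorB h d r *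
            ((d : ℝ) / (CMS.minSignal f * √(n : ℝ))) * (Real.log (8 * d / δ) / √δ))) ∧
    -- the factors are minimized separately at the optimal ratio and at `h = 1`
    (2 ≤ r → ∀ d : ℕ, 0 < d →
      (CMS.optRatio d r ∈ Set.Ioo (0 : ℝ) (1 / 20) ∧
        IsMinOn (fun s => CMS.factorA s d r) (Set.Ioo (0 : ℝ) (1 / 20)) (CMS.optRatio d r)) ∧
      ((1 : ℝ) ∈ Set.Ioo (0 : ℝ) (√5 / 2) ∧
        IsMinOn (fun h => CMS.factorB h d r) (Set.Ioo (0 : ℝ) (√5 / 2)) 1)) ∧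
    -- with these choices the prefactor is of order `d ^ r`
    (∃ c₃ C₃ : ℝ, 0 < c₃ ∧ 0 < C₃ ∧
      ∀ (d : ℕ) (σθ : ℝ), 0 < d → 0 < σθ →
        ((2 ≤ r ∧ σθ ^ 2 = CMS.optRatio d r) ∨ (r = 1 ∧ σθ ^ 2 ≤ 1 / (20 + 10 * (d : ℝ)))) →
        (c₃ * (d : ℝ) ^ r ≤ CMS.factorA (σθ ^ 2) d r * CMS.factorB 1 d r * d ∧
          CMS.factorA (σθ ^ 2) d r * CMS.factorB 1 d r * d ≤ C₃ * (d : ℝ) ^ r) ∧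
        ∀ (n m : ℕ) (P : MeasureTheory.Measure (CMS.Vec d × ℝ))
          [MeasureTheory.IsProbabilityMeasure P]
          (U : Matrix (Fin d) (Fin k) ℝ) (f : CMS.Vec k → ℝ) (part : Fin n → Fin m × Fin 2)
          (δ : ℝ),
          CMS.PolynomialModel r K σY P U f →
          0 < m → n = 2 * d * m → CMS.IsEqualSplit part → 0 < δ → δ < 1 →
          CMS.ErrorBound P U part 1 σθ δ
            (C₃ * (d : ℝ) ^ r / (CMS.minSignal f * √(n : ℝ)) * (Real.log (8 * d / δ) / √δ))) := by
  obtain ⟨C, hC, hmain⟩ := CMS.exists_errorBound_of_factor hk r hK hσY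
  refine ⟨⟨C, hC, ?_⟩, ?_, ?_⟩
  · intro d n m P _ U f part h σθ δ hmod hdk hm hn hpart hh hh2 hs hs2 hδ hδ1
    have hh3 := CMS.sq_lt_of_lt_sqrt_five_div_two hh hh2
    have hs3 := CMS.twenty_mul_sq_lt hs hs2
    obtain ⟨hτ, hr⟩ := hmod.minSignal_pos_and_one_le hk
    have hB := zero_lt_one.trans_le (CMS.one_le_factorB (d := d) hr hh hh3)
    rcases Nat.lt_or_ge k d with hkd | hkd
    -- Since `(d, k) ≠ (2, 1)`, either `d ≥ 3` or the central mean subspace is the whole space.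
    · have hd : 3 ≤ d := by omega
      exact hmain hmod hm hn hpart hh hh3.le hs hs3 hδ hδ1 hB (CMS.variance_factor_le hd hr hh hh3)
    · have hd : 0 < d := hk.trans_le (CMS.le_of_orthonormal hmod.orthonormal)
      have hlog := CMS.one_le_log_div hd hδ hδ1
      have hA : 0 < CMS.factorA (σθ ^ 2 / h ^ 2) d r := CMS.factorA_pos (by positivity) (by
        rw [← mul_div_assoc, div_lt_one (by positivity)]
        exact hs3)
      exact CMS.errorBound_of_le hmod hkd (by positivity)
  · intro hr d hd
    have h1 := CMS.optRatio_lt hd hr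
    refine ⟨⟨⟨CMS.optRatio_pos hr, by linarith⟩, fun s hs =>
      CMS.factorA_optRatio_le hd hr hs.1 (by linarith [hs.2])⟩,
      ⟨one_pos, ?_⟩, fun h hh => ?_⟩
    · have : (2 : ℝ) < √5 := Real.lt_sqrt_of_sq_lt (by norm_num)
      linarith
    · change CMS.factorB 1 d r ≤ CMS.factorB h d r
      rw [CMS.factorB_one]
      exact CMS.one_le_factorB (by omega) hh.1 (CMS.sq_lt_of_lt_sqrt_five_div_two hh.1 hh.2)
  · set C' : ℝ := 30 ^ (r - 1) * Real.exp r with hC'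
    have hC'0 : 0 < C' := by positivity
    refine ⟨(1 / ((r : ℝ) + 1)) ^ (r - 1), (1 + C) * C', by positivity, by positivity, ?_⟩
    intro d σθ hd hσ hopt
    obtain ⟨h20, hlow, hup⟩ := CMS.factorA_bounds hd (by positivity : 0 < σθ ^ 2) hopt
    rw [CMS.factorB_one, mul_one]
    have hdr : 0 < (d : ℝ) ^ r := by positivity
    refine ⟨⟨hlow, hup.trans ?_⟩, ?_⟩
    · rw [add_mul, one_mul, add_mul]
      exact le_add_of_nonneg_right (by positivity)
    · intro n m P _ U f part δ hmod hm hn hpart hδ hδ1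
      obtain ⟨hτ, -⟩ := hmod.minSignal_pos_and_one_le hk
      have hlog := CMS.one_le_log_div hd hδ hδ1
      have hb := hmain (b := 1) hmod hm hn hpart one_pos (by norm_num) hσ (by simpa using h20) hδ
        hδ1 one_pos (by norm_num)
      refine hb.mono ?_
      have hn0 : (0 : ℝ) < n := by
        have : 0 < n := by rw [hn]; positivity
        exact_mod_cast this
      have hw : 0 < CMS.minSignal f * √(n : ℝ) := by positivity
      refine mul_le_mul_of_nonneg_right ?_ (by positivity)
      rw [one_pow, div_one, mul_one, ← mul_div_assoc]
      refine div_le_div_of_nonneg_right ?_ hw.le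
      calc C * CMS.factorA (σθ ^ 2) d r * d = C * (CMS.factorA (σθ ^ 2) d r * d) := by ring
        _ ≤ C * (C' * (d : ℝ) ^ r) := by gcongr
        _ ≤ (1 + C) * C' * (d : ℝ) ^ r := by nlinarith [mul_pos hC'0 hdr]
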